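/- Let $R$ be a commutative ring. All functors are covariant functors on the category of commutative $R$-algebras, and $\mathcal R$ is the functor of rings $\mathcal R(S)=S$. A functor of $\mathcal R$-modules $\mathbb M$ assigns to each $S$ an $S$-module $\mathbb M(S)$, functorially in $S$; a functor of $\mathcal R$-algebras $\mathbb A$ assigns to each $S$ an associative unital (not necessarily commutative) $S$-algebra $\mathbb A(S)$, functorially in $S$. Morphisms are natural transformations which are $S$-linear (respectively morphisms of $S$-algebras) for each $S$. Put $(\mathbb M\otimes_{\mathcal R}\mathbb N)(S)=\mathbb M(S)\otimes_S\mathbb N(S)$ and $\mathbb M^*(S)=\operatorname{Hom}_{\mathcal S}(\mathbb M_{|S},\mathcal S)$, where $\mathbb M_{|S}$ is the restriction of $\mathbb M$ to commutative $S$-algebras and $\mathcal S=\mathcal R_{|S}$, and put $$\mathbb M\,\tilde\otimes_{\mathcal R}\,\mathbb N:=(\mathbb M^*\otimes_{\mathcal R}\mathbb N^*)^*.$$ There is a natural morphism $\mathbb M\otimes_{\mathcal R}\mathbb N\to\mathbb M\tilde\otimes_{\mathcal R}\mathbb N$, $m\otimes n\mapsto(\varphi\otimes\psi\mapsto\varphi(m)\psi(n))$.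 A functor of $\mathcal R$-modules is essentially free if it is isomorphic to $\varprojlim_{\alpha\in P}\mathcal R^{(\alpha)}$ for some set $I$ and some set $P$ of subsets of $I$ closed under binary unions, where $\mathcal R^{(\alpha)}=\bigoplus_{\alpha}\mathcal R$ and the transition morphisms $\mathcal R^{(\beta)}\to\mathcal R^{(\alpha)}$, $\alpha\subseteq\beta$, are the restrictions. Let $\mathfrak F$ be the class of essentially free functors. For an $R$-algebra $D$, the functor $\mathcal D(S)=D\otimes_RS$ is called a quasi-coherent algebra. A quasi-coherent algebra quotient of $\mathbb A$ is a morphism of functors of $\mathcal R$-algebras $\mathbb A\to\mathcal D$ onto a quasi-coherent algebra that is surjective for each $S$. A functor of $\mathcal R$-algebras is called pro-quasicoherent if it is the inverse limit of its quasi-coherent algebra quotients. **Theorem.** Let $\mathbb A,\mathbb B$ be pro-quasicoherent functors of $\mathcal R$-algebras whose underlying functors of $\mathcal R$-modules lie in $\mathfrak F$. Then: 1. $\mathbb A\tilde\otimes_{\mathcal R}\mathbb B\in\mathfrak F$. 2. There is exactly one structure of functor of $\mathcal R$-algebras on the functor of $\mathcal R$-modules $\mathbb A\tilde\otimes_{\mathcal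 R}\mathbb B$ for which the natural morphism $\iota\colon\mathbb A\otimes_{\mathcal R}\mathbb B\to\mathbb A\tilde\otimes_{\mathcal R}\mathbb B$ is a morphism of functors of $\mathcal R$-algebras, and with this structure $\mathbb A\tilde\otimes_{\mathcal R}\mathbb B$ is pro-quasicoherent. 3. For every pro-quasicoherent functor of $\mathcal R$-algebras $\mathbb C$, composition with $\iota$ is a bijection $$\operatorname{Hom}_{\mathcal R\text{-alg}}(\mathbb A\tilde\otimes_{\mathcal R}\mathbb B,\mathbb C)\;\longrightarrow\;\operatorname{Hom}_{\mathcal R\text{-alg}}(\mathbb A\otimes_{\mathcal R}\mathbb B,\mathbb C).$$ -/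

import Mathlib

open scoped TensorProduct

universe u w w₁ w₂ w₃

noncomputable section

/-- A functor of `𝓡`-modules: a covariant functor `S ↦ M(S)` on commutative `R`-algebras, where
`M(S)` is an `S`-module and addition and scalar multiplication are natural in `S`. -/
structure ModFunctor (R : Type u) [CommRing R] where
  obj : ∀ (S : Type u) [CommRing S] [Algebra R S], Type w
  addCommGroup : ∀ (S : Type u) [CommRing S] [Algebra R S], AddCommGroup (obj S)
  module : ∀ (S : Type u) [CommRing S] [Algebra R S], Module S (obj S)
  map : ∀ {S T : Type u} [CommRing S] [Algebra R S] [CommRing T] [Algebra R T],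
    (S →ₐ[R] T) → (obj S →+ obj T)
  map_smul : ∀ {S T : Type u} [CommRing S] [Algebra R S] [CommRing T] [Algebra R T]
    (f : S →ₐ[R] T) (s : S) (m : obj S), map f (s • m) = f s • map f m
  map_id : ∀ {S : Type u} [CommRing S] [Algebra R S] (m : obj S), map (AlgHom.id R S) m = m
  map_comp : ∀ {S T U : Type u} [CommRing S] [Algebra R S] [CommRing T] [Algebra R T]
    [CommRing U] [Algebra R U] (g : T →ₐ[R] U) (f : S →ₐ[R] T) (m : obj S),
    map (g.comp f) m = map g (map f m)

attribute [instance] ModFunctor.addCommGroup ModFunctor.module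

/-- A functor of `𝓡`-algebras: a functor `S ↦ A(S)` to (associative, unital, not necessarily
commutative) rings with a natural ring morphism `S → A(S)` whose image is central. -/
structure AlgFunctor (R : Type u) [CommRing R] where
  obj : ∀ (S : Type u) [CommRing S] [Algebra R S], Type w
  ring : ∀ (S : Type u) [CommRing S] [Algebra R S], Ring (obj S)
  algebra : ∀ (S : Type u) [CommRing S] [Algebra R S], Algebra S (obj S)
  map : ∀ {S T : Type u} [CommRing S] [Algebra R S] [CommRing T] [Algebra R T],
    (S →ₐ[R] T) → (obj S →+* obj T)
  map_algebraMap : ∀ {S T : Type u} [CommRing S] [Algebra R S] [CommRing T] [Algebra R T]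
    (f : S →ₐ[R] T) (s : S), map f (algebraMap S (obj S) s) = algebraMap T (obj T) (f s)
  map_id : ∀ {S : Type u} [CommRing S] [Algebra R S] (a : obj S), map (AlgHom.id R S) a = a
  map_comp : ∀ {S T U : Type u} [CommRing S] [Algebra R S] [CommRing T] [Algebra R T]
    [CommRing U] [Algebra R U] (g : T →ₐ[R] U) (f : S →ₐ[R] T) (a : obj S),
    map (g.comp f) a = map g (map f a)

attribute [instance] AlgFunctor.ring AlgFunctor.algebra

variable {R : Type u} [CommRing R]

/-- The functor of `𝓡`-modules underlying a functor of `𝓡`-algebras. -/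
def AlgFunctor.toMod (A : AlgFunctor.{u, w} R) : ModFunctor.{u, w} R where
  obj S := A.obj S
  addCommGroup S := inferInstance
  module S := inferInstance
  map f := (A.map f).toAddMonoidHom
  map_smul f s a := by
    simp only [Algebra.smul_def, RingHom.toAddMonoidHom_eq_coe, AddMonoidHom.coe_coe, map_mul,
      A.map_algebraMap]
  map_id a := A.map_id a
  map_comp g f a := A.map_comp g f a

/-- Morphisms of functors of `𝓡`-modules. -/
@[ext]
structure ModHom (M : ModFunctor.{u, w₁} R) (N : ModFunctor.{u, w₂} R) where
  app : ∀ (S : Type u) [CommRing S] [Algebra R S], M.obj S →ₗ[S] N.obj S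
  naturality : ∀ {S T : Type u} [CommRing S] [Algebra R S] [CommRing T] [Algebra R T]
    (f : S →ₐ[R] T) (m : M.obj S), app T (M.map f m) = N.map f (app S m)

/-- Morphisms of functors of `𝓡`-algebras. -/
@[ext]
structure AlgFunctorHom (A : AlgFunctor.{u, w₁} R) (B : AlgFunctor.{u, w₂} R) where
  app : ∀ (S : Type u) [CommRing S] [Algebra R S], A.obj S →ₐ[S] B.obj S
  naturality : ∀ {S T : Type u} [CommRing S] [Algebra R S] [CommRing T] [Algebra R T]
    (f : S →ₐ[R] T) (a : A.obj S), app T (A.map f a) = B.map f (app S a)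

/-- Composition `g ∘ f` of morphisms of functors of `𝓡`-algebras. -/
def AlgFunctorHom.comp {A : AlgFunctor.{u, w₁} R} {B : AlgFunctor.{u, w₂} R}
    {C : AlgFunctor.{u, w₃} R} (g : AlgFunctorHom B C) (f : AlgFunctorHom A B) :
    AlgFunctorHom A C where
  app S := (g.app S).comp (f.app S)
  naturality h a := by simp [f.naturality, g.naturality]

/-- `M` and `N` are isomorphic as functors of `𝓡`-modules. -/
def ModFunctor.Isomorphic (M : ModFunctor.{u, w₁} R) (N : ModFunctor.{u, w₂} R) : Prop :=
  ∃ (f : ModHom M N) (g : ModHom N M),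
    (∀ (S : Type u) [CommRing S] [Algebra R S] (m : M.obj S), g.app S (f.app S m) = m) ∧
    (∀ (S : Type u) [CommRing S] [Algebra R S] (n : N.obj S), f.app S (g.app S n) = n)

variable (R) in
/-- The functor `𝓡`, `𝓡(S) = S`. -/
def baseFunctor : ModFunctor.{u, u} R where
  obj S := S
  addCommGroup S := inferInstance
  module S := inferInstance
  map f := (f : _ →+* _).toAddMonoidHom
  map_smul f s m := by simp
  map_id m := rfl
  map_comp g f m := rfl

/-- `Hom_𝓢(M|S, N|S)`. A commutative `S`-algebra is the same as a commutative `R`-algebra `T` with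
a morphism of `R`-algebras `f : S → T`, and a morphism of `S`-algebras `(T, f) → (T', f')` is a
morphism of `R`-algebras `g` with `g ∘ f = f'`. -/
@[ext]
structure RestrictedHom (M : ModFunctor.{u, w₁} R) (N : ModFunctor.{u, w₂} R)
    (S : Type u) [CommRing S] [Algebra R S] where
  app : ∀ {T : Type u} [CommRing T] [Algebra R T] (_ : S →ₐ[R] T), M.obj T →ₗ[T] N.obj T
  naturality : ∀ {T T' : Type u} [CommRing T] [Algebra R T] [CommRing T'] [Algebra R T']
    (f : S →ₐ[R] T) (g : T →ₐ[R] T') (m : M.obj T),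
    app (g.comp f) (M.map g m) = N.map g (app f m)

namespace RestrictedHom

variable {M : ModFunctor.{u, w₁} R} {N : ModFunctor.{u, w₂} R}
  {S : Type u} [CommRing S] [Algebra R S]

instance : Zero (RestrictedHom M N S) := ⟨⟨fun _ => 0, by simp⟩⟩

instance : Add (RestrictedHom M N S) :=
  ⟨fun φ ψ => ⟨fun f => φ.app f + ψ.app f, by simp [φ.naturality, ψ.naturality]⟩⟩

instance : Neg (RestrictedHom M N S) :=
  ⟨fun φ => ⟨fun f => -φ.app f, by simp [φ.naturality]⟩⟩

instance : SMul S (RestrictedHom M N S) :=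
  ⟨fun s φ => ⟨fun f => f s • φ.app f, by simp [φ.naturality, N.map_smul]⟩⟩

@[simp] theorem zero_app {T : Type u} [CommRing T] [Algebra R T] (f : S →ₐ[R] T) :
    (0 : RestrictedHom M N S).app f = 0 := rfl

@[simp] theorem add_app (φ ψ : RestrictedHom M N S) {T : Type u} [CommRing T] [Algebra R T]
    (f : S →ₐ[R] T) : (φ + ψ).app f = φ.app f + ψ.app f := rfl

@[simp] theorem neg_app (φ : RestrictedHom M N S) {T : Type u} [CommRing T] [Algebra R T]
    (f : S →ₐ[R] T) : (-φ).app f = -φ.app f := rfl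

@[simp] theorem smul_app (s : S) (φ : RestrictedHom M N S) {T : Type u} [CommRing T]
    [Algebra R T] (f : S →ₐ[R] T) : (s • φ).app f = f s • φ.app f := rfl

theorem ext_app {φ ψ : RestrictedHom M N S}
    (h : ∀ (T : Type u) [CommRing T] [Algebra R T] (f : S →ₐ[R] T) (m : M.obj T),
      φ.app f m = ψ.app f m) : φ = ψ := by
  ext T _ _ f m
  exact h T f m

instance : AddCommGroup (RestrictedHom M N S) where
  add_assoc _ _ _ := ext_app fun _ _ _ _ _ => by simp [add_assoc]
  zero_add _ := ext_app fun _ _ _ _ _ => by simp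
  add_zero _ := ext_app fun _ _ _ _ _ => by simp
  add_comm _ _ := ext_app fun _ _ _ _ _ => by simp [add_comm]
  neg_add_cancel _ := ext_app fun _ _ _ _ _ => by simp
  nsmul := nsmulRec
  zsmul := zsmulRec

instance : Module S (RestrictedHom M N S) where
  one_smul _ := ext_app fun _ _ _ _ _ => by simp
  mul_smul _ _ _ := ext_app fun _ _ _ _ _ => by simp [mul_smul]
  smul_zero _ := ext_app fun _ _ _ _ _ => by simp
  smul_add _ _ _ := ext_app fun _ _ _ _ _ => by simp
  add_smul _ _ _ := ext_app fun _ _ _ _ _ => by simp [add_smul]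
  zero_smul _ := ext_app fun _ _ _ _ _ => by simp

end RestrictedHom

namespace ModFunctor

/-- The functor `ℍom_𝓡(M, N)`, `S ↦ Hom_𝓢(M|S, N|S)`. -/
def iHom (M : ModFunctor.{u, w₁} R) (N : ModFunctor.{u, w₂} R) :
    ModFunctor.{u, max (u + 1) w₁ w₂} R where
  obj S := RestrictedHom M N S
  addCommGroup S := inferInstance
  module S := inferInstance
  map h :=
    { toFun := fun φ =>
        ⟨fun f => φ.app (f.comp h), fun f g m => by
          rw [AlgHom.comp_assoc]; exact φ.naturality (f.comp h) g m⟩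
      map_zero' := rfl
      map_add' := fun _ _ => rfl }
  map_smul _ _ _ := rfl
  map_id _ := rfl
  map_comp _ _ _ := rfl

/-- The dual functor `M^* = ℍom_𝓡(M, 𝓡)`. -/
def dual (M : ModFunctor.{u, w} R) : ModFunctor.{u, max (u + 1) w} R :=
  M.iHom (baseFunctor R)

/-- The map `M(S) ⊗_S N(S) → M(T) ⊗_T N(T)` induced by `f : S → T`. -/
def tensorMap (M : ModFunctor.{u, w₁} R) (N : ModFunctor.{u, w₂} R) {S T : Type u}
    [CommRing S] [Algebra R S] [CommRing T] [Algebra R T] (f : S →ₐ[R] T) :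
    M.obj S ⊗[S] N.obj S →+ M.obj T ⊗[T] N.obj T :=
  TensorProduct.liftAddHom
    { toFun := fun m =>
        { toFun := fun n => M.map f m ⊗ₜ[T] N.map f n
          map_zero' := by simp
          map_add' := fun _ _ => by simp [TensorProduct.tmul_add] }
      map_zero' := by ext; simp
      map_add' := fun _ _ => by ext; simp [TensorProduct.add_tmul] }
    (fun s m n => by simp [M.map_smul, N.map_smul, TensorProduct.smul_tmul])

@[simp] theorem tensorMap_tmul (M : ModFunctor.{u, w₁} R) (N : ModFunctor.{u, w₂} R)
    {S T : Type u} [CommRing S] [Algebra R S] [CommRing T] [Algebra R T] (f : S →ₐ[R] T)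
    (m : M.obj S) (n : N.obj S) :
    tensorMap M N f (m ⊗ₜ[S] n) = M.map f m ⊗ₜ[T] N.map f n := rfl

/-- The tensor product `(M ⊗_𝓡 N)(S) = M(S) ⊗_S N(S)`. -/
def tensor (M : ModFunctor.{u, w₁} R) (N : ModFunctor.{u, w₂} R) :
    ModFunctor.{u, max w₁ w₂} R where
  obj S := M.obj S ⊗[S] N.obj S
  addCommGroup S := inferInstance
  module S := inferInstance
  map f := tensorMap M N f
  map_smul f s x := by
    induction x with
    | zero => simp
    | tmul m n => simp [TensorProduct.smul_tmul', M.map_smul]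
    | add x y hx hy => simp only [smul_add, map_add, hx, hy]
  map_id x := by
    induction x with
    | zero => simp
    | tmul m n => simp [M.map_id, N.map_id]
    | add x y hx hy => simp only [map_add, hx, hy]
  map_comp g f x := by
    induction x with
    | zero => simp
    | tmul m n => simp [M.map_comp, N.map_comp]
    | add x y hx hy => simp only [map_add, hx, hy]

/-- `M ⊗̃ N = (M^* ⊗ N^*)^*`. -/
def tildeTensor (M : ModFunctor.{u, w₁} R) (N : ModFunctor.{u, w₂} R) :
    ModFunctor.{u, max (u + 1) w₁ w₂} R :=
  (M.dual.tensor N.dual).dual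

/-- Evaluation `M^*(S) × M(S) → S`. -/
def eval (M : ModFunctor.{u, w} R) {S : Type u} [CommRing S] [Algebra R S]
    (φ : M.dual.obj S) : M.obj S →ₗ[S] S :=
  RestrictedHom.app (M := M) (N := baseFunctor R) φ (AlgHom.id R S)

theorem eval_add (M : ModFunctor.{u, w} R) {S : Type u} [CommRing S] [Algebra R S]
    (φ ψ : M.dual.obj S) (m : M.obj S) : M.eval (φ + ψ) m = M.eval φ m + M.eval ψ m := rfl

theorem eval_smul (M : ModFunctor.{u, w} R) {S : Type u} [CommRing S] [Algebra R S]
    (s : S) (φ : M.dual.obj S) (m : M.obj S) : M.eval (s • φ) m = s * M.eval φ m := rfl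

theorem eval_map (M : ModFunctor.{u, w} R) {S T : Type u} [CommRing S] [Algebra R S]
    [CommRing T] [Algebra R T] (f : S →ₐ[R] T) (φ : M.dual.obj S) (m : M.obj S) :
    M.eval (M.dual.map f φ) (M.map f m) = f (M.eval φ m) :=
  RestrictedHom.naturality (M := M) (N := baseFunctor R) φ (AlgHom.id R S) f m

/-- For `m ∈ M(S)` and `n ∈ N(S)`, the form `φ ⊗ ψ ↦ φ(m) ψ(n)` on `M^*(S) ⊗_S N^*(S)`. -/
def pairing (M : ModFunctor.{u, w₁} R) (N : ModFunctor.{u, w₂} R) {S : Type u} [CommRing S]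
    [Algebra R S] (m : M.obj S) (n : N.obj S) : M.dual.obj S ⊗[S] N.dual.obj S →ₗ[S] S :=
  TensorProduct.lift (LinearMap.mk₂ S (fun φ ψ => M.eval φ m * N.eval ψ n)
    (fun _ _ _ => by rw [eval_add, add_mul])
    (fun _ _ _ => by rw [eval_smul, smul_eq_mul, mul_assoc])
    (fun _ _ _ => by rw [eval_add, mul_add])
    (fun _ _ _ => by rw [eval_smul, smul_eq_mul, mul_left_comm]))

@[simp] theorem pairing_tmul (M : ModFunctor.{u, w₁} R) (N : ModFunctor.{u, w₂} R) {S : Type u}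
    [CommRing S] [Algebra R S] (m : M.obj S) (n : N.obj S) (φ : M.dual.obj S)
    (ψ : N.dual.obj S) : pairing M N m n (φ ⊗ₜ[S] ψ) = M.eval φ m * N.eval ψ n := rfl

theorem pairing_map (M : ModFunctor.{u, w₁} R) (N : ModFunctor.{u, w₂} R) {S T : Type u}
    [CommRing S] [Algebra R S] [CommRing T] [Algebra R T] (f : S →ₐ[R] T)
    (m : M.obj S) (n : N.obj S) (x : M.dual.obj S ⊗[S] N.dual.obj S) :
    pairing M N (M.map f m) (N.map f n) (tensorMap M.dual N.dual f x) =
      f (pairing M N m n x) := by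
  induction x with
  | zero => simp
  | tmul φ ψ => simp [eval_map]
  | add x y hx hy => simp only [map_add, hx, hy]

/-- The element of `(M ⊗̃ N)(S)` defined by `m ∈ M(S)` and `n ∈ N(S)`. -/
def pureTilde (M : ModFunctor.{u, w₁} R) (N : ModFunctor.{u, w₂} R) {S : Type u} [CommRing S]
    [Algebra R S] (m : M.obj S) (n : N.obj S) :
    RestrictedHom (M.dual.tensor N.dual) (baseFunctor R) S where
  app f := pairing M N (M.map f m) (N.map f n)
  naturality f g x := by
    rw [M.map_comp, N.map_comp]
    exact pairing_map M N g (M.map f m) (N.map f n) x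

theorem pureTilde_ext {M : ModFunctor.{u, w₁} R} {N : ModFunctor.{u, w₂} R} {S : Type u}
    [CommRing S] [Algebra R S] {φ ψ : RestrictedHom (M.dual.tensor N.dual) (baseFunctor R) S}
    (h : ∀ (T : Type u) [CommRing T] [Algebra R T] (f : S →ₐ[R] T) (a : M.dual.obj T)
      (b : N.dual.obj T), φ.app f (a ⊗ₜ[T] b) = ψ.app f (a ⊗ₜ[T] b)) : φ = ψ := by
  refine RestrictedHom.ext_app fun T _ _ f x => ?_
  induction x using TensorProduct.induction_on with
  | zero => exact (map_zero (φ.app f)).trans (map_zero (ψ.app f)).symm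
  | tmul a b => exact h T f a b
  | add x y hx hy =>
    exact (map_add (φ.app f) x y).trans ((congrArg₂ (· + ·) hx hy).trans
      (map_add (ψ.app f) x y).symm)

/-- The natural morphism `M ⊗ N → M ⊗̃ N`, `m ⊗ n ↦ (φ ⊗ ψ ↦ φ(m) ψ(n))`. -/
def toTilde (M : ModFunctor.{u, w₁} R) (N : ModFunctor.{u, w₂} R) :
    ModHom (M.tensor N) (M.tildeTensor N) where
  app S _ _ := TensorProduct.lift (LinearMap.mk₂ S
    (fun m n => (pureTilde M N m n : (M.tildeTensor N).obj S))
    (fun _ _ _ => pureTilde_ext fun T _ _ f a b => by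
      change M.eval a (M.map f (_ + _)) * N.eval b _ =
        M.eval a (M.map f _) * N.eval b _ + M.eval a (M.map f _) * N.eval b _
      rw [map_add, map_add, add_mul])
    (fun _ _ _ => pureTilde_ext fun T _ _ f a b => by
      change M.eval a (M.map f (_ • _)) * N.eval b _ = f _ * (M.eval a (M.map f _) * N.eval b _)
      rw [M.map_smul, LinearMap.map_smul, smul_eq_mul, mul_assoc])
    (fun _ _ _ => pureTilde_ext fun T _ _ f a b => by
      change M.eval a _ * N.eval b (N.map f (_ + _)) =
        M.eval a _ * N.eval b (N.map f _) + M.eval a _ * N.eval b (N.map f _)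
      rw [map_add, map_add, mul_add])
    (fun _ _ _ => pureTilde_ext fun T _ _ f a b => by
      change M.eval a _ * N.eval b (N.map f (_ • _)) = f _ * (M.eval a _ * N.eval b (N.map f _))
      rw [N.map_smul, LinearMap.map_smul, smul_eq_mul, mul_left_comm]))
  naturality {S T} _ _ _ _ f x := by
    induction x using TensorProduct.induction_on with
    | zero => exact (map_zero _).trans (map_zero ((M.tildeTensor N).map f)).symm
    | tmul m n =>
      refine pureTilde_ext fun U _ _ g a b => ?_
      change M.eval a (M.map g (M.map f m)) * N.eval b (N.map g (N.map f n)) =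
        M.eval a (M.map (g.comp f) m) * N.eval b (N.map (g.comp f) n)
      rw [M.map_comp, N.map_comp]
    | add x y hx hy =>
      refine (congrArg _ (map_add ((M.tensor N).map f) x y)).trans ?_
      refine (map_add _ _ _).trans ((congrArg₂ (· + ·) hx hy).trans ?_)
      exact ((congrArg ((M.tildeTensor N).map f) (map_add _ x y)).trans (map_add _ _ _)).symm

/-- The `S`-module `(lim_{α ∈ P} 𝓡^{(α)})(S)` of compatible families in the direct sums
`S^{(α)}`, `α ∈ P`, where `S^{(β)} → S^{(α)}` is the restriction for `α ⊆ β`. -/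
def limitFreeObj {I : Type u} (P : Set (Set I)) (S : Type u) [CommRing S] :
    Submodule S (∀ α : P, (α.1 →₀ S)) where
  carrier := {x | ∀ (α β : P) (h : α.1 ⊆ β.1) (i : α.1), x α i = x β ⟨i.1, h i.2⟩}
  zero_mem' := by intro α β h i; rfl
  add_mem' := by
    intro x y hx hy α β h i
    simp [hx α β h i, hy α β h i]
  smul_mem' := by
    intro s x hx α β h i
    simp [hx α β h i]

variable (R) in
/-- The functor of `𝓡`-modules `lim_{α ∈ P} 𝓡^{(α)}`. -/
def limitFree {I : Type u} (P : Set (Set I)) : ModFunctor.{u, u} R where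
  obj S := limitFreeObj P S
  addCommGroup S := inferInstance
  module S := inferInstance
  map f :=
    { toFun := fun x => ⟨fun α => (x.1 α).mapRange f (map_zero f), fun α β h i => by
        simpa using congrArg f (x.2 α β h i)⟩
      map_zero' := by ext; simp
      map_add' := fun x y => by ext; simp }
  map_smul f s x := by ext; simp
  map_id x := by ext; simp
  map_comp g f x := by ext; simp

/-- `M ∈ 𝔉`: there are a set `I`, a set `P` of subsets of `I` closed under binary unions and an
isomorphism `M ≃ lim_{α ∈ P} 𝓡^{(α)}`. -/
def EssentiallyFree (M : ModFunctor.{u, w} R) : Prop :=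
  ∃ (I : Type u) (P : Set (Set I)), (∀ α ∈ P, ∀ β ∈ P, α ∪ β ∈ P) ∧
    M.Isomorphic (limitFree R P)

/-- A structure of functor of `𝓡`-algebras on the functor of `𝓡`-modules `M`. -/
@[ext]
structure AlgebraStructure (M : ModFunctor.{u, w} R) where
  mul : ∀ (S : Type u) [CommRing S] [Algebra R S], M.obj S →ₗ[S] M.obj S →ₗ[S] M.obj S
  one : ∀ (S : Type u) [CommRing S] [Algebra R S], M.obj S
  mul_assoc : ∀ {S : Type u} [CommRing S] [Algebra R S] (a b c : M.obj S),
    mul S (mul S a b) c = mul S a (mul S b c)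
  one_mul : ∀ {S : Type u} [CommRing S] [Algebra R S] (a : M.obj S), mul S (one S) a = a
  mul_one : ∀ {S : Type u} [CommRing S] [Algebra R S] (a : M.obj S), mul S a (one S) = a
  map_mul : ∀ {S T : Type u} [CommRing S] [Algebra R S] [CommRing T] [Algebra R T]
    (f : S →ₐ[R] T) (a b : M.obj S), M.map f (mul S a b) = mul T (M.map f a) (M.map f b)
  map_one : ∀ {S T : Type u} [CommRing S] [Algebra R S] [CommRing T] [Algebra R T]
    (f : S →ₐ[R] T), M.map f (one S) = one T

/-- The ring `M(S)`; its additive group is the given one. -/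
@[reducible]
def AlgebraStructure.ringObj {M : ModFunctor.{u, w} R} (𝒮 : AlgebraStructure M) (S : Type u)
    [CommRing S] [Algebra R S] : Ring (M.obj S) :=
  { M.addCommGroup S with
    mul := fun a b => 𝒮.mul S a b
    one := 𝒮.one S
    mul_assoc := 𝒮.mul_assoc
    one_mul := 𝒮.one_mul
    mul_one := 𝒮.mul_one
    zero_mul := fun a => by
      change 𝒮.mul S 0 a = 0
      simp
    mul_zero := fun a => by
      change 𝒮.mul S a 0 = 0
      simp
    left_distrib := fun a b c => (𝒮.mul S a).map_add b c
    right_distrib := fun a b c => by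
      change 𝒮.mul S (a + b) c = 𝒮.mul S a c + 𝒮.mul S b c
      simp }

/-- The `S`-algebra `M(S)`; its scalar multiplication is the given one. -/
@[reducible]
def AlgebraStructure.algebraObj {M : ModFunctor.{u, w} R} (𝒮 : AlgebraStructure M) (S : Type u)
    [CommRing S] [Algebra R S] : @Algebra S (M.obj S) _ (𝒮.ringObj S).toSemiring :=
  letI := 𝒮.ringObj S
  letI : Module S (M.obj S) := M.module S
  Algebra.ofModule (fun s a b => (𝒮.mul S).map_smul₂ s a b) (fun s a b => (𝒮.mul S a).map_smul s b)

/-- `M` with the algebra structure `𝒮`, as a functor of `𝓡`-algebras. -/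
def AlgebraStructure.toAlgFunctor {M : ModFunctor.{u, w} R} (𝒮 : AlgebraStructure M) :
    AlgFunctor.{u, w} R where
  obj S := M.obj S
  ring S := 𝒮.ringObj S
  algebra S := 𝒮.algebraObj S
  map {S T} _ _ _ _ f :=
    letI := 𝒮.ringObj S
    letI := 𝒮.ringObj T
    { toFun := M.map f
      map_one' := 𝒮.map_one f
      map_mul' := 𝒮.map_mul f
      map_zero' := (M.map f).map_zero
      map_add' := (M.map f).map_add }
  map_algebraMap f s := by
    change M.map f (s • 𝒮.one _) = f s • 𝒮.one _
    rw [M.map_smul, 𝒮.map_one]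
  map_id a := M.map_id a
  map_comp g f a := M.map_comp g f a

/-- The functor of modules underlying `𝒮.toAlgFunctor` is `M` itself. -/
theorem AlgebraStructure.toMod_toAlgFunctor {M : ModFunctor.{u, w} R}
    (𝒮 : AlgebraStructure M) : 𝒮.toAlgFunctor.toMod = M := rfl

end ModFunctor

namespace AlgFunctor

/-- The ring morphism `A(S) ⊗_S B(S) → A(T) ⊗_T B(T)` induced by `f : S → T`. -/
def tensorMap (A : AlgFunctor.{u, w₁} R) (B : AlgFunctor.{u, w₂} R) {S T : Type u}
    [CommRing S] [Algebra R S] [CommRing T] [Algebra R T] (f : S →ₐ[R] T) :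
    A.obj S ⊗[S] B.obj S →+* A.obj T ⊗[T] B.obj T :=
  let F : A.obj S ⊗[S] B.obj S →+ A.obj T ⊗[T] B.obj T :=
    ModFunctor.tensorMap A.toMod B.toMod f
  have hF : ∀ (a : A.obj S) (b : B.obj S), F (a ⊗ₜ[S] b) = A.map f a ⊗ₜ[T] B.map f b :=
    fun _ _ => rfl
  { F with
    map_one' := by
      change F (1 ⊗ₜ[S] 1) = 1
      rw [hF, map_one, map_one, Algebra.TensorProduct.one_def]
    map_mul' := fun x y => by
      change F (x * y) = F x * F y
      induction x with
      | zero => simp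
      | add x x' hx hx' => rw [add_mul, map_add, map_add, hx, hx', add_mul]
      | tmul a b =>
        induction y with
        | zero => simp
        | add y y' hy hy' => rw [mul_add, map_add, map_add, hy, hy', mul_add]
        | tmul a' b' => simp only [hF, Algebra.TensorProduct.tmul_mul_tmul, map_mul] }

/-- The tensor product `(A ⊗_𝓡 B)(S) = A(S) ⊗_S B(S)` of functors of `𝓡`-algebras. -/
def tensor (A : AlgFunctor.{u, w₁} R) (B : AlgFunctor.{u, w₂} R) :
    AlgFunctor.{u, max w₁ w₂} R where
  obj S := A.obj S ⊗[S] B.obj S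
  ring S := inferInstance
  algebra S := inferInstance
  map f := tensorMap A B f
  map_algebraMap f s := by
    change A.map f (algebraMap _ _ s) ⊗ₜ B.map f 1 = algebraMap _ _ (f s) ⊗ₜ 1
    rw [A.map_algebraMap, map_one]
  map_id x := (A.toMod.tensor B.toMod).map_id x
  map_comp g f x := (A.toMod.tensor B.toMod).map_comp g f x

/-- The functor of modules underlying `A ⊗ B` is the tensor product of the underlying ones. -/
theorem toMod_tensor (A : AlgFunctor.{u, w₁} R) (B : AlgFunctor.{u, w₂} R) :
    (A.tensor B).toMod = A.toMod.tensor B.toMod := rfl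

/-- The quasi-coherent algebra `S ↦ S ⊗_R D` associated with the `R`-algebra `D`. -/
def quasiCoherent (D : Type w) [Ring D] [Algebra R D] : AlgFunctor.{u, max u w} R where
  obj S := S ⊗[R] D
  ring S := inferInstance
  algebra S := inferInstance
  map f := (Algebra.TensorProduct.map f (AlgHom.id R D)).toRingHom
  map_algebraMap f s := by simp [Algebra.TensorProduct.algebraMap_apply]
  map_id a := by simp
  map_comp g f a := by
    induction a with
    | zero => simp
    | tmul s d => simp
    | add x y hx hy => simp only [map_add, hx, hy]

/-- A quasi-coherent algebra quotient of `A`: an `R`-algebra `D` and an epimorphism `π` (that is,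
`π_S` is surjective for all `S`) from `A` onto the quasi-coherent algebra of `D`. Since `D` is a
quotient of `A(R)`, no quotient is lost by taking `D` in the universe of the values of `A`. -/
structure QuasiCoherentQuotient (A : AlgFunctor.{u, w} R) where
  carrier : Type w
  [ring : Ring carrier]
  [algebra : Algebra R carrier]
  π : AlgFunctorHom A (quasiCoherent (R := R) carrier)
  surjective : ∀ (S : Type u) [CommRing S] [Algebra R S], Function.Surjective (π.app S)

attribute [instance] QuasiCoherentQuotient.ring QuasiCoherentQuotient.algebra

/-- `A` is a functor of pro-quasicoherent algebras: it is the inverse limit of its quasi-coherent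
algebra quotients. That is, for all `S`, each family `x` of elements `x_Q` of the quotients `Q(S)`
that is compatible with the morphisms of quotients `Q → Q'` comes from exactly one element of
`A(S)`. -/
def ProQuasiCoherent (A : AlgFunctor.{u, w} R) : Prop :=
  ∀ (S : Type u) [CommRing S] [Algebra R S]
    (x : ∀ Q : A.QuasiCoherentQuotient, (quasiCoherent (R := R) Q.carrier).obj S),
    (∀ (Q Q' : A.QuasiCoherentQuotient)
      (g : AlgFunctorHom (quasiCoherent (R := R) Q.carrier) (quasiCoherent (R := R) Q'.carrier)),
      g.comp Q.π = Q'.π → g.app S (x Q) = x Q') →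
    ∃! a : A.obj S, ∀ Q : A.QuasiCoherentQuotient, Q.π.app S a = x Q

end AlgFunctor

end

/-! Write `perp P` for the family of sets that meet every member of `P` in a finite set. An
essentially free functor is the functor of vectors with support in `perp P`
(`toLimitFree_bijective`). Let `G` be a functor whose elements over S[X_i] involve only finitely
many variables (`Finitary`); quasi-coherent functors are of this kind. Evaluating a morphism to `G`
on a generic vector with coordinates X_i shows that it is determined by the images of the unit
vectors (`finFun_apply_eq_sum`). The families of images that occur are exactly those with support in
`perp (perp P)`. Since a triple `perp` is a single one, essentially free functors are reflexive, and
duals and ⊗̃ have the same shape. This is assertion 1. The basis of M ⊗̃ N comes from M ⊗ N, so M ⊗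
N is dense: a morphism from M ⊗̃ N to a finitary functor is determined on it (`tilde_hom_ext`).

The product comes from identifying A ⊗̃ B with the limit of the algebras Q ⊗ Q', where Q and Q' run
over the quasi-coherent quotients of A and B. A morphism M → 𝒟 is encoded as a form on M over the
commutative square-zero extension R ⊕ D. Elements of M ⊗̃ N are forms on M^* ⊗ N^*, so they can be
evaluated on two such forms, and this extends f ⊗ g to `tildeMap f g`. That the resulting map to the
limit is injective (`eq_zero_of_rho_eq_zero`) and surjective (`exists_rho_eq`) is proved one factor
at a time, from the fact that A and B are the limits of their quotients. The product is then
componentwise, and density makes it unique.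

A morphism A → 𝒟 factors through the image of A(R) in D (`exists_quotient_factor`). Hence every
morphism from A ⊗ B to a quasi-coherent algebra factors through some Q ⊗ Q' (`exists_tensor_factor`)
and extends uniquely to A ⊗̃ B. So the Q ⊗ Q' are cofinal among the quotients of A ⊗̃ B, which gives
pro-quasicoherence, and the universal property follows by writing C as the limit of its quotients.
-/

noncomputable section

universe v

/-! ### Orthogonality of families of sets. -/

section Perp

variable {I : Type u}

/-- The family of the sets that meet every member of `P` in a finite set. -/
def perp (P : Set (Set I)) : Set (Set I) := {t | ∀ α ∈ P, (α ∩ t).Finite}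

theorem perp_mono_left {P : Set (Set I)} {s t : Set I} (ht : t ∈ perp P) (h : s ⊆ t) :
    s ∈ perp P :=
  fun α hα => (ht α hα).subset (Set.inter_subset_inter_right α h)

theorem union_mem_perp {P : Set (Set I)} {s t : Set I} (hs : s ∈ perp P) (ht : t ∈ perp P) :
    s ∪ t ∈ perp P := fun α hα => by
  rw [Set.inter_union_distrib_left]
  exact (hs α hα).union (ht α hα)

theorem finite_mem_perp (P : Set (Set I)) {t : Set I} (ht : t.Finite) : t ∈ perp P :=
  fun _ _ => ht.subset Set.inter_subset_right

theorem subset_perp_perp (P : Set (Set I)) : P ⊆ perp (perp P) := fun α hα t ht => by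
  rw [Set.inter_comm]
  exact ht α hα

/-- The usual identity for an order-reversing Galois connection; reflexivity of essentially free
functors rests on it. -/
theorem perp_perp_perp (P : Set (Set I)) : perp (perp (perp P)) = perp P :=
  Set.Subset.antisymm (fun _ ht α hα => ht α (subset_perp_perp P hα)) (subset_perp_perp _)

end Perp

/-! ### Essentially free functors as functors of vectors with restricted support. -/

namespace ModFunctor

variable {R : Type u} [CommRing R]

/-- The `S`-module of the functions `I → S` whose support meets every member of `P` in a finite
set. -/
def finFunObj {I : Type u} (P : Set (Set I)) (S : Type u) [CommRing S] : Submodule S (I → S) where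
  carrier := {x | Function.support x ∈ perp P}
  zero_mem' := finite_mem_perp P (by simp)
  add_mem' hx hy := perp_mono_left (union_mem_perp hx hy) (Function.support_add _ _)
  smul_mem' s x hx := perp_mono_left hx (Function.support_const_smul_subset s x)

variable (R) in
/-- The functor of modules `S ↦ finFunObj P S`. -/
def finFun {I : Type u} (P : Set (Set I)) : ModFunctor.{u, u} R where
  obj S := finFunObj P S
  addCommGroup S := inferInstance
  module S := inferInstance
  map f :=
    { toFun := fun x => ⟨fun i => f (x.1 i), perp_mono_left x.2 fun i hi h => hi (by simp [h])⟩
      map_zero' := by ext; simp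
      map_add' := fun x y => by ext; simp }
  map_smul f s x := by ext; simp
  map_id x := rfl
  map_comp g f x := rfl

/-- The `i`-th unit vector. -/
def unitVector {I : Type u} (P : Set (Set I)) (S : Type u) [CommRing S] (i : I) :
    finFunObj P S := by
  classical
  exact ⟨Pi.single i 1, finite_mem_perp P ((Set.finite_singleton i).subset
    (Pi.support_single_subset))⟩

theorem unitVector_same {I : Type u} (P : Set (Set I)) (S : Type u) [CommRing S] (i : I) :
    (unitVector P S i).1 i = 1 := by
  simp [unitVector]

theorem unitVector_ne {I : Type u} (P : Set (Set I)) (S : Type u) [CommRing S] {i j : I}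
    (h : j ≠ i) : (unitVector P S i).1 j = 0 := by
  simp [unitVector, h]

theorem map_unitVector {I : Type u} (P : Set (Set I)) {S T : Type u} [CommRing S] [Algebra R S]
    [CommRing T] [Algebra R T] (f : S →ₐ[R] T) (i : I) :
    (finFun R P).map f (unitVector P S i) = unitVector P T i := by
  refine Subtype.ext (funext fun j => ?_)
  change f ((unitVector P S i).1 j) = _
  by_cases h : j = i
  · subst h; rw [unitVector_same, unitVector_same, map_one]
  · rw [unitVector_ne _ _ h, unitVector_ne _ _ h, map_zero]

/-- The composition of morphisms of functors of modules. -/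
def _root_.ModHom.comp {M : ModFunctor.{u, w₁} R} {N : ModFunctor.{u, w₂} R}
    {K : ModFunctor.{u, w₃} R} (g : ModHom N K) (f : ModHom M N) : ModHom M K where
  app S := (g.app S).comp (f.app S)
  naturality h m := by simp [f.naturality, g.naturality]

/-- The inverse of a bijective morphism. -/
def _root_.ModHom.inverse {M : ModFunctor.{u, w₁} R} {N : ModFunctor.{u, w₂} R} (f : ModHom M N)
    (hf : ∀ (S : Type u) [CommRing S] [Algebra R S], Function.Bijective (f.app S)) :
    ModHom N M where
  app S := (LinearEquiv.ofBijective (f.app S) (hf S)).symm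
  naturality {S T} _ _ _ _ g n := by
    apply (hf T).1
    rw [f.naturality]
    have key : ∀ (U : Type u) [CommRing U] [Algebra R U] (y : N.obj U),
        f.app U ((LinearEquiv.ofBijective (f.app U) (hf U)).symm y) = y := fun U _ _ y =>
      (LinearEquiv.ofBijective (f.app U) (hf U)).apply_symm_apply y
    exact (key T _).trans (congrArg (N.map g) (key S n).symm)

theorem _root_.ModHom.inverse_apply {M : ModFunctor.{u, w₁} R} {N : ModFunctor.{u, w₂} R}
    (f : ModHom M N)
    (hf : ∀ (S : Type u) [CommRing S] [Algebra R S], Function.Bijective (f.app S))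
    (S : Type u) [CommRing S] [Algebra R S] (m : M.obj S) :
    (f.inverse hf).app S (f.app S m) = m :=
  (LinearEquiv.ofBijective (f.app S) (hf S)).symm_apply_apply m

theorem _root_.ModHom.apply_inverse {M : ModFunctor.{u, w₁} R} {N : ModFunctor.{u, w₂} R}
    (f : ModHom M N)
    (hf : ∀ (S : Type u) [CommRing S] [Algebra R S], Function.Bijective (f.app S))
    (S : Type u) [CommRing S] [Algebra R S] (n : N.obj S) :
    f.app S ((f.inverse hf).app S n) = n :=
  (LinearEquiv.ofBijective (f.app S) (hf S)).apply_symm_apply n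

theorem Isomorphic.trans {M : ModFunctor.{u, w₁} R} {N : ModFunctor.{u, w₂} R}
    {K : ModFunctor.{u, w₃} R} (h : M.Isomorphic N) (h' : N.Isomorphic K) : M.Isomorphic K := by
  obtain ⟨f, g, hgf, hfg⟩ := h
  obtain ⟨f', g', hgf', hfg'⟩ := h'
  exact ⟨f'.comp f, g.comp g', fun S _ _ m => by simp [ModHom.comp, hgf, hgf'],
    fun S _ _ m => by simp [ModHom.comp, hfg, hfg']⟩

/-- If the members of `P` are indexed by `J ≃ ⋃₀ P`, restriction to the members of `P` is a
morphism to the inverse limit. -/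
def toLimitFree {I J : Type u} (P : Set (Set I)) (e : J ≃ ⋃₀ P) :
    ModHom (finFun R {β : Set J | ∃ α ∈ P, β = {j | (e j).1 ∈ α}}) (limitFree R P) where
  app S _ _ :=
    { toFun := fun x => ⟨fun α => Finsupp.ofSupportFinite
          (fun i => x.1 (e.symm ⟨i.1, α.1, α.2, i.2⟩)) (by
            refine ((x.2 _ ⟨α.1, α.2, rfl⟩).image (fun j => (e j).1)).preimage
              (f := (Subtype.val : α.1 → I)) Subtype.val_injective.injOn |>.subset fun i hi => ?_
            exact ⟨e.symm ⟨i.1, α.1, α.2, i.2⟩, ⟨by simp, hi⟩, by simp⟩),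
        fun α β h i => rfl⟩
      map_add' := fun x y => Subtype.ext (funext fun α => Finsupp.ext fun i => rfl)
      map_smul' := fun s x => Subtype.ext (funext fun α => Finsupp.ext fun i => rfl) }
  naturality f x := by
    refine Subtype.ext (funext fun α => Finsupp.ext fun i => rfl)

theorem toLimitFree_bijective {I J : Type u} (P : Set (Set I)) (hP : ∀ α ∈ P, ∀ β ∈ P, α ∪ β ∈ P)
    (e : J ≃ ⋃₀ P) (S : Type u) [CommRing S] [Algebra R S] :
    Function.Bijective ((toLimitFree (R := R) P e).app S) := by
  constructor
  · intro x y h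
    refine Subtype.ext (funext fun j => ?_)
    obtain ⟨α, hα, hj⟩ := (e j).2
    have := DFunLike.congr_fun (congrFun (congrArg Subtype.val h) ⟨α, hα⟩) ⟨(e j).1, hj⟩
    change x.1 (e.symm (e j)) = y.1 (e.symm (e j)) at this
    rwa [e.symm_apply_apply] at this
  · intro y
    choose a ha using fun j : J => (e j).2
    -- The value at j does not depend on the member of `P` used to read it: two members are compared
    -- inside their union, which is again in `P`.
    have key : ∀ (α : P) (j : J) (hj : (e j).1 ∈ α.1),
        y.1 ⟨a j, (ha j).1⟩ ⟨(e j).1, (ha j).2⟩ = y.1 α ⟨(e j).1, hj⟩ := fun α j hj => by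
      rw [y.2 ⟨a j, (ha j).1⟩ ⟨a j ∪ α.1, hP _ (ha j).1 _ α.2⟩ Set.subset_union_left,
        y.2 α ⟨a j ∪ α.1, hP _ (ha j).1 _ α.2⟩ Set.subset_union_right]
    refine ⟨⟨fun j => y.1 ⟨a j, (ha j).1⟩ ⟨(e j).1, (ha j).2⟩, ?_⟩, ?_⟩
    · rintro _ ⟨α, hα, rfl⟩
      refine Set.Finite.subset (((y.1 ⟨α, hα⟩).support.finite_toSet.image Subtype.val).preimage
        (f := fun j => (e j).1) (Subtype.val_injective.comp e.injective).injOn) ?_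
      rintro j ⟨hj, hj'⟩
      refine ⟨⟨(e j).1, hj⟩, ?_, rfl⟩
      rw [Function.mem_support, key ⟨α, hα⟩ j hj] at hj'
      simpa using hj'
    · refine Subtype.ext (funext fun α => Finsupp.ext fun i => ?_)
      have hi : (e (e.symm ⟨i.1, α.1, α.2, i.2⟩)).1 ∈ α.1 := by simp
      refine (key α _ hi).trans ?_
      congr 1
      exact Subtype.ext (by simp)

/-- Indices outside every member of `P` are invisible in the limit, so the index set is cut down to
`⋃₀ P`. -/
theorem EssentiallyFree.exists_isomorphic_finFun {M : ModFunctor.{u, w} R}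
    (h : M.EssentiallyFree) : ∃ (I : Type u) (P : Set (Set I)), M.Isomorphic (finFun R P) := by
  obtain ⟨I, P, hP, h⟩ := h
  have hb := fun (S : Type u) [CommRing S] [Algebra R S] =>
    toLimitFree_bijective (R := R) P hP (Equiv.refl _) S
  exact ⟨_, _, h.trans ⟨(toLimitFree P (Equiv.refl _)).inverse hb, toLimitFree P (Equiv.refl _),
    ModHom.apply_inverse _ hb, ModHom.inverse_apply _ hb⟩⟩

theorem EssentiallyFree.of_isomorphic_finFun {M : ModFunctor.{u, w} R} {I : Type u}
    (P : Set (Set I)) (h : M.Isomorphic (finFun R (perp P))) : M.EssentiallyFree := by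
  -- Singletons lie in `perp P`, so here the index set need not shrink, and `perp P` itself is the
  -- union-closed family required by the definition.
  have hu : ⋃₀ perp P = Set.univ := Set.eq_univ_of_forall fun i =>
    ⟨{i}, finite_mem_perp P (Set.finite_singleton i), rfl⟩
  let e : I ≃ ⋃₀ perp P := (Equiv.Set.univ I).symm.trans (Equiv.setCongr hu.symm)
  have he : {β : Set I | ∃ α ∈ perp P, β = {j | (e j).1 ∈ α}} = perp P := by
    ext β
    exact ⟨by rintro ⟨α, hα, rfl⟩; exact hα, fun hβ => ⟨β, hβ, rfl⟩⟩
  have hP : ∀ α ∈ perp P, ∀ β ∈ perp P, α ∪ β ∈ perp P := fun α hα β hβ => union_mem_perp hα hβ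
  have hb := fun (S : Type u) [CommRing S] [Algebra R S] =>
    toLimitFree_bijective (R := R) (perp P) hP e S
  refine ⟨I, perp P, hP, h.trans ?_⟩
  have := (show Isomorphic _ _ from ⟨toLimitFree (R := R) (perp P) e,
    (toLimitFree (perp P) e).inverse hb, ModHom.inverse_apply _ hb, ModHom.apply_inverse _ hb⟩)
  rwa [he] at this

end ModFunctor

end

/-! ### Morphisms from essentially free functors to finitary functors. -/

noncomputable section

universe v

namespace ModFunctor

variable {R : Type u} [CommRing R]

/-- Every element of `G(S[I])` depends on finitely many of the variables only. -/
def Finitary (G : ModFunctor.{u, w} R) : Prop :=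
  ∀ (S : Type u) [CommRing S] [Algebra R S] (I : Type u) (g : G.obj (MvPolynomial I S)),
    ∃ s : Finset I, ∀ (T : Type u) [CommRing T] [Algebra R T] (f f' : MvPolynomial I S →ₐ[R] T),
      (∀ c, f (MvPolynomial.C c) = f' (MvPolynomial.C c)) →
      (∀ i ∈ s, f (MvPolynomial.X i) = f' (MvPolynomial.X i)) → G.map f g = G.map f' g

theorem finitary_baseFunctor : (baseFunctor R).Finitary := fun S _ _ I g => by
  refine ⟨MvPolynomial.vars (σ := I) (R := S) g, fun T _ _ f f' hC hX => ?_⟩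
  exact MvPolynomial.hom_congr_vars (f₁ := (f : MvPolynomial I S →+* T)) (f₂ := f')
    (RingHom.ext hC) (fun i hi _ => hX i hi) rfl

theorem finitary_quasiCoherent (D : Type w) [Ring D] [Algebra R D] :
    (AlgFunctor.quasiCoherent (R := R) D).toMod.Finitary := fun S _ _ I g => by
  classical
  change MvPolynomial I S ⊗[R] D at g
  change ∃ s : Finset I, ∀ (T : Type u) [CommRing T] [Algebra R T]
    (f f' : MvPolynomial I S →ₐ[R] T), _ → _ →
      Algebra.TensorProduct.map f (AlgHom.id R D) g = Algebra.TensorProduct.map f' (AlgHom.id R D) g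
  induction g with
  | zero => exact ⟨∅, fun T _ _ f f' _ _ => by simp⟩
  | tmul p d =>
    obtain ⟨s, hs⟩ := finitary_baseFunctor (R := R) S I p
    refine ⟨s, fun T _ _ f f' hC hX => ?_⟩
    have : f p = f' p := hs T f f' hC hX
    simp [this]
  | add x y hx hy =>
    obtain ⟨s, hs⟩ := hx
    obtain ⟨s', hs'⟩ := hy
    refine ⟨s ∪ s', fun T _ _ f f' hC hX => ?_⟩
    rw [map_add, map_add, hs T f f' hC fun i hi => hX i (Finset.mem_union_left _ hi),
      hs' T f f' hC fun i hi => hX i (Finset.mem_union_right _ hi)]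

/-- Precomposition of a morphism over `S` with a morphism. -/
def _root_.RestrictedHom.precomp {M : ModFunctor.{u, w₁} R} {N : ModFunctor.{u, w₂} R}
    {G : ModFunctor.{u, w₃} R} {S : Type u} [CommRing S] [Algebra R S]
    (h : RestrictedHom N G S) (j : ModHom M N) : RestrictedHom M G S where
  app {T} _ _ f := (h.app f).comp (j.app T)
  naturality f g m := by simp [j.naturality, h.naturality]

/-- The restriction of a morphism to `S`-algebras. -/
def _root_.ModHom.restrict {M : ModFunctor.{u, w₁} R} {N : ModFunctor.{u, w₂} R}
    (j : ModHom M N) (S : Type u) [CommRing S] [Algebra R S] : RestrictedHom M N S where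
  app {T} _ _ _ := j.app T
  naturality _ g m := j.naturality g m

/-- The finite set `s` depends on `h` and `t` only, not on `T`, `f` or `x`: it consists of the
variables occurring in the value of `h` on one generic vector supported in `t`. -/
theorem finFun_apply_eq_sum {I : Type u} {P : Set (Set I)} {G : ModFunctor.{u, w} R}
    (hG : G.Finitary) {S : Type u} [CommRing S] [Algebra R S]
    (h : RestrictedHom (finFun R P) G S) {t : Set I} (ht : t ∈ perp P) :
    ∃ s : Finset I, ∀ (T : Type u) [CommRing T] [Algebra R T] (f : S →ₐ[R] T) (x : finFunObj P T),
      Function.support x.1 ⊆ t →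
      h.app f x = ∑ i ∈ s, x.1 i • h.app f (unitVector P T i) := by
  classical
  let c : S →ₐ[R] MvPolynomial I S := IsScalarTower.toAlgHom R S (MvPolynomial I S)
  -- The generic vector supported in `t`; it is admissible because `t ∈ perp P`.
  let X : finFunObj P (MvPolynomial I S) := ⟨fun i => if i ∈ t then MvPolynomial.X i else 0,
    perp_mono_left ht fun i hi => by
      by_contra h
      simp [h] at hi⟩
  obtain ⟨s, hs⟩ := hG S I (h.app c X)
  refine ⟨s, fun T _ _ f x hx => ?_⟩
  -- The truncation of `x` to `s`, on which linearity can be used.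
  let y : finFunObj P T := ∑ i ∈ s, x.1 i • unitVector P T i
  have hy : ∀ i, y.1 i = if i ∈ s then x.1 i else 0 := fun i => by
    have : y.1 i = ∑ j ∈ s, x.1 j * (unitVector P T j).1 i := by
      simp [y, Finset.sum_apply]
    rw [this, ← Finset.sum_ite_eq' s i fun j => x.1 j]
    refine Finset.sum_congr rfl fun j _ => ?_
    split_ifs with hij
    · subst hij; rw [unitVector_same, mul_one]
    · rw [unitVector_ne _ _ (Ne.symm hij), mul_zero]
  have hxt : ∀ i, i ∉ t → x.1 i = 0 := fun i hi => by
    by_contra h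
    exact hi (hx h)
  -- Every vector supported in `t` is the specialization X_i ↦ z_i of the generic one, so naturality
  -- computes `h` on it.
  have key : ∀ (z : finFunObj P T), (∀ i, i ∉ t → z.1 i = 0) →
      h.app f z = G.map (MvPolynomial.aevalTower f z.1) (h.app c X) := fun z hz => by
    have e : (MvPolynomial.aevalTower f z.1).comp c = f := AlgHom.ext fun a =>
      MvPolynomial.aevalTower_C f z.1 a
    have e' : (finFun R P).map (MvPolynomial.aevalTower f z.1) X = z := by
      refine Subtype.ext (funext fun i => ?_)
      change MvPolynomial.aevalTower f z.1 (if i ∈ t then MvPolynomial.X i else 0) = _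
      split_ifs with hi
      · simp
      · rw [map_zero, hz i hi]
    have := h.naturality c (MvPolynomial.aevalTower f z.1) X
    rwa [e, e'] at this
  have hyt : ∀ i, i ∉ t → y.1 i = 0 := fun i hi => by rw [hy, hxt i hi, ite_self]
  have hxy : h.app f x = h.app f y := by
    rw [key x hxt, key y hyt]
    refine hs T _ _ (fun a => by simp) fun i hi => ?_
    simp [hy, hi]
  rw [hxy]
  refine (map_sum (h.app f) _ s).trans (Finset.sum_congr rfl fun i _ => ?_)
  exact (h.app f).map_smul _ _

theorem app_unitVector {I : Type u} {P : Set (Set I)} {G : ModFunctor.{u, w} R}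
    {S : Type u} [CommRing S] [Algebra R S] (h : RestrictedHom (finFun R P) G S)
    {T : Type u} [CommRing T] [Algebra R T] (f : S →ₐ[R] T) (i : I) :
    h.app f (unitVector P T i) = G.map f (h.app (AlgHom.id R S) (unitVector P S i)) := by
  rw [← map_unitVector P f i]
  exact h.naturality (AlgHom.id R S) f (unitVector P S i)

theorem finFun_hom_ext {I : Type u} {P : Set (Set I)} {G : ModFunctor.{u, w} R}
    (hG : G.Finitary) {S : Type u} [CommRing S] [Algebra R S]
    {h h' : RestrictedHom (finFun R P) G S}
    (e : ∀ i, h.app (AlgHom.id R S) (unitVector P S i) =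
      h'.app (AlgHom.id R S) (unitVector P S i)) : h = h' := by
  classical
  -- The finite set in `finFun_apply_eq_sum` depends on the morphism; passing to the difference
  -- leaves a single one.
  rw [← sub_eq_zero]
  set d := h - h' with hd
  have hd' : ∀ i, d.app (AlgHom.id R S) (unitVector P S i) = 0 := fun i => by
    rw [hd, sub_eq_add_neg]
    change h.app _ _ + -(h'.app _ _) = 0
    rw [e i, add_neg_cancel]
  refine RestrictedHom.ext_app fun T _ _ f x => ?_
  change finFunObj P T at x
  obtain ⟨s, hs⟩ := finFun_apply_eq_sum hG d x.2
  refine (hs T f x subset_rfl).trans (Finset.sum_eq_zero fun i _ => ?_)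
  rw [app_unitVector, hd', map_zero, smul_zero]

/-- For i in `t` outside the finite set of `finFun_apply_eq_sum`, the formula applied to the i-th
unit vector is a sum of zeros. -/
theorem support_app_unitVector_mem {I : Type u} {P : Set (Set I)} {G : ModFunctor.{u, w} R}
    (hG : G.Finitary) {S : Type u} [CommRing S] [Algebra R S]
    (h : RestrictedHom (finFun R P) G S) :
    {i | h.app (AlgHom.id R S) (unitVector P S i) ≠ 0} ∈ perp (perp P) := fun t ht => by
  obtain ⟨s, hs⟩ := finFun_apply_eq_sum hG h ht
  refine s.finite_toSet.subset fun i hi => ?_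
  by_contra his
  refine hi.2 ((hs S (AlgHom.id R S) (unitVector P S i) fun j hj => ?_).trans
    (Finset.sum_eq_zero fun j hj => ?_))
  · by_cases hij : j = i
    · exact hij ▸ hi.1
    · exact absurd (unitVector_ne P S hij) hj
  · rw [unitVector_ne P S (fun e => his (by simpa [e] using hj)), zero_smul]

/-- The morphism with prescribed values on the unit vectors. -/
def finFunLift {I : Type u} (P : Set (Set I)) (G : ModFunctor.{u, w} R) {S : Type u} [CommRing S]
    [Algebra R S] (n : I → G.obj S) (hn : {i | n i ≠ 0} ∈ perp (perp P)) :
    RestrictedHom (finFun R P) G S :=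
  -- The support of `x` is in `perp P` and that of `n` in `perp (perp P)`, so they meet in a finite
  -- set and the sum is finite.
  have fin : ∀ {T : Type u} [CommRing T] [Algebra R T] (f : S →ₐ[R] T) (x : finFunObj P T),
      (Function.support fun i => x.1 i • G.map f (n i)).Finite := fun f x =>
    (hn _ x.2).subset fun i hi => ⟨fun h => hi (by simp [h]), fun h => hi (by simp [h])⟩
  { app := fun {T} _ _ f =>
      { toFun := fun x : finFunObj P T => ∑ᶠ i, x.1 i • G.map f (n i)
        map_add' := fun x y => by
          rw [← finsum_add_distrib (fin f x) (fin f y)]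
          exact finsum_congr fun i => add_smul _ _ _
        map_smul' := fun s x => by
          rw [RingHom.id_apply, smul_finsum' s (fin f x)]
          exact finsum_congr fun i => mul_smul _ _ _ }
    naturality := fun {T T'} _ _ _ _ f g x => by
      change ∑ᶠ i, g (x.1 i) • G.map (g.comp f) (n i) = G.map g (∑ᶠ i, x.1 i • G.map f (n i))
      rw [(G.map g).map_finsum (fin f x)]
      exact finsum_congr fun i => by rw [G.map_smul, G.map_comp] }

theorem finFunLift_unitVector {I : Type u} (P : Set (Set I)) (G : ModFunctor.{u, w} R)
    {S : Type u} [CommRing S] [Algebra R S] (n : I → G.obj S)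
    (hn : {i | n i ≠ 0} ∈ perp (perp P)) {T : Type u} [CommRing T] [Algebra R T] (f : S →ₐ[R] T)
    (i : I) : (finFunLift P G n hn).app f (unitVector P T i) = G.map f (n i) := by
  change ∑ᶠ j, (unitVector P T i).1 j • G.map f (n j) = _
  rw [finsum_eq_single _ i fun j hj => by rw [unitVector_ne _ _ hj, zero_smul],
    unitVector_same, one_smul]

/-- An isomorphism of `M` with `finFun R P`. -/
structure Coordinates (M : ModFunctor.{u, w} R) {I : Type u} (P : Set (Set I)) where
  hom : ModHom M (finFun R P)
  inv : ModHom (finFun R P) M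
  inv_hom : ∀ {S : Type u} [CommRing S] [Algebra R S] (m : M.obj S),
    inv.app S (hom.app S m) = m
  hom_inv : ∀ {S : Type u} [CommRing S] [Algebra R S] (x : (finFun R P).obj S),
    hom.app S (inv.app S x) = x

namespace Coordinates

/-- A bijective morphism to `finFun R P` defines coordinates. -/
def ofBijective {M : ModFunctor.{u, w} R} {I : Type u} {P : Set (Set I)}
    (f : ModHom M (finFun R P))
    (hf : ∀ (S : Type u) [CommRing S] [Algebra R S], Function.Bijective (f.app S)) :
    Coordinates M P :=
  ⟨f, f.inverse hf, fun m => f.inverse_apply hf _ m, fun x => f.apply_inverse hf _ x⟩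

theorem isomorphic {M : ModFunctor.{u, w} R} {I : Type u} {P : Set (Set I)}
    (c : Coordinates M P) : M.Isomorphic (finFun R P) :=
  ⟨c.hom, c.inv, fun _ _ _ m => c.inv_hom m, fun _ _ _ x => c.hom_inv x⟩

variable {M : ModFunctor.{u, w} R} {I : Type u} {P : Set (Set I)} (c : Coordinates M P)

/-- The element of `M(S)` whose coordinates are the `i`-th unit vector. -/
def basis (S : Type u) [CommRing S] [Algebra R S] (i : I) : M.obj S :=
  c.inv.app S (unitVector P S i)

/-- The `i`-th coordinate of an element of `M(S)`. -/
def coord {S : Type u} [CommRing S] [Algebra R S] (i : I) (m : M.obj S) : S :=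
  (c.hom.app S m : finFunObj P S).1 i

theorem hom_basis (S : Type u) [CommRing S] [Algebra R S] (i : I) :
    c.hom.app S (c.basis S i) = unitVector P S i := c.hom_inv _

theorem map_basis {S T : Type u} [CommRing S] [Algebra R S] [CommRing T] [Algebra R T]
    (f : S →ₐ[R] T) (i : I) : M.map f (c.basis S i) = c.basis T i := by
  refine (c.inv.naturality f _).symm.trans (congrArg (c.inv.app T) (map_unitVector P f i))

theorem hom_injective {S : Type u} [CommRing S] [Algebra R S] :
    Function.Injective (c.hom.app S) :=
  Function.LeftInverse.injective (g := c.inv.app S) c.inv_hom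

theorem hom_ext {G : ModFunctor.{u, v} R} (hG : G.Finitary) {S : Type u} [CommRing S]
    [Algebra R S] {h h' : RestrictedHom M G S}
    (e : ∀ i, h.app (AlgHom.id R S) (c.basis S i) = h'.app (AlgHom.id R S) (c.basis S i)) :
    h = h' := by
  have := finFun_hom_ext hG (h := h.precomp c.inv) (h' := h'.precomp c.inv) e
  refine RestrictedHom.ext_app fun T _ _ f m => ?_
  have := congrArg (fun k : RestrictedHom (finFun R P) G S => k.app f (c.hom.app T m)) this
  simpa [RestrictedHom.precomp, c.inv_hom] using this

theorem support_app_basis_mem {G : ModFunctor.{u, v} R} (hG : G.Finitary) {S : Type u}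
    [CommRing S] [Algebra R S] (h : RestrictedHom M G S) :
    {i | h.app (AlgHom.id R S) (c.basis S i) ≠ 0} ∈ perp (perp P) :=
  support_app_unitVector_mem hG (h.precomp c.inv)

/-- The morphism with prescribed values on the basis. -/
def lift {G : ModFunctor.{u, v} R} {S : Type u} [CommRing S] [Algebra R S] (n : I → G.obj S)
    (hn : {i | n i ≠ 0} ∈ perp (perp P)) : RestrictedHom M G S :=
  (finFunLift P G n hn).precomp c.hom

theorem lift_basis {G : ModFunctor.{u, v} R} {S : Type u} [CommRing S] [Algebra R S]
    (n : I → G.obj S) (hn : {i | n i ≠ 0} ∈ perp (perp P)) {T : Type u} [CommRing T]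
    [Algebra R T] (f : S →ₐ[R] T) (i : I) :
    (c.lift n hn).app f (c.basis T i) = G.map f (n i) := by
  change (finFunLift P G n hn).app f (c.hom.app T (c.basis T i)) = _
  rw [hom_basis, finFunLift_unitVector]

/-- The `i`-th coordinate, as a form on `M`. -/
def coordForm (S : Type u) [CommRing S] [Algebra R S] (i : I) :
    RestrictedHom M (baseFunctor R) S where
  app {T} _ _ _ :=
    { toFun := c.coord i
      map_add' := fun m n => by simp only [coord, map_add]; rfl
      map_smul' := fun s m => by simp only [coord, LinearMap.map_smul]; rfl }
  naturality {T T'} _ _ _ _ f g m := by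
    change ((c.hom.app T' (M.map g m) : finFunObj P T')).1 i = g (c.coord i m)
    rw [c.hom.naturality]
    rfl

/-- The coordinates of a form are its values on the basis. -/
def dualHom : ModHom M.dual (finFun R (perp P)) where
  app S _ _ :=
    { toFun := fun φ : RestrictedHom M (baseFunctor R) S =>
        (⟨fun i => φ.app (AlgHom.id R S) (c.basis S i),
          c.support_app_basis_mem finitary_baseFunctor φ⟩ : finFunObj (perp P) S)
      map_add' := fun _ _ => rfl
      map_smul' := fun _ _ => rfl }
  naturality {S T} _ _ _ _ f (φ : RestrictedHom M (baseFunctor R) S) := by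
    refine Subtype.ext (funext fun i => ?_)
    change φ.app f (c.basis T i) = f (φ.app (AlgHom.id R S) (c.basis S i))
    rw [← c.map_basis f]
    exact φ.naturality (AlgHom.id R S) f _

theorem dualHom_bijective (S : Type u) [CommRing S] [Algebra R S] :
    Function.Bijective (c.dualHom.app S) := by
  constructor
  · intro φ ψ h
    exact c.hom_ext finitary_baseFunctor fun i => congrFun (congrArg Subtype.val h) i
  · intro (y : finFunObj (perp P) S)
    refine ⟨c.lift (G := baseFunctor R) y.1 y.2, Subtype.ext (funext fun i => ?_)⟩
    exact c.lift_basis (G := baseFunctor R) y.1 y.2 (AlgHom.id R S) i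

/-- The coordinates of the dual functor. -/
def dual : Coordinates M.dual (perp P) := ofBijective c.dualHom c.dualHom_bijective

theorem dual_basis (S : Type u) [CommRing S] [Algebra R S] (i : I) :
    c.dual.basis S i = c.coordForm S i := by
  apply c.dual.hom_injective
  rw [hom_basis]
  refine Subtype.ext (funext fun j => ?_)
  change _ = (c.hom.app S (c.basis S j) : finFunObj P S).1 i
  rw [hom_basis]
  by_cases h : j = i
  · subst h; rw [unitVector_same, unitVector_same]
  · rw [unitVector_ne _ _ h, unitVector_ne _ _ (Ne.symm h)]

/-- A functor with coordinates is reflexive. -/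
theorem exists_eval_eq (c : Coordinates M P) {S : Type u} [CommRing S] [Algebra R S]
    (θ : RestrictedHom M.dual (baseFunctor R) S) :
    ∃ m : M.obj S, ∀ (T : Type u) [CommRing T] [Algebra R T] (f : S →ₐ[R] T) (φ : M.dual.obj T),
      θ.app f φ = M.eval φ (M.map f m) := by
  have hθ := c.dual.support_app_basis_mem finitary_baseFunctor θ
  -- The values of `θ` on the dual basis have support in the triple `perp`, hence in `perp P`: they
  -- are the coordinates of an element of M(S).
  rw [perp_perp_perp] at hθ
  let y : finFunObj P S := ⟨fun i => θ.app (AlgHom.id R S) (c.dual.basis S i), hθ⟩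
  let m : M.obj S := c.inv.app S y
  let θ' : RestrictedHom M.dual (baseFunctor R) S :=
    { app := fun {T} _ _ f =>
        { toFun := fun φ => M.eval φ (M.map f m)
          map_add' := fun φ ψ => M.eval_add φ ψ _
          map_smul' := fun s φ => M.eval_smul s φ _ }
      naturality := fun f g φ => by
        change M.eval (M.dual.map g φ) (M.map (g.comp f) m) = _
        rw [M.map_comp]
        exact M.eval_map g φ _ }
  have : θ = θ' := c.dual.hom_ext finitary_baseFunctor fun i => by
    change _ = M.eval (c.dual.basis S i) (M.map (AlgHom.id R S) m)
    rw [M.map_id]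
    refine Eq.trans ?_ (congrArg (fun φ => M.eval φ m) (c.dual_basis S i).symm)
    exact (congrFun (congrArg Subtype.val (c.hom_inv y)) i).symm
  exact ⟨m, fun T _ _ f φ => by rw [this]; rfl⟩

end Coordinates

theorem EssentiallyFree.exists_coordinates {M : ModFunctor.{u, w} R} (h : M.EssentiallyFree) :
    ∃ (I : Type u) (P : Set (Set I)), Nonempty (Coordinates M P) := by
  obtain ⟨I, P, f, g, hgf, hfg⟩ := h.exists_isomorphic_finFun
  exact ⟨I, P, ⟨f, g, fun m => hgf _ m, fun x => hfg _ x⟩⟩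

end ModFunctor

end

/-! ### Coordinates on M ⊗̃ N and density of M ⊗ N. -/

noncomputable section

universe v

namespace ModFunctor

variable {R : Type u} [CommRing R]

section Partial

variable {M : ModFunctor.{u, w₁} R} {N : ModFunctor.{u, w₂} R} {S : Type u} [CommRing S]
  [Algebra R S]

/-- The value of `z ∈ (M ⊗̃ N)(S)` on the forms `φ` and `ψ` over the `S`-algebra `T`. -/
def tildeEval (z : (M.tildeTensor N).obj S) {T : Type u} [CommRing T] [Algebra R T]
    (f : S →ₐ[R] T) (φ : M.dual.obj T) (ψ : N.dual.obj T) : T :=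
  RestrictedHom.app (M := M.dual.tensor N.dual) (N := baseFunctor R) z f (φ ⊗ₜ[T] ψ)

theorem tildeEval_add_left (z : (M.tildeTensor N).obj S) {T : Type u} [CommRing T] [Algebra R T]
    (f : S →ₐ[R] T) (φ φ' : M.dual.obj T) (ψ : N.dual.obj T) :
    tildeEval z f (φ + φ') ψ = tildeEval z f φ ψ + tildeEval z f φ' ψ := by
  refine (congrArg (RestrictedHom.app (M := M.dual.tensor N.dual) (N := baseFunctor R) z f)
    (TensorProduct.add_tmul φ φ' ψ)).trans ?_
  exact map_add (RestrictedHom.app (M := M.dual.tensor N.dual) (N := baseFunctor R) z f) _ _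

theorem tildeEval_add_right (z : (M.tildeTensor N).obj S) {T : Type u} [CommRing T] [Algebra R T]
    (f : S →ₐ[R] T) (φ : M.dual.obj T) (ψ ψ' : N.dual.obj T) :
    tildeEval z f φ (ψ + ψ') = tildeEval z f φ ψ + tildeEval z f φ ψ' := by
  refine (congrArg (RestrictedHom.app (M := M.dual.tensor N.dual) (N := baseFunctor R) z f)
    (TensorProduct.tmul_add φ ψ ψ')).trans ?_
  exact map_add (RestrictedHom.app (M := M.dual.tensor N.dual) (N := baseFunctor R) z f) _ _

theorem tildeEval_smul_left (z : (M.tildeTensor N).obj S) {T : Type u} [CommRing T] [Algebra R T]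
    (f : S →ₐ[R] T) (t : T) (φ : M.dual.obj T) (ψ : N.dual.obj T) :
    tildeEval z f (t • φ) ψ = t * tildeEval z f φ ψ := by
  refine (congrArg (RestrictedHom.app (M := M.dual.tensor N.dual) (N := baseFunctor R) z f)
    (TensorProduct.smul_tmul' t φ ψ).symm).trans ?_
  exact LinearMap.map_smul
    (RestrictedHom.app (M := M.dual.tensor N.dual) (N := baseFunctor R) z f) _ _

theorem tildeEval_smul_right (z : (M.tildeTensor N).obj S) {T : Type u} [CommRing T] [Algebra R T]
    (f : S →ₐ[R] T) (t : T) (φ : M.dual.obj T) (ψ : N.dual.obj T) :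
    tildeEval z f φ (t • ψ) = t * tildeEval z f φ ψ := by
  refine (congrArg (RestrictedHom.app (M := M.dual.tensor N.dual) (N := baseFunctor R) z f)
    (TensorProduct.tmul_smul t φ ψ)).trans ?_
  exact LinearMap.map_smul
    (RestrictedHom.app (M := M.dual.tensor N.dual) (N := baseFunctor R) z f) _ _

theorem tildeEval_map (z : (M.tildeTensor N).obj S) {T T' : Type u} [CommRing T] [Algebra R T]
    [CommRing T'] [Algebra R T'] (f : S →ₐ[R] T) (g : T →ₐ[R] T') (φ : M.dual.obj T)
    (ψ : N.dual.obj T) : tildeEval z (g.comp f) (M.dual.map g φ) (N.dual.map g ψ) =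
      g (tildeEval z f φ ψ) :=
  RestrictedHom.naturality (M := M.dual.tensor N.dual) (N := baseFunctor R) z f g (φ ⊗ₜ[T] ψ)

theorem tildeEval_toTilde (m : M.obj S) (n : N.obj S) {T : Type u} [CommRing T] [Algebra R T]
    (f : S →ₐ[R] T) (φ : M.dual.obj T) (ψ : N.dual.obj T) :
    tildeEval ((toTilde M N).app S (m ⊗ₜ[S] n)) f φ ψ =
      M.eval φ (M.map f m) * N.eval ψ (N.map f n) := rfl

theorem add_tildeEval (z z' : (M.tildeTensor N).obj S) {T : Type u} [CommRing T] [Algebra R T]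
    (f : S →ₐ[R] T) (φ : M.dual.obj T) (ψ : N.dual.obj T) :
    tildeEval (z + z') f φ ψ = tildeEval z f φ ψ + tildeEval z' f φ ψ := rfl

theorem smul_tildeEval (s : S) (z : (M.tildeTensor N).obj S) {T : Type u} [CommRing T]
    [Algebra R T] (f : S →ₐ[R] T) (φ : M.dual.obj T) (ψ : N.dual.obj T) :
    tildeEval (s • z) f φ ψ = f s * tildeEval z f φ ψ := rfl

theorem tilde_ext {z z' : (M.tildeTensor N).obj S}
    (h : ∀ (T : Type u) [CommRing T] [Algebra R T] (f : S →ₐ[R] T) (φ : M.dual.obj T)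
      (ψ : N.dual.obj T), tildeEval z f φ ψ = tildeEval z' f φ ψ) : z = z' :=
  pureTilde_ext h

/-- The form `φ ↦ z(φ, ψ)` on `M^*`. -/
def tildeLeft (z : (M.tildeTensor N).obj S) {T : Type u} [CommRing T] [Algebra R T]
    (f : S →ₐ[R] T) (ψ : N.dual.obj T) : RestrictedHom M.dual (baseFunctor R) T where
  app {U} _ _ g :=
    { toFun := fun φ => tildeEval (T := U) z (g.comp f) φ (N.dual.map g ψ)
      map_add' := fun φ φ' => tildeEval_add_left (T := U) z _ φ φ' _
      map_smul' := fun t φ => tildeEval_smul_left (T := U) z _ t φ _ }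
  naturality g g' φ := by
    change tildeEval z ((g'.comp g).comp f) (M.dual.map g' φ) (N.dual.map (g'.comp g) ψ) = _
    rw [N.dual.map_comp, AlgHom.comp_assoc]
    exact tildeEval_map z _ g' φ _

/-- The form `ψ ↦ z(φ, ψ)` on `N^*`. -/
def tildeRight (z : (M.tildeTensor N).obj S) {T : Type u} [CommRing T] [Algebra R T]
    (f : S →ₐ[R] T) (φ : M.dual.obj T) : RestrictedHom N.dual (baseFunctor R) T where
  app {U} _ _ g :=
    { toFun := fun ψ => tildeEval (T := U) z (g.comp f) (M.dual.map g φ) ψ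
      map_add' := fun ψ ψ' => tildeEval_add_right (T := U) z _ _ ψ ψ'
      map_smul' := fun t ψ => tildeEval_smul_right (T := U) z _ t _ ψ }
  naturality g g' ψ := by
    change tildeEval z ((g'.comp g).comp f) (M.dual.map (g'.comp g) φ) (N.dual.map g' ψ) = _
    rw [M.dual.map_comp, AlgHom.comp_assoc]
    exact tildeEval_map z _ g' _ ψ

theorem tildeLeft_app_id (z : (M.tildeTensor N).obj S) {T : Type u} [CommRing T] [Algebra R T]
    (f : S →ₐ[R] T) (φ : M.dual.obj T) (ψ : N.dual.obj T) :
    (tildeLeft z f ψ).app (AlgHom.id R T) φ = tildeEval z f φ ψ := rfl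

theorem tildeRight_app_id (z : (M.tildeTensor N).obj S) {T : Type u} [CommRing T] [Algebra R T]
    (f : S →ₐ[R] T) (φ : M.dual.obj T) (ψ : N.dual.obj T) :
    (tildeRight z f φ).app (AlgHom.id R T) ψ = tildeEval z f φ ψ := rfl

end Partial

namespace Coordinates

/-- The products of the supports of the forms on `M` and on `N`. -/
def rect {I J : Type u} (P : Set (Set I)) (Q : Set (Set J)) : Set (Set (I × J)) :=
  {t | ∃ s ∈ perp (perp P), ∃ s' ∈ perp (perp Q), t = s ×ˢ s'}

variable {M : ModFunctor.{u, w₁} R} {N : ModFunctor.{u, w₂} R} {I J : Type u} {P : Set (Set I)}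
  {Q : Set (Set J)} (c : Coordinates M P) (d : Coordinates N Q)

/-- The value of `z` on the `i`-th and the `j`-th coordinate form. -/
def tildeCoord {S : Type u} [CommRing S] [Algebra R S] (z : (M.tildeTensor N).obj S)
    (p : I × J) : S :=
  tildeEval z (AlgHom.id R S) (c.dual.basis S p.1) (d.dual.basis S p.2)

theorem tildeEval_basis {S : Type u} [CommRing S] [Algebra R S] (z : (M.tildeTensor N).obj S)
    {T : Type u} [CommRing T] [Algebra R T] (f : S →ₐ[R] T) (p : I × J) :
    tildeEval z f (c.dual.basis T p.1) (d.dual.basis T p.2) = f (c.tildeCoord d z p) := by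
  have := tildeEval_map z (AlgHom.id R S) f (c.dual.basis S p.1) (d.dual.basis S p.2)
  rwa [c.dual.map_basis, d.dual.map_basis] at this

/-- Finiteness in each variable separately does not bound the number of pairs. A generic form in the
second variable bounds the first index uniformly. -/
theorem support_tildeCoord_mem {S : Type u} [CommRing S] [Algebra R S]
    (z : (M.tildeTensor N).obj S) :
    Function.support (c.tildeCoord d z) ∈ perp (rect P Q) := by
  classical
  rintro _ ⟨s, hs, s', hs', rfl⟩
  let k : S →ₐ[R] MvPolynomial J S := IsScalarTower.toAlgHom R S (MvPolynomial J S)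
  let X : finFunObj (perp Q) (MvPolynomial J S) :=
    ⟨fun j => if j ∈ s' then MvPolynomial.X j else 0,
    perp_mono_left hs' fun j hj => by
      by_contra h
      simp [h] at hj⟩
  let ψ : N.dual.obj (MvPolynomial J S) := d.dual.inv.app _ X
  -- Only finitely many i in `s` pair nontrivially with the generic form `ψ` supported in `s'`;
  -- `hfin'` then bounds j for each such i.
  have hfin := c.dual.support_app_basis_mem finitary_baseFunctor (tildeLeft z k ψ)
    s hs
  have hfin' := fun i => d.dual.support_app_basis_mem finitary_baseFunctor
    (tildeRight z (AlgHom.id R S) (c.dual.basis S i)) s' hs'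
  refine (hfin.biUnion fun i _ => (hfin' i).image fun j => (i, j)).subset ?_
  rintro ⟨i, j⟩ ⟨⟨hi, hj⟩, hij⟩
  have hij' : tildeEval z (AlgHom.id R S) (c.dual.basis S i) (d.dual.basis S j) ≠ 0 := hij
  refine Set.mem_biUnion (x := i) ⟨hi, fun h0 => hij' ?_⟩ ⟨j, ⟨hj, hij⟩, rfl⟩
  -- Specializing the variables to the j-th unit vector turns `ψ` into the j-th basis form, so
  -- vanishing on `ψ` forces vanishing on that form.
  let ev : MvPolynomial J S →ₐ[R] S :=
    MvPolynomial.aevalTower (AlgHom.id R S) (unitVector (perp Q) S j).1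
  have e₁ : ev.comp k = AlgHom.id R S := AlgHom.ext fun a => MvPolynomial.aevalTower_C _ _ a
  have e₂ : N.dual.map ev ψ = d.dual.basis S j := by
    refine (d.dual.inv.naturality ev X).symm.trans (congrArg (d.dual.inv.app S) ?_)
    refine Subtype.ext (funext fun l => ?_)
    change ev (if l ∈ s' then MvPolynomial.X l else 0) = _
    split_ifs with hl
    · simp [ev]
    · rw [map_zero, unitVector_ne _ _ fun h : l = j => hl (h ▸ hj)]
  have := tildeEval_map z k ev (c.dual.basis _ i) ψ
  rw [e₁, e₂, c.dual.map_basis] at this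
  rw [this]
  exact (congrArg ev h0).trans (map_zero ev)

/-- The coordinates of an element of `M ⊗̃ N` are its values on pairs of coordinate forms. -/
def tildeHom : ModHom (M.tildeTensor N) (finFun R (perp (perp (rect P Q)))) where
  app S _ _ :=
    { toFun := fun z => (⟨c.tildeCoord d z, by
        -- The redundant double `perp` in the target puts it in the shape `perp _` asked for by
        -- `EssentiallyFree.of_isomorphic_finFun`, and matches the support condition of
        -- `finFunLift`.
        change Function.support (c.tildeCoord d z) ∈ perp (perp (perp (rect P Q)))
        rw [perp_perp_perp]; exact c.support_tildeCoord_mem d z⟩ :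
          finFunObj (perp (perp (rect P Q))) S)
      map_add' := fun _ _ => rfl
      map_smul' := fun _ _ => rfl }
  naturality f z := Subtype.ext (funext fun p => c.tildeEval_basis d z f p)

/-- Dual functors have coordinates, so a form on M^* or N^* is determined on basis forms; this is
applied to one variable at a time. -/
theorem tildeHom_injective (S : Type u) [CommRing S] [Algebra R S] :
    Function.Injective ((c.tildeHom d).app S) := by
  intro z z' h
  have hp : ∀ p, c.tildeCoord d z p = c.tildeCoord d z' p := fun p =>
    congrFun (congrArg Subtype.val h) p
  refine tilde_ext fun T _ _ f φ ψ => ?_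
  have h₁ : ∀ i, tildeRight z f (c.dual.basis T i) = tildeRight z' f (c.dual.basis T i) := fun i =>
    d.dual.hom_ext finitary_baseFunctor fun j => by
      rw [tildeRight_app_id, tildeRight_app_id, c.tildeEval_basis d z f (i, j),
        c.tildeEval_basis d z' f (i, j), hp]
  have h₂ : tildeLeft z f ψ = tildeLeft z' f ψ :=
    c.dual.hom_ext finitary_baseFunctor fun i => by
      rw [tildeLeft_app_id, tildeLeft_app_id, ← tildeRight_app_id, h₁, tildeRight_app_id]
  rw [← tildeLeft_app_id, h₂, tildeLeft_app_id]

/-- The products of the coordinates of the two factors of a tensor. -/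
def tensorHom : ModHom (M.tensor N)
    (finFun R (perp {t | ∃ s ∈ perp P, ∃ s' ∈ perp Q, t = s ×ˢ s'})) where
  app S _ _ := TensorProduct.lift (LinearMap.mk₂ S
    (fun m n => (⟨fun p => c.coord p.1 m * d.coord p.2 n, perp_mono_left
        (subset_perp_perp _ ⟨_, (c.hom.app S m).2, _, (d.hom.app S n).2, rfl⟩)
        fun p hp => ⟨left_ne_zero_of_mul hp, right_ne_zero_of_mul hp⟩⟩  :
        finFunObj (perp {t | ∃ s ∈ perp P, ∃ s' ∈ perp Q, t = s ×ˢ s'}) S))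
    (fun m m' n => Subtype.ext (funext fun p => by
      change c.coord p.1 (m + m') * _ = c.coord p.1 m * _ + c.coord p.1 m' * _
      rw [← add_mul]
      exact congrArg (· * _) ((c.coordForm S p.1).app (AlgHom.id R S) |>.map_add m m')))
    (fun s m n => Subtype.ext (funext fun p => by
      change c.coord p.1 (s • m) * _ = s * (c.coord p.1 m * _)
      rw [← mul_assoc]
      exact congrArg (· * _) ((c.coordForm S p.1).app (AlgHom.id R S) |>.map_smul s m)))
    (fun m n n' => Subtype.ext (funext fun p => by
      change _ * d.coord p.2 (n + n') = _ * d.coord p.2 n + _ * d.coord p.2 n'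
      rw [← mul_add]
      exact congrArg (_ * ·) ((d.coordForm S p.2).app (AlgHom.id R S) |>.map_add n n')))
    (fun s m n => Subtype.ext (funext fun p => by
      change _ * d.coord p.2 (s • n) = s * (_ * d.coord p.2 n)
      rw [mul_left_comm]
      exact congrArg (_ * ·) ((d.coordForm S p.2).app (AlgHom.id R S) |>.map_smul s n))))
  naturality {S T} _ _ _ _ f x := by
    induction x using TensorProduct.induction_on with
    | zero => exact (map_zero _).trans (map_zero ((finFun R _).map f)).symm
    | tmul m n =>
      refine Subtype.ext (funext fun p => ?_)
      change c.coord p.1 (M.map f m) * d.coord p.2 (N.map f n) =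
        f (c.coord p.1 m * d.coord p.2 n)
      rw [map_mul]
      exact congrArg₂ (· * ·) ((c.coordForm S p.1).naturality (AlgHom.id R S) f m)
        ((d.coordForm S p.2).naturality (AlgHom.id R S) f n)
    | add x y hx hy =>
      refine (congrArg _ (map_add ((M.tensor N).map f) x y)).trans ?_
      refine (map_add _ _ _).trans ((congrArg₂ (· + ·) hx hy).trans ?_)
      exact ((congrArg ((finFun R _).map f) (map_add _ x y)).trans (map_add _ _ _)).symm

theorem tensorHom_basis (S : Type u) [CommRing S] [Algebra R S] (i : I) (j : J) :
    (c.tensorHom d).app S (c.basis S i ⊗ₜ[S] d.basis S j) = unitVector _ S (i, j) := by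
  refine Subtype.ext (funext fun p => ?_)
  change (c.hom.app S (c.basis S i) : finFunObj P S).1 p.1 *
    (d.hom.app S (d.basis S j) : finFunObj Q S).1 p.2 = _
  rw [hom_basis, hom_basis]
  obtain ⟨k, l⟩ := p
  by_cases hk : k = i
  · by_cases hl : l = j
    · subst hk hl
      rw [unitVector_same, unitVector_same, unitVector_same, mul_one]
    · rw [unitVector_ne _ _ hl, mul_zero, unitVector_ne _ _ fun h => hl (congrArg Prod.snd h)]
  · rw [unitVector_ne _ _ hk, zero_mul, unitVector_ne _ _ fun h => hk (congrArg Prod.fst h)]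

/-- Applied to the dual coordinates, `tensorHom` lands in vectors with support in `perp (perp (rect
P Q))`. Forms there can be prescribed on unit vectors by `finFunLift` and pulled back to M^* ⊗ N^*.
-/
theorem tildeHom_surjective (S : Type u) [CommRing S] [Algebra R S] :
    Function.Surjective ((c.tildeHom d).app S) := by
  intro (y : finFunObj (perp (perp (rect P Q))) S)
  let ℓ := finFunLift (perp (rect P Q)) (baseFunctor R) y.1 y.2
  let z : RestrictedHom (M.dual.tensor N.dual) (baseFunctor R) S :=
    ℓ.precomp (c.dual.tensorHom d.dual)
  refine ⟨z, Subtype.ext (funext fun p => ?_)⟩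
  refine (congrArg (ℓ.app (AlgHom.id R S)) (c.dual.tensorHom_basis d.dual S p.1 p.2)).trans ?_
  exact finFunLift_unitVector (perp (rect P Q)) (baseFunctor R) y.1 y.2 (AlgHom.id R S) p

/-- The coordinates of `M ⊗̃ N`. -/
def tilde : Coordinates (M.tildeTensor N) (perp (perp (rect P Q))) :=
  ofBijective (c.tildeHom d) fun S _ _ => ⟨c.tildeHom_injective d S, c.tildeHom_surjective d S⟩

/-- The basis of M ⊗̃ N lies in the image of M ⊗ N; this is the source of every density argument
below. -/
theorem tilde_basis (S : Type u) [CommRing S] [Algebra R S] (i : I) (j : J) :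
    (c.tilde d).basis S (i, j) = (toTilde M N).app S (c.basis S i ⊗ₜ[S] d.basis S j) := by
  apply (c.tilde d).hom_injective
  rw [hom_basis]
  refine Eq.trans ?_ (Subtype.ext (funext fun p => ?_) : unitVector _ S (i, j) = _)
  · rfl
  have h := congrFun (congrArg Subtype.val (c.tensorHom_basis d S i j)) p
  have h' : ((c.tildeHom d).app S ((toTilde M N).app S (c.basis S i ⊗ₜ[S] d.basis S j)) :
      finFunObj (perp (perp (rect P Q))) S).1 p = c.coord p.1 (c.basis S i) *
        d.coord p.2 (d.basis S j) := by
    refine (tildeEval_toTilde _ _ (AlgHom.id R S) (c.dual.basis S p.1)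
      (d.dual.basis S p.2)).trans ?_
    rw [M.map_id, N.map_id]
    exact congrArg₂ (· * ·) (congrArg (fun φ => M.eval φ _) (c.dual_basis S p.1))
      (congrArg (fun φ => N.eval φ _) (d.dual_basis S p.2))
  exact (h'.trans h).symm

/-- A morphism over `S` from `M ⊗̃ N` to a finitary functor is determined by its values on
`M ⊗ N`. -/
theorem tilde_hom_ext (c : Coordinates M P) (d : Coordinates N Q) {G : ModFunctor.{u, v} R}
    (hG : G.Finitary) {S : Type u} [CommRing S] [Algebra R S]
    {h h' : RestrictedHom (M.tildeTensor N) G S}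
    (e : ∀ (m : M.obj S) (n : N.obj S),
      h.app (AlgHom.id R S) ((toTilde M N).app S (m ⊗ₜ[S] n)) =
        h'.app (AlgHom.id R S) ((toTilde M N).app S (m ⊗ₜ[S] n))) : h = h' :=
  (c.tilde d).hom_ext hG fun p => by
    rw [c.tilde_basis d S p.1 p.2]
    exact e _ _

end Coordinates

theorem EssentiallyFree.tildeTensor {M : ModFunctor.{u, w₁} R} {N : ModFunctor.{u, w₂} R}
    (hM : M.EssentiallyFree) (hN : N.EssentiallyFree) : (M.tildeTensor N).EssentiallyFree := by
  obtain ⟨I, P, ⟨c⟩⟩ := hM.exists_coordinates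
  obtain ⟨J, Q, ⟨d⟩⟩ := hN.exists_coordinates
  exact EssentiallyFree.of_isomorphic_finFun _ (c.tilde d).isomorphic

end ModFunctor

end

/-! ### Square-zero extensions, and morphisms to quasi-coherent modules as forms. -/

noncomputable section

universe v v₁ v₂

section SqZero

/-- The module `D` in the universe of `R`, with equal left and right actions of `R`. -/
def CentralShrink (_R : Type u) (D : Type v) [Small.{u} D] : Type u := Shrink.{u} D

variable (R : Type u) [CommRing R] (D : Type v) [AddCommGroup D] [Module R D] [Small.{u} D]

namespace CentralShrink

instance : AddCommGroup (CentralShrink R D) := inferInstanceAs (AddCommGroup (Shrink.{u} D))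

instance : Module R (CentralShrink R D) := inferInstanceAs (Module R (Shrink.{u} D))

instance : Module Rᵐᵒᵖ (CentralShrink R D) :=
  Module.compHom (CentralShrink R D) ((RingHom.id R).fromOpposite fun _ _ => mul_comm _ _)

instance : IsCentralScalar R (CentralShrink R D) := ⟨fun _ _ => rfl⟩

/-- The isomorphism with `D`. -/
def equiv : CentralShrink R D ≃ₗ[R] D := Shrink.linearEquiv.{u} R D

end CentralShrink

/-- The square-zero extension `R ⊕ D`, as a type in the universe of `R`. -/
def SqZero : Type u := TrivSqZeroExt R (CentralShrink R D)

namespace SqZero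

instance : CommRing (SqZero R D) :=
  inferInstanceAs (CommRing (TrivSqZeroExt R (CentralShrink R D)))

instance : Algebra R (SqZero R D) :=
  inferInstanceAs (Algebra R (TrivSqZeroExt R (CentralShrink R D)))

/-- The inclusion `D → R ⊕ D`. -/
def inr : D →ₗ[R] SqZero R D :=
  (TrivSqZeroExt.inrHom R (CentralShrink R D)).comp (CentralShrink.equiv R D).symm.toLinearMap

/-- The projection `R ⊕ D → D`. -/
def snd : SqZero R D →ₗ[R] D :=
  (CentralShrink.equiv R D).toLinearMap.comp (TrivSqZeroExt.sndHom R (CentralShrink R D))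

variable {D}

@[simp] theorem snd_inr (d : D) : snd R D (inr R D d) = d :=
  (CentralShrink.equiv R D).apply_symm_apply d

variable {D' : Type w} [AddCommGroup D'] [Module R D'] [Small.{u} D']

/-- The functoriality of the square-zero extension. -/
def map (g : D →ₗ[R] D') : SqZero R D →ₐ[R] SqZero R D' :=
  TrivSqZeroExt.map ((CentralShrink.equiv R D').symm.toLinearMap.comp
    (g.comp (CentralShrink.equiv R D).toLinearMap))

@[simp] theorem map_inr (g : D →ₗ[R] D') (d : D) : map R g (inr R D d) = inr R D' (g d) := by
  refine (TrivSqZeroExt.map_inr _ _).trans (congrArg TrivSqZeroExt.inr ?_)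
  simp

@[simp] theorem snd_map (g : D →ₗ[R] D') (x : SqZero R D) :
    snd R D' (map R g x) = g (snd R D x) := by
  refine (congrArg (CentralShrink.equiv R D') (TrivSqZeroExt.snd_map _ x)).trans ?_
  exact (CentralShrink.equiv R D').apply_symm_apply _

end SqZero

end SqZero

namespace AlgFunctor

variable {R : Type u} [CommRing R]

/-- The morphism of functors of modules underlying a morphism of functors of algebras. -/
def _root_.AlgFunctorHom.toModHom {A : AlgFunctor.{u, w₁} R} {B : AlgFunctor.{u, w₂} R}
    (f : AlgFunctorHom A B) : ModHom A.toMod B.toMod where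
  app S := (f.app S).toLinearMap
  naturality g a := f.naturality g a

section QuasiCoherent

variable {D : Type v₁} [Ring D] [Algebra R D] {D' : Type v₂} [Ring D'] [Algebra R D']

/-- The morphism of quasi-coherent modules induced by a linear map. -/
def qcLinear (g : D →ₗ[R] D') :
    ModHom (quasiCoherent (R := R) D).toMod (quasiCoherent (R := R) D').toMod where
  app S _ _ := g.baseChange S
  naturality {S T} _ _ _ _ f x := by
    change S ⊗[R] D at x
    change g.baseChange T (Algebra.TensorProduct.map f (AlgHom.id R D) x) =
      Algebra.TensorProduct.map f (AlgHom.id R D') (g.baseChange S x)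
    induction x with
    | zero => simp
    | tmul s d => simp
    | add x y hx hy => simp only [map_add, hx, hy]

/-- The morphism of quasi-coherent algebras induced by a morphism of algebras. -/
def qcMap (g : D →ₐ[R] D') :
    AlgFunctorHom (quasiCoherent (R := R) D) (quasiCoherent (R := R) D') where
  app S _ _ := Algebra.TensorProduct.map (AlgHom.id S S) g
  naturality f x := (qcLinear g.toLinearMap).naturality f x

theorem qcMap_tmul (g : D →ₐ[R] D') {S : Type u} [CommRing S] [Algebra R S] (s : S) (d : D) :
    (qcMap g).app S (s ⊗ₜ[R] d) = s ⊗ₜ[R] g d := rfl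

/-- Every morphism of quasi-coherent algebras is induced by a morphism of algebras. -/
theorem exists_eq_qcMap
    (g : AlgFunctorHom (quasiCoherent (R := R) D) (quasiCoherent (R := R) D')) :
    ∃ g' : D →ₐ[R] D', g = qcMap g' := by
  let e := Algebra.TensorProduct.lid R D
  let e' := Algebra.TensorProduct.lid R D'
  let gR : R ⊗[R] D →ₐ[R] R ⊗[R] D' := g.app R
  let g' : D →ₐ[R] D' := (e'.toAlgHom.comp gR).comp e.symm.toAlgHom
  have hg' : ∀ d, gR (1 ⊗ₜ d) = 1 ⊗ₜ g' d := fun d => by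
    apply e'.injective
    simp [g', e, e']
  refine ⟨g', ?_⟩
  refine AlgFunctorHom.ext (funext fun S => funext fun _ => funext fun _ => ?_)
  refine AlgHom.ext fun x => ?_
  change S ⊗[R] D at x
  induction x with
  | zero => exact (map_zero (g.app S)).trans (map_zero ((qcMap g').app S)).symm
  | add x y hx hy =>
    exact (map_add (g.app S) x y).trans ((congrArg₂ (· + ·) hx hy).trans
      (map_add ((qcMap g').app S) x y).symm)
  | tmul s d =>
    -- S ⊗ D is spanned over S by the image of R ⊗ D, so naturality along R → S and linearity
    -- determine `g` from its value over R.
    have := g.naturality (Algebra.ofId R S) (1 ⊗ₜ[R] d : R ⊗[R] D)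
    rw [show g.app R (1 ⊗ₜ[R] d : R ⊗[R] D) = 1 ⊗ₜ g' d from hg' d] at this
    change g.app S (Algebra.ofId R S 1 ⊗ₜ d) = Algebra.ofId R S 1 ⊗ₜ g' d at this
    rw [map_one] at this
    have e : (s ⊗ₜ[R] d : S ⊗[R] D) = s • (1 ⊗ₜ[R] d) := by
      rw [TensorProduct.smul_tmul', smul_eq_mul, mul_one]
    rw [qcMap_tmul]
    refine (congrArg (g.app S) e).trans ((map_smul (g.app S) s _).trans ?_)
    refine (congrArg (s • ·) this).trans ?_
    refine (TensorProduct.smul_tmul' s (1 : S) (g' d)).trans ?_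
    rw [smul_eq_mul, mul_one]

/-- The product `(S ⊗ D) × (S ⊗ D') → S ⊗ (D ⊗ D')`. -/
def boxMul {S : Type u} [CommRing S] [Algebra R S] (x : S ⊗[R] D) (y : S ⊗[R] D') :
    S ⊗[R] (D ⊗[R] D') :=
  Algebra.TensorProduct.map (AlgHom.id S S)
      (Algebra.TensorProduct.includeLeft : D →ₐ[R] D ⊗[R] D') x *
    Algebra.TensorProduct.map (AlgHom.id S S)
      (Algebra.TensorProduct.includeRight : D' →ₐ[R] D ⊗[R] D') y

theorem boxMul_tmul {S : Type u} [CommRing S] [Algebra R S] (s t : S) (d : D) (d' : D') :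
    boxMul (R := R) (s ⊗ₜ[R] d) (t ⊗ₜ[R] d') = (s * t) ⊗ₜ[R] (d ⊗ₜ[R] d') := by
  simp [boxMul]

theorem boxMul_zero_left {S : Type u} [CommRing S] [Algebra R S] (y : S ⊗[R] D') :
    boxMul (0 : S ⊗[R] D) y = 0 := by
  rw [boxMul, map_zero, zero_mul]

theorem boxMul_zero_right {S : Type u} [CommRing S] [Algebra R S] (x : S ⊗[R] D) :
    boxMul x (0 : S ⊗[R] D') = 0 := by
  rw [boxMul, map_zero, mul_zero]

theorem boxMul_add_left {S : Type u} [CommRing S] [Algebra R S] (x x' : S ⊗[R] D)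
    (y : S ⊗[R] D') : boxMul (x + x') y = boxMul x y + boxMul x' y := by
  rw [boxMul, map_add, add_mul, boxMul, boxMul]

theorem boxMul_add_right {S : Type u} [CommRing S] [Algebra R S] (x : S ⊗[R] D)
    (y y' : S ⊗[R] D') : boxMul x (y + y') = boxMul x y + boxMul x y' := by
  rw [boxMul, map_add, mul_add, boxMul, boxMul]

theorem boxMul_mul_boxMul {S : Type u} [CommRing S] [Algebra R S] (x x' : S ⊗[R] D)
    (y y' : S ⊗[R] D') : boxMul x y * boxMul x' y' = boxMul (x * x') (y * y') := by
  induction x with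
  | zero => rw [zero_mul, boxMul_zero_left, boxMul_zero_left, zero_mul]
  | add x₁ x₂ h₁ h₂ => rw [add_mul, boxMul_add_left, boxMul_add_left, add_mul, h₁, h₂]
  | tmul s d =>
  induction x' with
  | zero => rw [mul_zero, boxMul_zero_left, boxMul_zero_left, mul_zero]
  | add x₁ x₂ h₁ h₂ => rw [mul_add, boxMul_add_left, boxMul_add_left, mul_add, h₁, h₂]
  | tmul s' d' =>
  induction y with
  | zero => rw [zero_mul, boxMul_zero_right, boxMul_zero_right, zero_mul]
  | add x₁ x₂ h₁ h₂ => rw [add_mul, boxMul_add_right, boxMul_add_right, add_mul, h₁, h₂]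
  | tmul t e =>
  induction y' with
  | zero => rw [mul_zero, boxMul_zero_right, boxMul_zero_right, mul_zero]
  | add x₁ x₂ h₁ h₂ => rw [mul_add, boxMul_add_right, boxMul_add_right, mul_add, h₁, h₂]
  | tmul t' e' =>
    simp only [boxMul_tmul, Algebra.TensorProduct.tmul_mul_tmul]
    rw [mul_mul_mul_comm]

end QuasiCoherent

/-- The morphism `T ⊗ D → T` defined by a point of the square-zero extension of `D`. -/
def liftForm {D : Type v} [AddCommGroup D] [Module R D] [Small.{u} D] {T : Type u} [CommRing T]
    [Algebra R T] (κ : SqZero R D →ₐ[R] T) : T ⊗[R] D →ₗ[T] T :=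
  LinearMap.liftBaseChange T (κ.toLinearMap.comp (SqZero.inr R D))

@[simp] theorem liftForm_tmul {D : Type v} [AddCommGroup D] [Module R D] [Small.{u} D]
    {T : Type u} [CommRing T] [Algebra R T] (κ : SqZero R D →ₐ[R] T) (t : T) (d : D) :
    liftForm κ (t ⊗ₜ d) = t * κ (SqZero.inr R D d) := by
  simp [liftForm]

theorem liftForm_comp {D : Type v} [Ring D] [Algebra R D] [Small.{u} D] {T T' : Type u}
    [CommRing T] [Algebra R T] [CommRing T'] [Algebra R T'] (κ : SqZero R D →ₐ[R] T)
    (g : T →ₐ[R] T') (x : T ⊗[R] D) :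
    liftForm (g.comp κ) (Algebra.TensorProduct.map g (AlgHom.id R D) x) = g (liftForm κ x) := by
  induction x with
  | zero => simp
  | tmul s d => simp
  | add x y hx hy => simp only [map_add, hx, hy]

/-- At the tautological point of T ⊗ (R ⊕ D), the form keeps the whole element of T ⊗ D, placed in
the summand D. -/
theorem liftForm_includeRight {D : Type v} [Ring D] [Algebra R D] [Small.{u} D] {T : Type u}
    [CommRing T] [Algebra R T] (x : T ⊗[R] D) :
    liftForm (Algebra.TensorProduct.includeRight : SqZero R D →ₐ[R] T ⊗[R] SqZero R D)
      (Algebra.TensorProduct.map (Algebra.TensorProduct.includeLeft : T →ₐ[R] T ⊗[R] SqZero R D)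
        (AlgHom.id R D) x) = (SqZero.inr R D).baseChange T x := by
  induction x with
  | zero => simp
  | tmul s d => simp
  | add x y hx hy => simp only [map_add, hx, hy]

section Generic

variable {M : ModFunctor.{u, w₁} R} {N : ModFunctor.{u, w₂} R}
  {D : Type v₁} [Ring D] [Algebra R D] [Small.{u} D]
  {D' : Type v₂} [Ring D'] [Algebra R D'] [Small.{u} D']

/-- A morphism to a quasi-coherent module, as a form with values in the square-zero extension. -/
def genericForm (f : ModHom M (quasiCoherent (R := R) D).toMod) : M.dual.obj (SqZero R D) :=
  show RestrictedHom M (baseFunctor R) (SqZero R D) from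
  { app := fun {T} _ _ κ => (liftForm κ).comp (f.app T)
    naturality := fun {T T'} _ _ _ _ κ g m => by
      change liftForm (g.comp κ) (f.app T' (M.map g m)) = g (liftForm κ (f.app T m))
      rw [f.naturality]
      exact liftForm_comp κ g _ }

theorem eval_map_genericForm (f : ModHom M (quasiCoherent (R := R) D).toMod) {T : Type u}
    [CommRing T] [Algebra R T] (κ : SqZero R D →ₐ[R] T) (m : M.obj T) :
    M.eval (M.dual.map κ (genericForm f)) m = liftForm κ (f.app T m) := rfl

/-- The forms on M obtained from `f` see everything that `f` sees: one of them returns `f m` itself.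
-/
theorem eval_genericForm_includeRight (f : ModHom M (quasiCoherent (R := R) D).toMod) {T : Type u}
    [CommRing T] [Algebra R T] (m : M.obj T) :
    M.eval (M.dual.map Algebra.TensorProduct.includeRight (genericForm f))
      (M.map (Algebra.TensorProduct.includeLeft : T →ₐ[R] T ⊗[R] SqZero R D) m) =
        (SqZero.inr R D).baseChange T (f.app T m) := by
  rw [eval_map_genericForm, f.naturality]
  exact liftForm_includeRight _

variable (R D D') in
/-- The point of `S ⊗ ((R ⊕ D) ⊗ (R ⊕ D'))` defined by the first factor. -/
def pointLeft (S : Type u) [CommRing S] [Algebra R S] :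
    SqZero R D →ₐ[R] S ⊗[R] (SqZero R D ⊗[R] SqZero R D') :=
  (Algebra.TensorProduct.includeRight :
    SqZero R D ⊗[R] SqZero R D' →ₐ[R] S ⊗[R] (SqZero R D ⊗[R] SqZero R D')).comp
      Algebra.TensorProduct.includeLeft

variable (R D D') in
/-- The point of `S ⊗ ((R ⊕ D) ⊗ (R ⊕ D'))` defined by the second factor. -/
def pointRight (S : Type u) [CommRing S] [Algebra R S] :
    SqZero R D' →ₐ[R] S ⊗[R] (SqZero R D ⊗[R] SqZero R D') :=
  (Algebra.TensorProduct.includeRight :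
    SqZero R D ⊗[R] SqZero R D' →ₐ[R] S ⊗[R] (SqZero R D ⊗[R] SqZero R D')).comp
      Algebra.TensorProduct.includeRight

variable (R D D') in
/-- The inclusion `S → S ⊗ ((R ⊕ D) ⊗ (R ⊕ D'))`. -/
def scalarPoint (S : Type u) [CommRing S] [Algebra R S] :
    S →ₐ[R] S ⊗[R] (SqZero R D ⊗[R] SqZero R D') :=
  Algebra.TensorProduct.includeLeft

theorem pointLeft_apply {S : Type u} [CommRing S] [Algebra R S] (x : SqZero R D) :
    pointLeft R D D' S x = 1 ⊗ₜ (x ⊗ₜ 1) := rfl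

theorem pointRight_apply {S : Type u} [CommRing S] [Algebra R S] (x : SqZero R D') :
    pointRight R D D' S x = 1 ⊗ₜ (1 ⊗ₜ x) := rfl

theorem scalarPoint_apply {S : Type u} [CommRing S] [Algebra R S] (s : S) :
    scalarPoint R D D' S s = s ⊗ₜ 1 := rfl

/-- The value of `z ∈ M ⊗̃ N` on the forms defined by morphisms to quasi-coherent modules. -/
def genericEval (f : ModHom M (quasiCoherent (R := R) D).toMod)
    (g : ModHom N (quasiCoherent (R := R) D').toMod) :
    ModHom (M.tildeTensor N)
      (quasiCoherent (R := R) (SqZero R D ⊗[R] SqZero R D')).toMod where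
  app S _ _ :=
    { toFun := fun z => ModFunctor.tildeEval (T := S ⊗[R] (SqZero R D ⊗[R] SqZero R D')) z
        (scalarPoint R D D' S)
        (M.dual.map (pointLeft R D D' S) (genericForm f))
        (N.dual.map (pointRight R D D' S) (genericForm g))
      map_add' := fun z z' => ModFunctor.add_tildeEval z z' (scalarPoint R D D' S) _ _
      map_smul' := fun s z => (ModFunctor.smul_tildeEval s z (scalarPoint R D D' S) _ _).trans
        (Algebra.smul_def (A := S ⊗[R] (SqZero R D ⊗[R] SqZero R D')) s _).symm }
  naturality {S T} _ _ _ _ h z := by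
    let hK : S ⊗[R] (SqZero R D ⊗[R] SqZero R D') →ₐ[R] T ⊗[R] (SqZero R D ⊗[R] SqZero R D') :=
      Algebra.TensorProduct.map h (AlgHom.id R _)
    have e : hK.comp (scalarPoint R D D' S) = (scalarPoint R D D' T).comp h :=
      AlgHom.ext fun s => by simp [hK, scalarPoint_apply]
    have e₁ : hK.comp (pointLeft R D D' S) = pointLeft R D D' T :=
      AlgHom.ext fun k => by simp [hK, pointLeft_apply]
    have e₂ : hK.comp (pointRight R D D' S) = pointRight R D D' T :=
      AlgHom.ext fun k => by simp [hK, pointRight_apply]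
    have := ModFunctor.tildeEval_map z (scalarPoint R D D' S) hK
      (M.dual.map (pointLeft R D D' S) (genericForm f))
      (N.dual.map (pointRight R D D' S) (genericForm g))
    rw [← M.dual.map_comp, ← N.dual.map_comp, e, e₁, e₂] at this
    exact this

/-- S ⊗ (R ⊕ D) ⊗ (R ⊕ D') is universal among algebras with a map from S and two such points, so
naturality of `z` transports the universal value to any other. -/
theorem tildeEval_genericForm (f : ModHom M (quasiCoherent (R := R) D).toMod)
    (g : ModHom N (quasiCoherent (R := R) D').toMod) {S T : Type u} [CommRing S] [Algebra R S]
    [CommRing T] [Algebra R T] (z : (M.tildeTensor N).obj S) (h : S →ₐ[R] T)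
    (κ : SqZero R D →ₐ[R] T) (κ' : SqZero R D' →ₐ[R] T) :
    ModFunctor.tildeEval z h (M.dual.map κ (genericForm f)) (N.dual.map κ' (genericForm g)) =
      Algebra.TensorProduct.productMap h (Algebra.TensorProduct.productMap κ κ')
        ((genericEval f g).app S z) := by
  let l : S ⊗[R] (SqZero R D ⊗[R] SqZero R D') →ₐ[R] T :=
    Algebra.TensorProduct.productMap h (Algebra.TensorProduct.productMap κ κ')
  have := ModFunctor.tildeEval_map z (scalarPoint R D D' S) l
      (M.dual.map (pointLeft R D D' S) (genericForm f))
      (N.dual.map (pointRight R D D' S) (genericForm g))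
  have e : l.comp (scalarPoint R D D' S) = h :=
    AlgHom.ext fun s => by simp [l, scalarPoint_apply]
  have e₁ : l.comp (pointLeft R D D' S) = κ :=
    AlgHom.ext fun s => by simp [l, pointLeft_apply]
  have e₂ : l.comp (pointRight R D D' S) = κ' :=
    AlgHom.ext fun s => by simp [l, pointRight_apply]
  rw [← M.dual.map_comp, ← N.dual.map_comp, e, e₁, e₂] at this
  exact this

end Generic

end AlgFunctor

end

/-! ### Extension of f ⊗ g to M ⊗̃ N, and separation of points by quotients. -/

noncomputable section

universe v v₁ v₂

namespace ModFunctor.Coordinates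

variable {R : Type u} [CommRing R]

theorem tilde_modHom_ext {M : ModFunctor.{u, w₁} R} {N : ModFunctor.{u, w₂} R} {I J : Type u}
    {P : Set (Set I)} {Q : Set (Set J)} (c : Coordinates M P) (d : Coordinates N Q)
    {G : ModFunctor.{u, v} R} (hG : G.Finitary) {h h' : ModHom (M.tildeTensor N) G}
    (e : ∀ (S : Type u) [CommRing S] [Algebra R S] (m : M.obj S) (n : N.obj S),
      h.app S ((toTilde M N).app S (m ⊗ₜ[S] n)) = h'.app S ((toTilde M N).app S (m ⊗ₜ[S] n))) :
    h = h' := by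
  ext S _ _ z
  have := c.tilde_hom_ext d hG (h := h.restrict S) (h' := h'.restrict S) fun m n => e S m n
  exact congrArg (fun k : RestrictedHom (M.tildeTensor N) G S => k.app (AlgHom.id R S) z) this

end ModFunctor.Coordinates

namespace AlgFunctor

variable {R : Type u} [CommRing R]

section Rho

variable {M : ModFunctor.{u, w₁} R} {N : ModFunctor.{u, w₂} R}
  {D : Type v₁} [Ring D] [Algebra R D] [Small.{u} D]
  {D' : Type v₂} [Ring D'] [Algebra R D'] [Small.{u} D']

theorem liftForm_mul_liftForm {S : Type u} [CommRing S] [Algebra R S] (x : S ⊗[R] D)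
    (y : S ⊗[R] D') :
    liftForm (pointLeft R D D' S)
        (Algebra.TensorProduct.map (scalarPoint R D D' S) (AlgHom.id R D) x) *
      liftForm (pointRight R D D' S)
        (Algebra.TensorProduct.map (scalarPoint R D D' S) (AlgHom.id R D') y) =
      (TensorProduct.map (SqZero.inr R D) (SqZero.inr R D')).baseChange S (boxMul x y) := by
  induction x with
  | zero => rw [map_zero, map_zero, zero_mul, boxMul_zero_left, map_zero]
  | add x₁ x₂ h₁ h₂ => rw [map_add, map_add, add_mul, h₁, h₂, boxMul_add_left, map_add]
  | tmul s d =>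
  induction y with
  | zero => rw [map_zero, map_zero, mul_zero, boxMul_zero_right, map_zero]
  | add x₁ x₂ h₁ h₂ => rw [map_add, map_add, mul_add, h₁, h₂, boxMul_add_right, map_add]
  | tmul t d' =>
    simp [boxMul_tmul, scalarPoint_apply, pointLeft_apply, pointRight_apply]

theorem genericEval_toTilde (f : ModHom M (quasiCoherent (R := R) D).toMod)
    (g : ModHom N (quasiCoherent (R := R) D').toMod) {S : Type u} [CommRing S] [Algebra R S]
    (m : M.obj S) (n : N.obj S) :
    (genericEval f g).app S ((ModFunctor.toTilde M N).app S (m ⊗ₜ[S] n)) =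
      (qcLinear (TensorProduct.map (SqZero.inr R D) (SqZero.inr R D'))).app S
        (boxMul (f.app S m) (g.app S n)) := by
  refine (ModFunctor.tildeEval_toTilde m n (scalarPoint R D D' S)
    (M.dual.map (pointLeft R D D' S) (genericForm f))
    (N.dual.map (pointRight R D D' S) (genericForm g))).trans ?_
  rw [eval_map_genericForm, eval_map_genericForm, f.naturality, g.naturality]
  exact liftForm_mul_liftForm _ _

/-- The extension to `M ⊗̃ N` of the tensor product of two morphisms to quasi-coherent modules. -/
def tildeMap (f : ModHom M (quasiCoherent (R := R) D).toMod)
    (g : ModHom N (quasiCoherent (R := R) D').toMod) :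
    ModHom (M.tildeTensor N) (quasiCoherent (R := R) (D ⊗[R] D')).toMod :=
  (qcLinear (TensorProduct.map (SqZero.snd R D) (SqZero.snd R D'))).comp (genericEval f g)

theorem qcLinear_snd_inr {S : Type u} [CommRing S] [Algebra R S] (x : S ⊗[R] (D ⊗[R] D')) :
    (qcLinear (TensorProduct.map (SqZero.snd R D) (SqZero.snd R D'))).app S
      ((qcLinear (TensorProduct.map (SqZero.inr R D) (SqZero.inr R D'))).app S x) = x := by
  change (TensorProduct.map (SqZero.snd R D) (SqZero.snd R D')).baseChange S
    ((TensorProduct.map (SqZero.inr R D) (SqZero.inr R D')).baseChange S x) = x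
  have : (TensorProduct.map (SqZero.snd R D) (SqZero.snd R D')).comp
      (TensorProduct.map (SqZero.inr R D) (SqZero.inr R D')) = LinearMap.id := by
    ext; simp
  rw [← LinearMap.comp_apply, ← LinearMap.baseChange_comp, this]
  simp

theorem tildeMap_toTilde (f : ModHom M (quasiCoherent (R := R) D).toMod)
    (g : ModHom N (quasiCoherent (R := R) D').toMod) {S : Type u} [CommRing S] [Algebra R S]
    (m : M.obj S) (n : N.obj S) :
    (tildeMap f g).app S ((ModFunctor.toTilde M N).app S (m ⊗ₜ[S] n)) =
      boxMul (f.app S m) (g.app S n) := by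
  refine (congrArg ((qcLinear (TensorProduct.map (SqZero.snd R D) (SqZero.snd R D'))).app S)
    (genericEval_toTilde f g m n)).trans ?_
  exact qcLinear_snd_inr _

/-- The universal value could have components outside D ⊗ D' in (R ⊕ D) ⊗ (R ⊕ D'). On tensors it
has none, and density extends this to M ⊗̃ N, so the projection to D ⊗ D' loses nothing. -/
theorem genericEval_eq {I J : Type u} {P : Set (Set I)} {Q : Set (Set J)}
    (c : ModFunctor.Coordinates M P) (d : ModFunctor.Coordinates N Q)
    (f : ModHom M (quasiCoherent (R := R) D).toMod)
    (g : ModHom N (quasiCoherent (R := R) D').toMod) :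
    genericEval f g = (qcLinear (TensorProduct.map (SqZero.inr R D) (SqZero.inr R D'))).comp
      (tildeMap f g) :=
  c.tilde_modHom_ext d (ModFunctor.finitary_quasiCoherent _) fun S _ _ m n => by
    refine (genericEval_toTilde f g m n).trans ?_
    exact congrArg ((qcLinear _).app S) (tildeMap_toTilde f g m n).symm

theorem tildeEval_eq_zero {I J : Type u} {P : Set (Set I)} {Q : Set (Set J)}
    (c : ModFunctor.Coordinates M P) (d : ModFunctor.Coordinates N Q)
    (f : ModHom M (quasiCoherent (R := R) D).toMod)
    (g : ModHom N (quasiCoherent (R := R) D').toMod) {S T : Type u} [CommRing S] [Algebra R S]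
    [CommRing T] [Algebra R T] (z : (M.tildeTensor N).obj S) (hz : (tildeMap f g).app S z = 0)
    (h : S →ₐ[R] T) (κ : SqZero R D →ₐ[R] T) (κ' : SqZero R D' →ₐ[R] T) :
    ModFunctor.tildeEval z h (M.dual.map κ (genericForm f)) (N.dual.map κ' (genericForm g)) =
      0 := by
  rw [tildeEval_genericForm, genericEval_eq c d]
  have : ((qcLinear (TensorProduct.map (SqZero.inr R D) (SqZero.inr R D'))).comp
      (tildeMap f g)).app S z = 0 :=
    (congrArg ((qcLinear _).app S) hz).trans (map_zero _)
  exact (congrArg (Algebra.TensorProduct.productMap h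
    (Algebra.TensorProduct.productMap κ κ')) this).trans (map_zero _)

end Rho

/-- The uniqueness half of being the limit of the quotients. -/
theorem ProQuasiCoherent.eq_of_forall {A : AlgFunctor.{u, w} R} (hA : A.ProQuasiCoherent)
    {S : Type u} [CommRing S] [Algebra R S] {a b : A.obj S}
    (h : ∀ Q : A.QuasiCoherentQuotient, Q.π.app S a = Q.π.app S b) : a = b :=
  (hA S (fun Q => Q.π.app S b) fun Q Q' g hg => by rw [← hg]; rfl).unique h fun _ => rfl

/-- The extension to `A ⊗̃ B` of the tensor product of two quotients. -/
def rho {A : AlgFunctor.{u, w₁} R} {B : AlgFunctor.{u, w₂} R}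
    (Q : A.QuasiCoherentQuotient) (Q' : B.QuasiCoherentQuotient) [Small.{u} Q.carrier]
    [Small.{u} Q'.carrier] :
    ModHom (A.toMod.tildeTensor B.toMod)
      (quasiCoherent (R := R) (Q.carrier ⊗[R] Q'.carrier)).toMod :=
  tildeMap Q.π.toModHom Q'.π.toModHom

/-- The inclusion is split by `SqZero.snd`, so it stays injective after any base change, without
flatness. -/
theorem inr_baseChange_injective {D : Type v} [Ring D] [Algebra R D] [Small.{u} D] {T : Type u}
    [CommRing T] [Algebra R T] : Function.Injective ((SqZero.inr R D).baseChange T) := by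
  have h : (SqZero.snd R D).comp (SqZero.inr R D) = LinearMap.id := by ext; simp
  refine Function.LeftInverse.injective (g := (SqZero.snd R D).baseChange T) fun x => ?_
  rw [← LinearMap.comp_apply, ← LinearMap.baseChange_comp, h]
  simp

section Limit

variable {A : AlgFunctor.{u, w₁} R} {B : AlgFunctor.{u, w₂} R}
  [∀ Q : A.QuasiCoherentQuotient, Small.{u} Q.carrier]
  [∀ Q : B.QuasiCoherentQuotient, Small.{u} Q.carrier]
  {I J : Type u} {P : Set (Set I)} {P' : Set (Set J)}

/-- Freezing one argument of `z` gives a form on a dual functor, hence an element of A(T) or B(T) by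
reflexivity, and such an element vanishes as soon as its images in all quotients do. -/
theorem eq_zero_of_rho_eq_zero (c : ModFunctor.Coordinates A.toMod P)
    (d : ModFunctor.Coordinates B.toMod P') (hA : A.ProQuasiCoherent) (hB : B.ProQuasiCoherent)
    {S : Type u} [CommRing S] [Algebra R S] (z : (A.toMod.tildeTensor B.toMod).obj S)
    (hz : ∀ (Q : A.QuasiCoherentQuotient) (Q' : B.QuasiCoherentQuotient),
      (rho Q Q').app S z = 0) : z = 0 := by
  have h₁ : ∀ (Q' : B.QuasiCoherentQuotient) (T : Type u) [CommRing T] [Algebra R T]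
      (f : S →ₐ[R] T) (κ' : SqZero R Q'.carrier →ₐ[R] T) (φ : A.toMod.dual.obj T),
      ModFunctor.tildeEval z f φ (B.toMod.dual.map κ' (genericForm Q'.π.toModHom)) = 0 := by
    intro Q' T _ _ f κ' φ
    obtain ⟨a, ha⟩ := c.exists_eval_eq
      (ModFunctor.tildeLeft z f (B.toMod.dual.map κ' (genericForm Q'.π.toModHom)))
    -- The image of `a` in Q is read off by pairing `a` with the generic form of Q; that pairing is
    -- a value of `z` on two generic forms, which is zero by `tildeEval_eq_zero`.
    have ha0 : a = (0 : A.obj T) := hA.eq_of_forall fun Q => by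
      apply inr_baseChange_injective (R := R)
      rw [map_zero (Q.π.app T)]
      refine Eq.trans ?_ (map_zero _).symm
      refine (eval_genericForm_includeRight Q.π.toModHom a).symm.trans ?_
      rw [← ha]
      change ModFunctor.tildeEval z _ _ (B.toMod.dual.map _ _) = 0
      rw [← B.toMod.dual.map_comp]
      exact tildeEval_eq_zero c d Q.π.toModHom Q'.π.toModHom z (hz Q Q') _ _ _
    rw [← ModFunctor.tildeLeft_app_id, ha T (AlgHom.id R T) φ, ha0]
    exact (congrArg _ (map_zero _)).trans (map_zero _)
  refine ModFunctor.tilde_ext fun T _ _ f φ ψ => ?_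
  -- The same argument for B, now with an arbitrary form `φ` on A, which `h₁` permits.
  obtain ⟨b, hb⟩ := d.exists_eval_eq (ModFunctor.tildeRight z f φ)
  have hb0 : b = (0 : B.obj T) := hB.eq_of_forall fun Q' => by
    apply inr_baseChange_injective (R := R)
    rw [map_zero (Q'.π.app T)]
    refine Eq.trans ?_ (map_zero _).symm
    refine (eval_genericForm_includeRight Q'.π.toModHom b).symm.trans ?_
    rw [← hb]
    exact h₁ Q' _ _ _ _
  rw [← ModFunctor.tildeRight_app_id, hb T (AlgHom.id R T) ψ, hb0]
  exact (congrArg _ (map_zero _)).trans (map_zero _)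

end Limit

end AlgFunctor

end

/-! ### Elements of A ⊗̃ B from compatible families in Q ⊗ Q'. -/

noncomputable section

universe v v₁ v₂

namespace AlgFunctor

variable {R : Type u} [CommRing R]

section Coeff

variable {M : ModFunctor.{u, w₁} R} {D : Type v₁} [Ring D] [Algebra R D] [Small.{u} D]
  {D' : Type v₂} [Ring D'] [Algebra R D'] [Small.{u} D']

variable (R) in
/-- The inclusion `S ⊗ (R ⊕ D) → T ⊗ (R ⊕ D)` induced by `S → T`. -/
def sqZeroScalars (D : Type v₁) [Ring D] [Algebra R D] [Small.{u} D] {S T : Type u} [CommRing S]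
    [Algebra R S] [CommRing T] [Algebra R T] (f : S →ₐ[R] T) :
    S ⊗[R] SqZero R D →ₐ[R] T ⊗[R] SqZero R D :=
  Algebra.TensorProduct.map f (AlgHom.id R _)

/-- The morphism `T ⊗ (R ⊕ D) → T ⊗ (R ⊕ D')` induced by `D → D'`. -/
def sqZeroMap (T : Type u) [CommRing T] [Algebra R T] (g : D →ₐ[R] D') :
    T ⊗[R] SqZero R D →ₐ[R] T ⊗[R] SqZero R D' :=
  Algebra.TensorProduct.map (AlgHom.id R T) (SqZero.map R g.toLinearMap)

variable (R) in
/-- The inclusion `T → T ⊗ (R ⊕ D)`. -/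
def sqZeroIncl (D : Type v₁) [Ring D] [Algebra R D] [Small.{u} D] (T : Type u) [CommRing T]
    [Algebra R T] : T →ₐ[R] T ⊗[R] SqZero R D :=
  Algebra.TensorProduct.includeLeft

/-- The `D`-component of the value of a form on an element of `M(S ⊗ (R ⊕ D))`. -/
def coeff {S T : Type u} [CommRing S] [Algebra R S] [CommRing T] [Algebra R T] (f : S →ₐ[R] T)
    (φ : M.dual.obj T) (a : M.obj (S ⊗[R] SqZero R D)) : T ⊗[R] D :=
  (SqZero.snd R D).baseChange T
    (M.eval (M.dual.map (sqZeroIncl R D T) φ) (M.map (sqZeroScalars R D f) a))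

variable {S T : Type u} [CommRing S] [Algebra R S] [CommRing T] [Algebra R T] (f : S →ₐ[R] T)

theorem coeff_add (φ ψ : M.dual.obj T) (a : M.obj (S ⊗[R] SqZero R D)) :
    coeff f (φ + ψ) a = coeff f φ a + coeff f ψ a := by
  rw [coeff, map_add, M.eval_add, map_add, coeff, coeff]

theorem coeff_smul (t : T) (φ : M.dual.obj T) (a : M.obj (S ⊗[R] SqZero R D)) :
    coeff f (t • φ) a = t • coeff f φ a := by
  rw [coeff, M.dual.map_smul, M.eval_smul, coeff, ← map_smul, Algebra.smul_def]
  rfl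

theorem coeff_comp {T' : Type u} [CommRing T'] [Algebra R T'] (g : T →ₐ[R] T')
    (φ : M.dual.obj T) (a : M.obj (S ⊗[R] SqZero R D)) :
    coeff (g.comp f) (M.dual.map g φ) a =
      Algebra.TensorProduct.map g (AlgHom.id R D) (coeff f φ a) := by
  have e₁ : (sqZeroIncl R D T').comp g = (sqZeroScalars R D g).comp (sqZeroIncl R D T) :=
    AlgHom.ext fun t => by simp [sqZeroIncl, sqZeroScalars]
  have e₂ : sqZeroScalars R D (g.comp f) = (sqZeroScalars R D g).comp (sqZeroScalars R D f) :=
    Algebra.TensorProduct.ext (AlgHom.ext fun s => by simp [sqZeroScalars])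
      (AlgHom.ext fun s => by simp [sqZeroScalars])
  rw [coeff, ← M.dual.map_comp, e₁, e₂, M.dual.map_comp, M.map_comp, M.eval_map, coeff]
  generalize (M.eval (M.dual.map (sqZeroIncl R D T) φ)) (M.map (sqZeroScalars R D f) a) = x
  induction x with
  | zero => simp
  | tmul t y => simp [sqZeroScalars]
  | add x y hx hy => simp only [map_add, hx, hy]

/-- Naturality in the algebra D: it makes the coefficients compatible when Q' runs over the
quotients of B. -/
theorem coeff_sqZeroMap (g : D →ₐ[R] D') (φ : M.dual.obj T) (a : M.obj (S ⊗[R] SqZero R D)) :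
    coeff f φ (M.map (sqZeroMap S g) a) = (qcMap g).app T (coeff f φ a) := by
  have e₁ : sqZeroIncl R D' T = (sqZeroMap T g).comp (sqZeroIncl R D T) :=
    AlgHom.ext fun t => by simp [sqZeroIncl, sqZeroMap]
  have e₂ : (sqZeroScalars R D' f).comp (sqZeroMap S g) =
      (sqZeroMap T g).comp (sqZeroScalars R D f) :=
    Algebra.TensorProduct.ext (AlgHom.ext fun s => by simp [sqZeroScalars, sqZeroMap])
      (AlgHom.ext fun s => by simp [sqZeroScalars, sqZeroMap])
  rw [coeff, ← M.map_comp, e₁, e₂, M.dual.map_comp, M.map_comp, M.eval_map, coeff]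
  generalize (M.eval (M.dual.map (sqZeroIncl R D T) φ)) (M.map (sqZeroScalars R D f) a) = x
  change _ = Algebra.TensorProduct.map (AlgHom.id T T) g _
  induction x with
  | zero => simp
  | tmul t y => simp [sqZeroMap]
  | add x y hx hy => simp only [map_add, hx, hy]

theorem coeff_genericForm (h : ModHom M (quasiCoherent (R := R) D').toMod)
    (κ : SqZero R D' →ₐ[R] T) (a : M.obj (S ⊗[R] SqZero R D)) :
    coeff f (M.dual.map κ (genericForm h)) a =
      (SqZero.snd R D).baseChange T (liftForm ((sqZeroIncl R D T).comp κ)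
        (Algebra.TensorProduct.map (sqZeroScalars R D f) (AlgHom.id R D') (h.app _ a))) := by
  rw [coeff, ← M.dual.map_comp, eval_map_genericForm, h.naturality]
  rfl

end Coeff

variable (R) in
/-- The map `S ⊗ (D ⊗ D') → (S ⊗ (R ⊕ D')) ⊗ D`. -/
def swapInr (S : Type u) [CommRing S] [Algebra R S] (D : Type v₁) [Ring D] [Algebra R D]
    (D' : Type v₂) [Ring D'] [Algebra R D'] [Small.{u} D'] :
    S ⊗[R] (D ⊗[R] D') →ₗ[R] (S ⊗[R] SqZero R D') ⊗[R] D :=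
  (TensorProduct.map (TensorProduct.map LinearMap.id (SqZero.inr R D')) LinearMap.id).comp
    ((TensorProduct.assoc R S D' D).symm.toLinearMap.comp
      (TensorProduct.map LinearMap.id (TensorProduct.comm R D D').toLinearMap))

@[simp] theorem swapInr_tmul {S : Type u} [CommRing S] [Algebra R S] {D : Type v₁} [Ring D]
    [Algebra R D] {D' : Type v₂} [Ring D'] [Algebra R D'] [Small.{u} D'] (s : S) (d : D)
    (d' : D') : swapInr R S D D' (s ⊗ₜ (d ⊗ₜ d')) = (s ⊗ₜ SqZero.inr R D' d') ⊗ₜ d := by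
  simp [swapInr]

theorem tmul_tmul_induction {S : Type u} [CommRing S] [Algebra R S] {D : Type v₁} [Ring D]
    [Algebra R D] {D' : Type v₂} [Ring D'] [Algebra R D']
    {p : S ⊗[R] (D ⊗[R] D') → Prop} (x : S ⊗[R] (D ⊗[R] D')) (zero : p 0)
    (tmul : ∀ s d d', p (s ⊗ₜ (d ⊗ₜ d'))) (add : ∀ x y, p x → p y → p (x + y)) : p x := by
  induction x with
  | zero => exact zero
  | add x y hx hy => exact add x y hx hy
  | tmul s e =>
    induction e with
    | zero => simpa using zero
    | add x y hx hy => rw [TensorProduct.tmul_add]; exact add _ _ hx hy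
    | tmul d d' => exact tmul s d d'

section Limit

variable {A : AlgFunctor.{u, w₁} R} {B : AlgFunctor.{u, w₂} R}

/-- A family of elements of the tensor products of the quotients of `A` and `B` that is compatible
with the morphisms of quotients. -/
def CompatibleFamily {S : Type u} [CommRing S] [Algebra R S]
    (x : ∀ (Q : A.QuasiCoherentQuotient) (Q' : B.QuasiCoherentQuotient),
      S ⊗[R] (Q.carrier ⊗[R] Q'.carrier)) : Prop :=
  ∀ (Q₁ Q₂ : A.QuasiCoherentQuotient) (Q₁' Q₂' : B.QuasiCoherentQuotient)
    (g : Q₁.carrier →ₐ[R] Q₂.carrier) (g' : Q₁'.carrier →ₐ[R] Q₂'.carrier),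
    (qcMap g).comp Q₁.π = Q₂.π → (qcMap g').comp Q₁'.π = Q₂'.π →
      Algebra.TensorProduct.map (AlgHom.id S S) (Algebra.TensorProduct.map g g') (x Q₁ Q₁') =
        x Q₂ Q₂'

theorem qcMap_id_comp {A : AlgFunctor.{u, w} R} (Q : A.QuasiCoherentQuotient) :
    (qcMap (AlgHom.id R Q.carrier)).comp Q.π = Q.π := by
  refine AlgFunctorHom.ext (funext fun S => funext fun _ => funext fun _ => AlgHom.ext fun a => ?_)
  change Algebra.TensorProduct.map (AlgHom.id S S) (AlgHom.id R Q.carrier) (Q.π.app S a) = _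
  rw [Algebra.TensorProduct.map_id]
  rfl

/-- With Q' frozen, `swapInr` turns x(Q, Q') into an element of the quotient Q over the commutative
algebra S ⊗ (R ⊕ Q'). These are compatible in Q, so they come from an element of A over that
algebra. -/
theorem exists_partial [∀ Q : B.QuasiCoherentQuotient, Small.{u} Q.carrier]
    (hA : A.ProQuasiCoherent) {S : Type u} [CommRing S] [Algebra R S]
    (x : ∀ (Q : A.QuasiCoherentQuotient) (Q' : B.QuasiCoherentQuotient),
      S ⊗[R] (Q.carrier ⊗[R] Q'.carrier)) (hx : CompatibleFamily x) :
    ∃ w : ∀ Q' : B.QuasiCoherentQuotient, A.obj (S ⊗[R] SqZero R Q'.carrier),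
      (∀ Q Q', Q.π.app _ (w Q') = swapInr R S Q.carrier Q'.carrier (x Q Q')) ∧
      ∀ (Q₁ Q₂ : B.QuasiCoherentQuotient) (g : Q₁.carrier →ₐ[R] Q₂.carrier),
        (qcMap g).comp Q₁.π = Q₂.π → A.map (sqZeroMap S g) (w Q₁) = w Q₂ := by
  have : ∀ Q' : B.QuasiCoherentQuotient, ∃ a : A.obj (S ⊗[R] SqZero R Q'.carrier),
      ∀ Q, Q.π.app _ a = swapInr R S Q.carrier Q'.carrier (x Q Q') := fun Q' => by
    refine (hA _ (fun Q => swapInr R S Q.carrier Q'.carrier (x Q Q')) fun Q₁ Q₂ g hg => ?_).exists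
    obtain ⟨g, rfl⟩ := exists_eq_qcMap g
    rw [← hx Q₁ Q₂ Q' Q' g (AlgHom.id R _) hg (qcMap_id_comp Q')]
    generalize x Q₁ Q' = y
    change Algebra.TensorProduct.map (AlgHom.id _ _) g _ = _
    induction y using tmul_tmul_induction with
    | zero => simp
    | tmul s d d' => simp
    | add y y' h h' => simp only [map_add, h, h']
  choose w hw using this
  -- Compatibility of `w` in Q' is checked in every quotient Q of A, where it is compatibility of
  -- `x`.
  refine ⟨w, fun Q Q' => hw Q' Q, fun Q₁ Q₂ g hg => hA.eq_of_forall fun Q => ?_⟩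
  rw [Q.π.naturality, hw, hw, ← hx Q Q Q₁ Q₂ (AlgHom.id R _) g (qcMap_id_comp Q) hg]
  generalize x Q Q₁ = y
  change Algebra.TensorProduct.map (sqZeroMap S g) (AlgHom.id R _) _ = _
  induction y using tmul_tmul_induction with
  | zero => simp
  | tmul s d d' => simp [sqZeroMap]
  | add y y' h h' => simp only [map_add, h, h']

/-- The element of `A ⊗̃ B` defined by a family of elements `b(φ) ∈ B(T)`, `φ ∈ A^*(T)`, that is
linear and natural in `φ`. -/
def tildeOfFamily {M : ModFunctor.{u, w₁} R} {N : ModFunctor.{u, w₂} R} {S : Type u} [CommRing S]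
    [Algebra R S]
    (b : ∀ (T : Type u) [CommRing T] [Algebra R T], (S →ₐ[R] T) → M.dual.obj T → N.obj T)
    (hadd : ∀ (T : Type u) [CommRing T] [Algebra R T] (f : S →ₐ[R] T) (φ ψ : M.dual.obj T),
      b T f (φ + ψ) = b T f φ + b T f ψ)
    (hsmul : ∀ (T : Type u) [CommRing T] [Algebra R T] (f : S →ₐ[R] T) (t : T)
      (φ : M.dual.obj T), b T f (t • φ) = t • b T f φ)
    (hmap : ∀ (T T' : Type u) [CommRing T] [Algebra R T] [CommRing T'] [Algebra R T']
      (f : S →ₐ[R] T) (g : T →ₐ[R] T') (φ : M.dual.obj T),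
      b T' (g.comp f) (M.dual.map g φ) = N.map g (b T f φ)) : (M.tildeTensor N).obj S :=
  show RestrictedHom (M.dual.tensor N.dual) (baseFunctor R) S from
  { app := fun {T} _ _ f => TensorProduct.lift (LinearMap.mk₂ T (fun φ ψ => N.eval ψ (b T f φ))
      (fun φ φ' ψ => by rw [hadd]; exact map_add _ _ _)
      (fun t φ ψ => by rw [hsmul]; exact map_smul _ _ _)
      (fun φ ψ ψ' => N.eval_add ψ ψ' _)
      (fun t φ ψ => N.eval_smul t ψ _))
    naturality := fun {T T'} _ _ _ _ f g x => by
      induction x using TensorProduct.induction_on with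
      | zero => exact ((congrArg _ (map_zero ((M.dual.tensor N.dual).map g))).trans
          (map_zero _)).trans ((congrArg g (map_zero _)).trans (map_zero g)).symm
      | tmul φ ψ =>
        change N.eval (N.dual.map g ψ) (b T' (g.comp f) (M.dual.map g φ)) = g (N.eval ψ (b T f φ))
        rw [hmap, N.eval_map]
      | add x y hx hy =>
        refine (congrArg _ (map_add ((M.dual.tensor N.dual).map g) x y)).trans ?_
        refine (map_add _ _ _).trans ((congrArg₂ (· + ·) hx hy).trans ?_)
        exact ((congrArg g (map_add _ x y)).trans (map_add g _ _)).symm }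

theorem liftForm_snd_liftForm {S : Type u} [CommRing S] [Algebra R S] {D : Type v₁} [Ring D]
    [Algebra R D] [Small.{u} D] {D' : Type v₂} [Ring D'] [Algebra R D'] [Small.{u} D']
    (x : S ⊗[R] (D ⊗[R] D')) :
    liftForm (pointRight R D D' S) ((SqZero.snd R D').baseChange _
      (liftForm ((sqZeroIncl R D' _).comp (pointLeft R D D' S))
        (Algebra.TensorProduct.map (sqZeroScalars R D' (scalarPoint R D D' S)) (AlgHom.id R D)
          (swapInr R S D D' x)))) =
      (TensorProduct.map (SqZero.inr R D) (SqZero.inr R D')).baseChange S x := by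
  induction x using tmul_tmul_induction with
  | zero => simp
  | tmul s d d' =>
    simp [sqZeroScalars, sqZeroIncl, scalarPoint_apply, pointLeft_apply, pointRight_apply]
  | add y y' h h' => simp only [map_add, h, h']

/-- Computing `tildeMap f g` takes only the value of `z` on the two generic forms; `hz` says that
this value is obtained by applying the two forms to `a` in succession. -/
theorem tildeMap_eq_of_tildeEval_eq {M : ModFunctor.{u, w₁} R} {N : ModFunctor.{u, w₂} R}
    {D : Type v₁} [Ring D] [Algebra R D] [Small.{u} D]
    {D' : Type v₂} [Ring D'] [Algebra R D'] [Small.{u} D']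
    (f : ModHom M (quasiCoherent (R := R) D).toMod)
    (g : ModHom N (quasiCoherent (R := R) D').toMod)
    {S : Type u} [CommRing S] [Algebra R S] (z : (M.tildeTensor N).obj S)
    (a : M.obj (S ⊗[R] SqZero R D')) {x : S ⊗[R] (D ⊗[R] D')}
    (ha : f.app _ a = swapInr R S D D' x)
    (hz : ModFunctor.tildeEval z (scalarPoint R D D' S)
        (M.dual.map (pointLeft R D D' S) (genericForm f))
        (N.dual.map (pointRight R D D' S) (genericForm g)) =
      liftForm (pointRight R D D' S) (coeff (scalarPoint R D D' S)
          (M.dual.map (pointLeft R D D' S) (genericForm f)) a)) :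
    (tildeMap f g).app S z = x := by
  rw [coeff_genericForm, ha, liftForm_snd_liftForm] at hz
  exact (congrArg ((qcLinear (TensorProduct.map (SqZero.snd R D) (SqZero.snd R D'))).app S)
    hz).trans (qcLinear_snd_inr x)

/-- The family is lifted first in the direction of A, giving w(Q'). A form φ on A applied to w(Q')
has coefficients in T ⊗ Q', compatible in Q', so they lift to b(φ) in B(T); then z is φ ⊗ ψ ↦
ψ(b(φ)). -/
theorem exists_rho_eq [∀ Q : A.QuasiCoherentQuotient, Small.{u} Q.carrier]
    [∀ Q : B.QuasiCoherentQuotient, Small.{u} Q.carrier]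
    (hA : A.ProQuasiCoherent) (hB : B.ProQuasiCoherent) {S : Type u} [CommRing S] [Algebra R S]
    (x : ∀ (Q : A.QuasiCoherentQuotient) (Q' : B.QuasiCoherentQuotient),
      S ⊗[R] (Q.carrier ⊗[R] Q'.carrier)) (hx : CompatibleFamily x) :
    ∃ z : (A.toMod.tildeTensor B.toMod).obj S, ∀ Q Q', (rho Q Q').app S z = x Q Q' := by
  obtain ⟨w, hw, hw'⟩ := exists_partial hA x hx
  have hb : ∀ (T : Type u) [CommRing T] [Algebra R T] (f : S →ₐ[R] T) (φ : A.toMod.dual.obj T),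
      ∃ b : B.obj T, ∀ Q' : B.QuasiCoherentQuotient,
        Q'.π.app T b = coeff (M := A.toMod) f φ (w Q') := fun T _ _ f φ => by
    refine (hB T (fun Q' => coeff (M := A.toMod) f φ (w Q')) fun Q₁ Q₂ g hg => ?_).exists
    obtain ⟨g, rfl⟩ := exists_eq_qcMap g
    rw [← hw' Q₁ Q₂ g hg]
    exact (coeff_sqZeroMap (M := A.toMod) f g φ (w Q₁)).symm
  choose b hb using hb
  -- Linearity and naturality of b(φ) in φ hold because they hold for the coefficients in each
  -- quotient of B.
  let z : (A.toMod.tildeTensor B.toMod).obj S := tildeOfFamily (M := A.toMod) (N := B.toMod) b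
    (fun T _ _ f φ ψ => hB.eq_of_forall fun Q' => by
      refine (hb T f (φ + ψ) Q').trans ((coeff_add f φ ψ _).trans ?_)
      exact (congrArg₂ (· + ·) (hb T f φ Q').symm (hb T f ψ Q').symm).trans
        (map_add (Q'.π.app T) _ _).symm)
    (fun T _ _ f t φ => hB.eq_of_forall fun Q' => by
      refine (hb T f (t • φ) Q').trans ((coeff_smul f t φ _).trans ?_)
      exact (congrArg (t • ·) (hb T f φ Q').symm).trans (map_smul (Q'.π.app T) _ _).symm)
    (fun T T' _ _ _ _ f g φ => hB.eq_of_forall fun Q' => by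
      refine (hb T' (g.comp f) _ Q').trans ((coeff_comp f g φ _).trans ?_)
      refine Eq.trans ?_ (Q'.π.naturality g (b T f φ)).symm
      rw [hb]
      rfl)
  refine ⟨z, fun Q Q' => ?_⟩
  refine tildeMap_eq_of_tildeEval_eq Q.π.toModHom Q'.π.toModHom z (w Q') (hw Q Q') ?_
  refine (eval_map_genericForm Q'.π.toModHom (pointRight R Q.carrier Q'.carrier S) _).trans ?_
  exact congrArg (liftForm (pointRight R Q.carrier Q'.carrier S)) (hb _ _ _ Q')

end Limit

end AlgFunctor

end

/-! ### The algebra structure on A ⊗̃ B. -/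

noncomputable section

universe v v₁ v₂

namespace AlgFunctor

variable {R : Type u} [CommRing R]

theorem map_boxMul {D₁ D₂ : Type v₁} {D₁' D₂' : Type v₂} [Ring D₁] [Algebra R D₁] [Ring D₂]
    [Algebra R D₂] [Ring D₁'] [Algebra R D₁'] [Ring D₂'] [Algebra R D₂'] (g : D₁ →ₐ[R] D₂)
    (g' : D₁' →ₐ[R] D₂') {S : Type u} [CommRing S] [Algebra R S] (x : S ⊗[R] D₁)
    (y : S ⊗[R] D₁') :
    Algebra.TensorProduct.map (AlgHom.id S S) (Algebra.TensorProduct.map g g') (boxMul x y) =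
      boxMul (Algebra.TensorProduct.map (AlgHom.id S S) g x)
        (Algebra.TensorProduct.map (AlgHom.id S S) g' y) := by
  induction x with
  | zero => rw [boxMul_zero_left, map_zero, map_zero, boxMul_zero_left]
  | add x₁ x₂ h₁ h₂ => rw [boxMul_add_left, map_add, map_add, boxMul_add_left, h₁, h₂]
  | tmul s d =>
  induction y with
  | zero => rw [boxMul_zero_right, map_zero, map_zero, boxMul_zero_right]
  | add x₁ x₂ h₁ h₂ => rw [boxMul_add_right, map_add, map_add, boxMul_add_right, h₁, h₂]
  | tmul t d' => simp [boxMul_tmul]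

section Structure

variable {A : AlgFunctor.{u, w₁} R} {B : AlgFunctor.{u, w₂} R}
  [∀ Q : A.QuasiCoherentQuotient, Small.{u} Q.carrier]
  [∀ Q : B.QuasiCoherentQuotient, Small.{u} Q.carrier]

/-- The image of `z ∈ A ⊗̃ B` in the tensor product of two quotients. -/
def rhoVal (Q : A.QuasiCoherentQuotient) (Q' : B.QuasiCoherentQuotient) {S : Type u} [CommRing S]
    [Algebra R S] (z : (A.toMod.tildeTensor B.toMod).obj S) :
    S ⊗[R] (Q.carrier ⊗[R] Q'.carrier) := (rho Q Q').app S z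

section

variable (Q : A.QuasiCoherentQuotient) (Q' : B.QuasiCoherentQuotient) {S : Type u} [CommRing S]
  [Algebra R S]

theorem rhoVal_add (z z' : (A.toMod.tildeTensor B.toMod).obj S) :
    rhoVal Q Q' (z + z') = rhoVal Q Q' z + rhoVal Q Q' z' := map_add ((rho Q Q').app S) z z'

theorem rhoVal_smul (s : S) (z : (A.toMod.tildeTensor B.toMod).obj S) :
    rhoVal Q Q' (s • z) = s • rhoVal Q Q' z := map_smul ((rho Q Q').app S) s z

theorem rhoVal_map {T : Type u} [CommRing T] [Algebra R T] (f : S →ₐ[R] T)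
    (z : (A.toMod.tildeTensor B.toMod).obj S) :
    rhoVal Q Q' ((A.toMod.tildeTensor B.toMod).map f z) =
      Algebra.TensorProduct.map f (AlgHom.id R _) (rhoVal Q Q' z) := (rho Q Q').naturality f z

theorem rhoVal_toTilde (a : A.obj S) (b : B.obj S) :
    rhoVal Q Q' ((ModFunctor.toTilde A.toMod B.toMod).app S (a ⊗ₜ[S] b)) =
      boxMul (Q.π.app S a) (Q'.π.app S b) :=
  tildeMap_toTilde Q.π.toModHom Q'.π.toModHom a b

theorem rhoVal_toTilde_mul (x y : A.obj S ⊗[S] B.obj S) :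
    rhoVal Q Q' ((ModFunctor.toTilde A.toMod B.toMod).app S (x * y)) =
      rhoVal Q Q' ((ModFunctor.toTilde A.toMod B.toMod).app S x) *
        rhoVal Q Q' ((ModFunctor.toTilde A.toMod B.toMod).app S y) := by
  let L : A.obj S ⊗[S] B.obj S →+ S ⊗[R] (Q.carrier ⊗[R] Q'.carrier) :=
    ((rho Q Q').app S).toAddMonoidHom.comp
      ((ModFunctor.toTilde A.toMod B.toMod).app S).toAddMonoidHom
  have hL : ∀ a b, L (a ⊗ₜ[S] b) = boxMul (Q.π.app S a) (Q'.π.app S b) :=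
    fun a b => rhoVal_toTilde Q Q' a b
  change L (x * y) = L x * L y
  induction x with
  | zero => rw [zero_mul, map_zero, zero_mul]
  | add x x' h h' => rw [add_mul, map_add, map_add, h, h', add_mul]
  | tmul a b =>
  induction y with
  | zero => rw [mul_zero, map_zero, mul_zero]
  | add x x' h h' => rw [mul_add, map_add, map_add, h, h', mul_add]
  | tmul a' b' =>
    rw [Algebra.TensorProduct.tmul_mul_tmul, hL, hL, hL]
    refine Eq.trans ?_ (boxMul_mul_boxMul _ _ _ _).symm
    exact congrArg₂ boxMul (map_mul (Q.π.app S) a a') (map_mul (Q'.π.app S) b b')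

theorem rhoVal_toTilde_one :
    rhoVal Q Q' ((ModFunctor.toTilde A.toMod B.toMod).app S
      ((1 : A.obj S) ⊗ₜ[S] (1 : B.obj S))) = 1 := by
  rw [rhoVal_toTilde, map_one, map_one]
  exact (boxMul_tmul 1 1 1 1).trans (by rw [one_mul]; rfl)

end

variable {I J : Type u} {P : Set (Set I)} {P' : Set (Set J)}
  (c : ModFunctor.Coordinates A.toMod P) (d : ModFunctor.Coordinates B.toMod P')
  (hA : A.ProQuasiCoherent) (hB : B.ProQuasiCoherent)

include c d in
-- By density it suffices to compare on tensors a ⊗ b, where both sides are products of images of a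
-- and b.
theorem compatibleFamily_rhoVal {S : Type u} [CommRing S] [Algebra R S]
    (z : (A.toMod.tildeTensor B.toMod).obj S) :
    CompatibleFamily fun (Q : A.QuasiCoherentQuotient) (Q' : B.QuasiCoherentQuotient) =>
      rhoVal Q Q' z := by
  intro Q₁ Q₂ Q₁' Q₂' g g' hg hg'
  have : (qcMap (Algebra.TensorProduct.map g g')).toModHom.comp (rho Q₁ Q₁') = rho Q₂ Q₂' := by
    refine c.tilde_modHom_ext d (ModFunctor.finitary_quasiCoherent _) fun S _ _ a b => ?_
    refine Eq.trans ?_ (rhoVal_toTilde Q₂ Q₂' a b).symm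
    rw [← hg, ← hg']
    refine Eq.trans ?_ (map_boxMul g g' (Q₁.π.app S a) (Q₁'.π.app S b))
    exact congrArg (Algebra.TensorProduct.map (AlgHom.id S S) (Algebra.TensorProduct.map g g'))
      (rhoVal_toTilde Q₁ Q₁' a b)
  exact congrArg (fun k : ModHom _ _ => k.app S z) this

include c d hA hB in
theorem rhoVal_injective {S : Type u} [CommRing S] [Algebra R S]
    {z z' : (A.toMod.tildeTensor B.toMod).obj S}
    (h : ∀ (Q : A.QuasiCoherentQuotient) (Q' : B.QuasiCoherentQuotient),
      rhoVal Q Q' z = rhoVal Q Q' z') : z = z' := by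
  rw [← sub_eq_zero]
  refine eq_zero_of_rho_eq_zero c d hA hB _ fun Q Q' => ?_
  exact (map_sub ((rho Q Q').app S) z z').trans (sub_eq_zero.2 (h Q Q'))

include c d hA hB in
-- Transition maps between the Q ⊗ Q' are multiplicative, so the componentwise product of two
-- compatible families is compatible and comes from an element.
theorem exists_rhoVal_eq_mul {S : Type u} [CommRing S] [Algebra R S]
    (z z' : (A.toMod.tildeTensor B.toMod).obj S) :
    ∃ y : (A.toMod.tildeTensor B.toMod).obj S,
      ∀ (Q : A.QuasiCoherentQuotient) (Q' : B.QuasiCoherentQuotient),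
        rhoVal Q Q' y = rhoVal Q Q' z * rhoVal Q Q' z' := by
  refine exists_rho_eq hA hB (fun Q Q' => rhoVal Q Q' z * rhoVal Q Q' z') ?_
  intro Q₁ Q₂ Q₁' Q₂' g g' hg hg'
  rw [map_mul, compatibleFamily_rhoVal c d z Q₁ Q₂ Q₁' Q₂' g g' hg hg',
    compatibleFamily_rhoVal c d z' Q₁ Q₂ Q₁' Q₂' g g' hg hg']

/-- The product on `A ⊗̃ B`. -/
def tildeMul {S : Type u} [CommRing S] [Algebra R S]
    (z z' : (A.toMod.tildeTensor B.toMod).obj S) : (A.toMod.tildeTensor B.toMod).obj S :=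
  (exists_rhoVal_eq_mul c d hA hB z z').choose

theorem rhoVal_tildeMul (Q : A.QuasiCoherentQuotient) (Q' : B.QuasiCoherentQuotient)
    {S : Type u} [CommRing S] [Algebra R S] (z z' : (A.toMod.tildeTensor B.toMod).obj S) :
    rhoVal Q Q' (tildeMul c d hA hB z z') = rhoVal Q Q' z * rhoVal Q Q' z' :=
  (exists_rhoVal_eq_mul c d hA hB z z').choose_spec Q Q'

/-- The structure of functor of algebras on `A ⊗̃ B`. -/
def tildeStructure : ModFunctor.AlgebraStructure (A.toMod.tildeTensor B.toMod) where
  -- Every axiom is verified after projection to the Q ⊗ Q', where it is an axiom of the tensor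
  -- product algebra.
  mul S _ _ := LinearMap.mk₂ S (tildeMul c d hA hB)
    (fun z z' y => rhoVal_injective c d hA hB fun Q Q' => by
      simp only [rhoVal_tildeMul, rhoVal_add, add_mul])
    (fun s z y => rhoVal_injective c d hA hB fun Q Q' => by
      simp only [rhoVal_tildeMul, rhoVal_smul, smul_mul_assoc])
    (fun z y y' => rhoVal_injective c d hA hB fun Q Q' => by
      simp only [rhoVal_tildeMul, rhoVal_add, mul_add])
    (fun s z y => rhoVal_injective c d hA hB fun Q Q' => by
      simp only [rhoVal_tildeMul, rhoVal_smul, mul_smul_comm])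
  one S _ _ := (ModFunctor.toTilde A.toMod B.toMod).app S ((1 : A.obj S) ⊗ₜ[S] (1 : B.obj S))
  mul_assoc x y z := rhoVal_injective c d hA hB fun Q Q' => by
    simp only [LinearMap.mk₂_apply, rhoVal_tildeMul, mul_assoc]
  one_mul x := rhoVal_injective c d hA hB fun Q Q' => by
    simp only [LinearMap.mk₂_apply, rhoVal_tildeMul, rhoVal_toTilde_one, one_mul]
  mul_one x := rhoVal_injective c d hA hB fun Q Q' => by
    simp only [LinearMap.mk₂_apply, rhoVal_tildeMul, rhoVal_toTilde_one, mul_one]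
  map_mul f x y := rhoVal_injective c d hA hB fun Q Q' => by
    simp only [LinearMap.mk₂_apply, rhoVal_tildeMul, rhoVal_map, map_mul]
  map_one f := rhoVal_injective c d hA hB fun Q Q' => by
    rw [rhoVal_map, rhoVal_toTilde_one, rhoVal_toTilde_one, map_one]

/-- The natural morphism `A ⊗ B → A ⊗̃ B`. -/
def tildeIncl : AlgFunctorHom (A.tensor B) (tildeStructure c d hA hB).toAlgFunctor where
  app S _ _ :=
    { toFun := fun x => (ModFunctor.toTilde A.toMod B.toMod).app S x
      map_one' := rfl
      map_mul' := fun x y => rhoVal_injective c d hA hB fun Q Q' =>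
        (rhoVal_toTilde_mul Q Q' x y).trans (rhoVal_tildeMul c d hA hB Q Q' _ _).symm
      map_zero' := map_zero ((ModFunctor.toTilde A.toMod B.toMod).app S)
      map_add' := map_add ((ModFunctor.toTilde A.toMod B.toMod).app S)
      commutes' := fun s => by
        have h : algebraMap S (A.obj S ⊗[S] B.obj S) s = s • (1 ⊗ₜ[S] 1) := by
          rw [Algebra.algebraMap_eq_smul_one]; rfl
        exact (congrArg ((ModFunctor.toTilde A.toMod B.toMod).app S) h).trans
          (map_smul ((ModFunctor.toTilde A.toMod B.toMod).app S) s _) }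
  naturality f x := (ModFunctor.toTilde A.toMod B.toMod).naturality f x

/-- The morphism from `A ⊗̃ B` to the tensor product of two quotients. -/
def rhoHom (Q : A.QuasiCoherentQuotient) (Q' : B.QuasiCoherentQuotient) :
    AlgFunctorHom (tildeStructure c d hA hB).toAlgFunctor
      (quasiCoherent (R := R) (Q.carrier ⊗[R] Q'.carrier)) where
  app S _ _ :=
    { toFun := rhoVal Q Q'
      map_one' := rhoVal_toTilde_one Q Q'
      map_mul' := rhoVal_tildeMul c d hA hB Q Q'
      map_zero' := map_zero ((rho Q Q').app S)
      map_add' := rhoVal_add Q Q'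
      commutes' := fun s => by
        refine (rhoVal_smul Q Q' s _).trans
          ((congrArg (s • ·) (rhoVal_toTilde_one Q Q')).trans ?_)
        exact (Algebra.algebraMap_eq_smul_one (A := S ⊗[R] (Q.carrier ⊗[R] Q'.carrier)) s).symm }
  naturality f z := (rho Q Q').naturality f z

end Structure

end AlgFunctor

end

/-! ### Natural bilinear maps to finitary functors. -/

noncomputable section

universe v v₁ v₂ v₃

variable {R : Type u} [CommRing R]

/-- A natural bilinear map. -/
structure BilinHom (M : ModFunctor.{u, w₁} R) (N : ModFunctor.{u, w₂} R)
    (G : ModFunctor.{u, w₃} R) where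
  app : ∀ (S : Type u) [CommRing S] [Algebra R S], M.obj S →ₗ[S] N.obj S →ₗ[S] G.obj S
  naturality : ∀ {S T : Type u} [CommRing S] [Algebra R S] [CommRing T] [Algebra R T]
    (f : S →ₐ[R] T) (m : M.obj S) (n : N.obj S),
    app T (M.map f m) (N.map f n) = G.map f (app S m n)

namespace BilinHom

variable {M : ModFunctor.{u, w₁} R} {N : ModFunctor.{u, w₂} R} {G : ModFunctor.{u, w₃} R}

/-- The linear morphism obtained by fixing the second variable. -/
def fixRight (μ : BilinHom M N G) {S : Type u} [CommRing S] [Algebra R S] (n : N.obj S) :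
    RestrictedHom M G S where
  app {T} _ _ f := (μ.app T).flip (N.map f n)
  naturality f g m := by
    rw [N.map_comp]
    exact μ.naturality g m (N.map f n)

/-- The linear morphism obtained by fixing the first variable. -/
def fixLeft (μ : BilinHom M N G) {S : Type u} [CommRing S] [Algebra R S] (m : M.obj S) :
    RestrictedHom N G S where
  app {T} _ _ f := μ.app T (M.map f m)
  naturality f g n := by
    rw [M.map_comp]
    exact μ.naturality g (M.map f m) n

theorem fixRight_app_id (μ : BilinHom M N G) {S : Type u} [CommRing S] [Algebra R S] (m : M.obj S)
    (n : N.obj S) : (μ.fixRight n).app (AlgHom.id R S) m = μ.app S m n :=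
  congrArg (μ.app S m) (N.map_id n)

theorem fixLeft_app_id (μ : BilinHom M N G) {S : Type u} [CommRing S] [Algebra R S] (m : M.obj S)
    (n : N.obj S) : (μ.fixLeft m).app (AlgHom.id R S) n = μ.app S m n :=
  congrArg (fun m => μ.app S m n) (M.map_id m)

/-- Bilinear maps are equal if they agree on sets that determine linear maps. -/
theorem app_eq_of_determines {S : Type u} [CommRing S] [Algebra R S] {X : Set (M.obj S)}
    {Y : Set (N.obj S)}
    (hX : ∀ h h' : RestrictedHom M G S,
      (∀ m ∈ X, h.app (AlgHom.id R S) m = h'.app (AlgHom.id R S) m) → h = h')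
    (hY : ∀ h h' : RestrictedHom N G S,
      (∀ n ∈ Y, h.app (AlgHom.id R S) n = h'.app (AlgHom.id R S) n) → h = h')
    {μ μ' : BilinHom M N G} (e : ∀ m ∈ X, ∀ n ∈ Y, μ.app S m n = μ'.app S m n) (m : M.obj S)
    (n : N.obj S) : μ.app S m n = μ'.app S m n := by
  -- Extension in the first variable with n in `Y` fixed; the second variable is then extended with
  -- m arbitrary.
  have h₁ : ∀ m, ∀ n ∈ Y, μ.app S m n = μ'.app S m n := fun m n hn => by
    rw [← fixRight_app_id, ← fixRight_app_id, hX (μ.fixRight n) (μ'.fixRight n) fun m hm => by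
      rw [fixRight_app_id, fixRight_app_id, e m hm n hn]]
  rw [← fixLeft_app_id, ← fixLeft_app_id, hY (μ.fixLeft m) (μ'.fixLeft m) fun n hn => by
    rw [fixLeft_app_id, fixLeft_app_id, h₁ m n hn]]

/-- The product of an algebra structure, followed by a linear morphism. -/
def ofStructure (𝒮 : ModFunctor.AlgebraStructure M) (r : ModHom M G) : BilinHom M M G where
  app S _ _ := (𝒮.mul S).compr₂ (r.app S)
  naturality f m n := by
    simp only [LinearMap.compr₂_apply, ← 𝒮.map_mul, r.naturality]

end BilinHom

namespace ModFunctor.Coordinates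

variable {M : ModFunctor.{u, w₁} R} {I : Type u} {P : Set (Set I)} (c : Coordinates M P)

/-- Morphisms to a finitary functor that agree on the basis over `R` are equal. -/
theorem modHom_ext {G : ModFunctor.{u, v} R} (hG : G.Finitary) {h h' : ModHom M G}
    (e : ∀ i, h.app R (c.basis R i) = h'.app R (c.basis R i)) : h = h' := by
  ext S _ _ m
  have := c.hom_ext hG (h := h.restrict S) (h' := h'.restrict S) fun i => by
    change h.app S (c.basis S i) = h'.app S (c.basis S i)
    rw [← c.map_basis (Algebra.ofId R S), h.naturality, h'.naturality, e]
  exact congrArg (fun k : RestrictedHom M G S => k.app (AlgHom.id R S) m) this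

/-- Bilinear maps to a finitary functor that agree on the basis over `R` are equal. -/
theorem bilinHom_ext {G : ModFunctor.{u, v} R} (hG : G.Finitary) {μ μ' : BilinHom M M G}
    (e : ∀ i j, μ.app R (c.basis R i) (c.basis R j) = μ'.app R (c.basis R i) (c.basis R j))
    (S : Type u) [CommRing S] [Algebra R S] (m n : M.obj S) : μ.app S m n = μ'.app S m n := by
  refine BilinHom.app_eq_of_determines (X := Set.range (c.basis S)) (Y := Set.range (c.basis S))
    (fun h h' H => c.hom_ext hG fun i => H _ ⟨i, rfl⟩)
    (fun h h' H => c.hom_ext hG fun i => H _ ⟨i, rfl⟩) ?_ m n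
  rintro _ ⟨i, rfl⟩ _ ⟨j, rfl⟩
  rw [← c.map_basis (Algebra.ofId R S) i, ← c.map_basis (Algebra.ofId R S) j, μ.naturality,
    μ'.naturality, e]

/-- Bilinear maps from `M ⊗̃ N` to a finitary functor that agree on `M ⊗ N` are equal. -/
theorem tilde_bilinHom_ext (c : Coordinates M P) {N : ModFunctor.{u, w₂} R}
    {J : Type u} {Q : Set (Set J)}
    (d : Coordinates N Q) {G : ModFunctor.{u, v} R} (hG : G.Finitary)
    {μ μ' : BilinHom (M.tildeTensor N) (M.tildeTensor N) G} (S : Type u) [CommRing S]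
    [Algebra R S]
    (e : ∀ x y, μ.app S ((toTilde M N).app S x) ((toTilde M N).app S y) =
      μ'.app S ((toTilde M N).app S x) ((toTilde M N).app S y))
    (z z' : (M.tildeTensor N).obj S) : μ.app S z z' = μ'.app S z z' := by
  refine BilinHom.app_eq_of_determines (X := Set.range ((toTilde M N).app S))
    (Y := Set.range ((toTilde M N).app S))
    (fun h h' H => c.tilde_hom_ext d hG fun m n => H _ ⟨_, rfl⟩)
    (fun h h' H => c.tilde_hom_ext d hG fun m n => H _ ⟨_, rfl⟩) ?_ z z'
  rintro _ ⟨x, rfl⟩ _ ⟨y, rfl⟩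
  exact e x y

end ModFunctor.Coordinates

/-! ### Factoring morphisms to quasi-coherent algebras through quotients. -/

namespace AlgFunctor

theorem qcMap_comp {D₁ : Type v₁} {D₂ : Type v₂} {D₃ : Type v₃} [Ring D₁] [Algebra R D₁]
    [Ring D₂] [Algebra R D₂] [Ring D₃] [Algebra R D₃] (g : D₂ →ₐ[R] D₃) (f : D₁ →ₐ[R] D₂) :
    qcMap (g.comp f) = (qcMap g).comp (qcMap f) := by
  refine AlgFunctorHom.ext (funext fun S => funext fun _ => funext fun _ => ?_)
  exact Algebra.TensorProduct.map_comp (AlgHom.id S S) (AlgHom.id S S) g f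

theorem comp_assoc {A : AlgFunctor.{u, w₁} R} {B : AlgFunctor.{u, w₂} R}
    {C : AlgFunctor.{u, w₃} R} {D : AlgFunctor.{u, v} R} (h : AlgFunctorHom C D)
    (g : AlgFunctorHom B C) (f : AlgFunctorHom A B) : (h.comp g).comp f = h.comp (g.comp f) := rfl

/-- Square-zero extensions serve as test algebras, so they must live in the universe of R. This is
possible because Q is a quotient of A(R), which is identified with a module of functions I → R. -/
theorem small_carrier {A : AlgFunctor.{u, w} R} {I : Type u} {P : Set (Set I)}
    (c : ModFunctor.Coordinates A.toMod P) (Q : A.QuasiCoherentQuotient) :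
    Small.{u} Q.carrier := by
  refine small_of_surjective (α := ModFunctor.finFunObj P R)
    (f := fun x => Algebra.TensorProduct.lid R Q.carrier (Q.π.app R (c.inv.app R x))) fun y => ?_
  obtain ⟨a, ha⟩ := Q.surjective R ((Algebra.TensorProduct.lid R Q.carrier).symm y)
  refine ⟨c.hom.app R a, ?_⟩
  change Algebra.TensorProduct.lid R Q.carrier (Q.π.app R (c.inv.app R (c.hom.app R a))) = y
  rw [show c.inv.app R (c.hom.app R a) = a from c.inv_hom (S := R) a, ha,
    AlgEquiv.apply_symm_apply]

/-- Stated over R only: after a general base change an injection of algebras need not stay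
injective. -/
theorem qcMap_app_injective {D₁ : Type v₁} {D₂ : Type v₂} [Ring D₁] [Algebra R D₁] [Ring D₂]
    [Algebra R D₂] {k : D₁ →ₐ[R] D₂} (hk : Function.Injective k) :
    Function.Injective ((qcMap k).app R) := by
  have : ∀ x : R ⊗[R] D₁, Algebra.TensorProduct.lid R D₂
      (Algebra.TensorProduct.map (AlgHom.id R R) k x) =
        k (Algebra.TensorProduct.lid R D₁ x) := fun x => by
    induction x with
    | zero => simp
    | tmul r d => simp
    | add x y hx hy => simp only [map_add, hx, hy]
  intro (x : R ⊗[R] D₁) (y : R ⊗[R] D₁) hxy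
  apply (Algebra.TensorProduct.lid R D₁).injective
  apply hk
  rw [← this, ← this]
  exact congrArg _ hxy

/-- The `R`-algebra morphism `A(R) → D` defined by a morphism to a quasi-coherent algebra. -/
def globalMap {A : AlgFunctor.{u, w} R} {D : Type v} [Ring D] [Algebra R D]
    (f : AlgFunctorHom A (quasiCoherent (R := R) D)) : A.obj R →ₐ[R] D :=
  (Algebra.TensorProduct.lid R D).toAlgHom.comp (f.app R : A.obj R →ₐ[R] R ⊗[R] D)

theorem app_eq_one_tmul_globalMap {A : AlgFunctor.{u, w} R} {D : Type v} [Ring D] [Algebra R D]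
    (f : AlgFunctorHom A (quasiCoherent (R := R) D)) (a : A.obj R) :
    f.app R a = (1 : R) ⊗ₜ[R] globalMap f a :=
  ((Algebra.TensorProduct.lid R D).symm_apply_apply (f.app R a : R ⊗[R] D)).symm

/-- A morphism over `R` is a morphism. -/
def _root_.RestrictedHom.toModHom {M : ModFunctor.{u, w₁} R} {G : ModFunctor.{u, w₂} R}
    (h : RestrictedHom M G R) : ModHom M G where
  app S _ _ := h.app (Algebra.ofId R S)
  naturality {S T} _ _ _ _ f m := by
    rw [← h.naturality, Subsingleton.elim (f.comp (Algebra.ofId R S)) (Algebra.ofId R T)]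

/-- A value of a morphism to a quasi-coherent module. -/
def qcApp {A : AlgFunctor.{u, w} R} {D : Type v} [Ring D] [Algebra R D]
    (h : ModHom A.toMod (quasiCoherent (R := R) D).toMod) {S : Type u} [CommRing S] [Algebra R S] :
    A.obj S →ₗ[S] S ⊗[R] D := h.app S

theorem qcApp_map {A : AlgFunctor.{u, w} R} {D : Type v} [Ring D] [Algebra R D]
    (h : ModHom A.toMod (quasiCoherent (R := R) D).toMod) {S T : Type u} [CommRing S]
    [Algebra R S] [CommRing T] [Algebra R T] (f : S →ₐ[R] T) (a : A.obj S) :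
    qcApp h (A.map f a) = Algebra.TensorProduct.map f (AlgHom.id R D) (qcApp h a) :=
  h.naturality f a

/-- The bilinear map `(a, b) ↦ h(ab)`. -/
def bilinOfMul {A : AlgFunctor.{u, w} R} {D : Type v} [Ring D] [Algebra R D]
    (h : ModHom A.toMod (quasiCoherent (R := R) D).toMod) :
    BilinHom A.toMod A.toMod (quasiCoherent (R := R) D).toMod where
  app S _ _ := (LinearMap.mul S (A.obj S)).compr₂ (qcApp h)
  naturality {S T} _ _ _ _ f (a : A.obj S) (b : A.obj S) := by
    change qcApp h (A.map f a * A.map f b) =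
      Algebra.TensorProduct.map f (AlgHom.id R D) (qcApp h (a * b))
    rw [← map_mul, qcApp_map]

/-- The bilinear map `(a, b) ↦ h(a)h(b)`. -/
def bilinMulMul {A : AlgFunctor.{u, w} R} {D : Type v} [Ring D] [Algebra R D]
    (h : ModHom A.toMod (quasiCoherent (R := R) D).toMod) :
    BilinHom A.toMod A.toMod (quasiCoherent (R := R) D).toMod where
  app S _ _ := (LinearMap.mul S (S ⊗[R] D)).compl₁₂ (qcApp h) (qcApp h)
  naturality {S T} _ _ _ _ f (a : A.obj S) (b : A.obj S) := by
    change qcApp h (A.map f a) * qcApp h (A.map f b) =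
      Algebra.TensorProduct.map f (AlgHom.id R D) (qcApp h a * qcApp h b)
    rw [map_mul, qcApp_map, qcApp_map]

/-- A linear morphism to a quasi-coherent algebra that is multiplicative over `R` is a morphism of
functors of algebras. -/
theorem exists_algFunctorHom {A : AlgFunctor.{u, w} R} {I : Type u} {P : Set (Set I)}
    (c : ModFunctor.Coordinates A.toMod P) {D : Type v} [Ring D] [Algebra R D]
    (h : ModHom A.toMod (quasiCoherent (R := R) D).toMod) (p : A.obj R →ₐ[R] D)
    (hp : ∀ a : A.obj R, qcApp h a = 1 ⊗ₜ[R] p a) :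
    ∃ π : AlgFunctorHom A (quasiCoherent (R := R) D),
      ∀ (S : Type u) [CommRing S] [Algebra R S] (a : A.obj S), π.app S a = qcApp h a := by
  have hmul : ∀ (S : Type u) [CommRing S] [Algebra R S] (a b : A.obj S),
      qcApp h (a * b) = qcApp h a * qcApp h b := by
    -- Both sides are natural bilinear maps to a finitary functor, so it is enough to compare them
    -- over R, where the morphism is given by the algebra map `p`.
    refine c.bilinHom_ext (ModFunctor.finitary_quasiCoherent D) (μ := bilinOfMul h)
      (μ' := bilinMulMul h) fun i j => ?_
    have : ∀ a b : A.obj R, qcApp h (a * b) = qcApp h a * qcApp h b := fun a b => by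
      rw [hp, hp, hp, Algebra.TensorProduct.tmul_mul_tmul, one_mul, map_mul]
    exact this _ _
  have hone : ∀ (S : Type u) [CommRing S] [Algebra R S], qcApp h (1 : A.obj S) = 1 :=
    fun S _ _ => by
      rw [← map_one (A.map (Algebra.ofId R S)), qcApp_map, hp, map_one,
        ← Algebra.TensorProduct.one_def, map_one]
  exact ⟨{ app := fun S _ _ => AlgHom.ofLinearMap (qcApp h) (hone S) (hmul S)
           naturality := fun g a => qcApp_map h g a }, fun _ _ _ _ => rfl⟩

theorem surjective_of_globalMap {A : AlgFunctor.{u, w} R} {D : Type v} [Ring D] [Algebra R D]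
    (π : AlgFunctorHom A (quasiCoherent (R := R) D))
    (hπ : Function.Surjective (globalMap π)) (S : Type u) [CommRing S] [Algebra R S] :
    Function.Surjective (π.app S) := by
  intro (y : S ⊗[R] D)
  induction y with
  | zero => exact ⟨0, map_zero (π.app S)⟩
  | add x y hx hy =>
    obtain ⟨a, rfl⟩ := hx
    obtain ⟨b, rfl⟩ := hy
    exact ⟨a + b, map_add (π.app S) a b⟩
  | tmul s d =>
    obtain ⟨a, rfl⟩ := hπ d
    refine ⟨s • A.map (Algebra.ofId R S) a, (map_smul (π.app S) s _).trans ?_⟩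
    rw [π.naturality, app_eq_one_tmul_globalMap]
    change s • (Algebra.ofId R S 1 ⊗ₜ[R] globalMap π a : S ⊗[R] D) = _
    rw [map_one, TensorProduct.smul_tmul', smul_eq_mul, mul_one]

/-- A linear morphism to a quasi-coherent algebra lifts if it does so over `R`. -/
theorem exists_modHom_factor {A : AlgFunctor.{u, w} R} {I : Type u} {P : Set (Set I)}
    (c : ModFunctor.Coordinates A.toMod P) {D : Type v} [Ring D] [Algebra R D]
    (f : ModHom A.toMod (quasiCoherent (R := R) D).toMod) {D₁ : Type v₁} [Ring D₁] [Algebra R D₁]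
    (k : D₁ →ₐ[R] D) (hk : Function.Injective k) (p : A.obj R → D₁)
    (hkp : ∀ a : A.obj R, qcApp f a = 1 ⊗ₜ[R] k (p a)) :
    ∃ h : ModHom A.toMod (quasiCoherent (R := R) D₁).toMod,
      (qcMap k).toModHom.comp h = f ∧ ∀ a : A.obj R, qcApp h a = 1 ⊗ₜ[R] p a := by
  have hkp' : ∀ a : A.obj R, (qcMap k).app R ((1 : R) ⊗ₜ[R] p a : R ⊗[R] D₁) = f.app R a :=
    fun a => (hkp a).symm
  let n : I → (quasiCoherent (R := R) D₁).toMod.obj R := fun i =>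
    ((1 : R) ⊗ₜ[R] p (c.basis R i) : R ⊗[R] D₁)
  -- Since S ⊗ D₁ → S ⊗ D may fail to be injective, the factorization is constructed from the basis
  -- over R. There `k` is injective, so `n i` vanishes whenever `f` kills the i-th basis vector, and
  -- the support condition is inherited from `f`.
  have hn : {i | n i ≠ 0} ∈ perp (perp P) := by
    refine perp_mono_left (c.support_app_basis_mem (ModFunctor.finitary_quasiCoherent D)
      (f.restrict R)) fun i hi h0 => hi (qcMap_app_injective hk ?_)
    exact (hkp' _).trans (Eq.trans h0 (map_zero ((qcMap k).app R)).symm)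
  have hh : (qcMap k).toModHom.comp (c.lift n hn).toModHom = f :=
    c.modHom_ext (ModFunctor.finitary_quasiCoherent D) fun i => by
      refine Eq.trans ?_ (hkp' (c.basis R i))
      refine congrArg ((qcMap k).app R) ((c.lift_basis n hn _ i).trans ?_)
      rw [Subsingleton.elim (Algebra.ofId R R) (AlgHom.id R R), ModFunctor.map_id]
  generalize (c.lift n hn).toModHom = h at hh
  subst hh
  exact ⟨h, rfl, fun a => qcMap_app_injective hk (hkp' a).symm⟩

/-- A morphism to a quasi-coherent algebra factors through a given factorization over `R`. -/
theorem exists_factor {A : AlgFunctor.{u, w} R} {I : Type u} {P : Set (Set I)}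
    (c : ModFunctor.Coordinates A.toMod P) {D : Type v} [Ring D] [Algebra R D]
    (f : AlgFunctorHom A (quasiCoherent (R := R) D)) {D₁ : Type v₁} [Ring D₁] [Algebra R D₁]
    (k : D₁ →ₐ[R] D) (hk : Function.Injective k) (p : A.obj R →ₐ[R] D₁)
    (hkp : ∀ a, k (p a) = globalMap f a) :
    ∃ π : AlgFunctorHom A (quasiCoherent (R := R) D₁),
      (qcMap k).comp π = f ∧ ∀ a, globalMap π a = p a := by
  obtain ⟨h, hh, hhR⟩ := exists_modHom_factor c f.toModHom k hk p fun a => by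
    rw [hkp]
    exact app_eq_one_tmul_globalMap f a
  obtain ⟨π, hπ⟩ := exists_algFunctorHom c h p hhR
  refine ⟨π, ?_, fun a => ?_⟩
  · refine AlgFunctorHom.ext (funext fun S => funext fun _ => funext fun _ =>
      AlgHom.ext fun a => ?_)
    refine (congrArg ((qcMap k).app S) (hπ S a)).trans ?_
    exact congrArg (fun j : ModHom _ _ => j.app S a) hh
  · refine (congrArg (Algebra.TensorProduct.lid R D₁) ((hπ R a).trans (hhR a))).trans ?_
    simp

/-- A morphism from `A` to a quasi-coherent algebra factors through a quotient of `A`. -/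
theorem exists_quotient_factor {A : AlgFunctor.{u, w} R} {I : Type u} {P : Set (Set I)}
    (c : ModFunctor.Coordinates A.toMod P) {D : Type v} [Ring D] [Algebra R D]
    (f : AlgFunctorHom A (quasiCoherent (R := R) D)) :
    ∃ (Q : A.QuasiCoherentQuotient) (k : Q.carrier →ₐ[R] D), (qcMap k).comp Q.π = f := by
  let F := globalMap f
  -- The image of A(R) lies in the universe of D, whereas a quotient of A has its carrier in the
  -- universe of A.
  have : Small.{w} F.range := small_of_surjective F.rangeRestrict_surjective
  let e : Shrink.{w} F.range ≃ₐ[R] F.range := Shrink.algEquiv R F.range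
  let k : Shrink.{w} F.range →ₐ[R] D := F.range.val.comp e.toAlgHom
  have hk : Function.Injective k := Subtype.val_injective.comp e.injective
  let p : A.obj R →ₐ[R] Shrink.{w} F.range := e.symm.toAlgHom.comp F.rangeRestrict
  have hp : Function.Surjective p := e.symm.surjective.comp F.rangeRestrict_surjective
  have hkp : ∀ a, k (p a) = F a := fun a => by simp [k, p]
  obtain ⟨π, hπ, hπ'⟩ := exists_factor c f k hk p hkp
  exact ⟨⟨_, π, surjective_of_globalMap π fun y => (hp y).imp fun a ha => (hπ' a).trans ha⟩, k, hπ⟩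

end AlgFunctor

end

/-! ### Cofinality of the Q ⊗ Q' and maps into limits. -/

noncomputable section

universe v v₁ v₂ v₃

namespace AlgFunctor

variable {R : Type u} [CommRing R]

theorem _root_.AlgFunctorHom.ext_app {A : AlgFunctor.{u, w₁} R} {B : AlgFunctor.{u, w₂} R}
    {f g : AlgFunctorHom A B}
    (h : ∀ (S : Type u) [CommRing S] [Algebra R S] (a : A.obj S), f.app S a = g.app S a) :
    f = g :=
  AlgFunctorHom.ext (funext fun S => funext fun _ => funext fun _ => AlgHom.ext fun a => h S a)

/-- The inclusion `A → A ⊗ B`. -/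
def tensorInclLeft (A : AlgFunctor.{u, w₁} R) (B : AlgFunctor.{u, w₂} R) :
    AlgFunctorHom A (A.tensor B) where
  app S _ _ := (Algebra.TensorProduct.includeLeft : A.obj S →ₐ[S] A.obj S ⊗[S] B.obj S)
  naturality {S T} _ _ _ _ f a := by
    change A.map f a ⊗ₜ[T] (1 : B.obj T) = A.map f a ⊗ₜ[T] B.map f 1
    rw [map_one]

/-- The inclusion `B → A ⊗ B`. -/
def tensorInclRight (A : AlgFunctor.{u, w₁} R) (B : AlgFunctor.{u, w₂} R) :
    AlgFunctorHom B (A.tensor B) where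
  app S _ _ := (Algebra.TensorProduct.includeRight : B.obj S →ₐ[S] A.obj S ⊗[S] B.obj S)
  naturality {S T} _ _ _ _ f b := by
    change (1 : A.obj T) ⊗ₜ[T] B.map f b = A.map f 1 ⊗ₜ[T] B.map f b
    rw [map_one]

theorem inclLeft_mul_inclRight {A : AlgFunctor.{u, w₁} R} {B : AlgFunctor.{u, w₂} R} {S : Type u}
    [CommRing S] [Algebra R S] (a : A.obj S) (b : B.obj S) :
    (tensorInclLeft A B).app S a * (tensorInclRight A B).app S b =
      (a ⊗ₜ[S] b : A.obj S ⊗[S] B.obj S) := by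
  change (a ⊗ₜ[S] (1 : B.obj S)) * ((1 : A.obj S) ⊗ₜ[S] b) = _
  rw [Algebra.TensorProduct.tmul_mul_tmul, mul_one, one_mul]

theorem inclRight_mul_inclLeft {A : AlgFunctor.{u, w₁} R} {B : AlgFunctor.{u, w₂} R} {S : Type u}
    [CommRing S] [Algebra R S] (a : A.obj S) (b : B.obj S) :
    (tensorInclRight A B).app S b * (tensorInclLeft A B).app S a =
      (a ⊗ₜ[S] b : A.obj S ⊗[S] B.obj S) := by
  change ((1 : A.obj S) ⊗ₜ[S] b) * (a ⊗ₜ[S] (1 : B.obj S)) = _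
  rw [Algebra.TensorProduct.tmul_mul_tmul, mul_one, one_mul]

theorem globalMap_surjective {A : AlgFunctor.{u, w} R} (Q : A.QuasiCoherentQuotient) :
    Function.Surjective (globalMap Q.π) :=
  (Algebra.TensorProduct.lid R Q.carrier).surjective.comp (Q.surjective R)

theorem globalMap_qcMap_comp {A : AlgFunctor.{u, w} R} {D : Type v₁} [Ring D] [Algebra R D]
    {D' : Type v₂} [Ring D'] [Algebra R D'] (k : D →ₐ[R] D')
    (f : AlgFunctorHom A (quasiCoherent (R := R) D)) (a : A.obj R) :
    globalMap ((qcMap k).comp f) a = k (globalMap f a) := by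
  change Algebra.TensorProduct.lid R D' ((qcMap k).app R (f.app R a)) = _
  rw [app_eq_one_tmul_globalMap f, qcMap_tmul]
  simp

theorem globalMap_comp {A : AlgFunctor.{u, w₁} R} {B : AlgFunctor.{u, w₂} R} {D : Type v} [Ring D]
    [Algebra R D] (f : AlgFunctorHom B (quasiCoherent (R := R) D)) (g : AlgFunctorHom A B)
    (a : A.obj R) : globalMap (f.comp g) a = globalMap f (g.app R a) := rfl

theorem map_lift_boxMul {D₁ : Type v₁} [Ring D₁] [Algebra R D₁] {D₂ : Type v₂} [Ring D₂]
    [Algebra R D₂] {D : Type v} [Ring D] [Algebra R D] (k : D₁ →ₐ[R] D) (k' : D₂ →ₐ[R] D)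
    (hkk' : ∀ x y, Commute (k x) (k' y)) {S : Type u} [CommRing S] [Algebra R S]
    (x : S ⊗[R] D₁) (y : S ⊗[R] D₂) :
    Algebra.TensorProduct.map (AlgHom.id S S) (Algebra.TensorProduct.lift k k' hkk')
      (boxMul x y) = Algebra.TensorProduct.map (AlgHom.id S S) k x *
        Algebra.TensorProduct.map (AlgHom.id S S) k' y := by
  induction x with
  | zero => rw [boxMul_zero_left, map_zero, map_zero, zero_mul]
  | add x₁ x₂ h₁ h₂ => rw [boxMul_add_left, map_add, map_add, add_mul, h₁, h₂]
  | tmul s d =>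
  induction y with
  | zero => rw [boxMul_zero_right, map_zero, map_zero, mul_zero]
  | add x₁ x₂ h₁ h₂ => rw [boxMul_add_right, map_add, map_add, mul_add, h₁, h₂]
  | tmul t d' => simp [boxMul_tmul]

theorem qcMap_symm_comp {D : Type v₁} [Ring D] [Algebra R D] {D' : Type v₂} [Ring D']
    [Algebra R D'] (e : D ≃ₐ[R] D') {A : AlgFunctor.{u, w} R}
    (f : AlgFunctorHom A (quasiCoherent (R := R) D)) :
    (qcMap e.symm.toAlgHom).comp ((qcMap e.toAlgHom).comp f) = f := by
  rw [← comp_assoc, ← qcMap_comp]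
  have : e.symm.toAlgHom.comp e.toAlgHom = AlgHom.id R D := AlgHom.ext e.symm_apply_apply
  rw [this]
  refine AlgFunctorHom.ext_app fun S _ _ a => ?_
  change Algebra.TensorProduct.map (AlgHom.id S S) (AlgHom.id R D) (f.app S a) = _
  rw [Algebra.TensorProduct.map_id]
  rfl

theorem qcMap_symm_app {D : Type v₁} [Ring D] [Algebra R D] {D' : Type v₂} [Ring D']
    [Algebra R D'] (e : D ≃ₐ[R] D') {S : Type u} [CommRing S] [Algebra R S]
    (x : (quasiCoherent (R := R) D).obj S) :
    (qcMap e.symm.toAlgHom).app S ((qcMap e.toAlgHom).app S x) = x := by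
  have := qcMap_symm_comp e (qcMap (AlgHom.id R D))
  have h := congrArg (fun j : AlgFunctorHom _ _ => j.app S x) this
  have hid : (qcMap (AlgHom.id R D)).app S x = x := by
    change Algebra.TensorProduct.map (AlgHom.id S S) (AlgHom.id R D) x = _
    rw [Algebra.TensorProduct.map_id]
    rfl
  rw [← hid]
  exact h.trans (by rw [hid])

theorem surjective_qcMap_comp {D : Type v₁} [Ring D] [Algebra R D] {D' : Type v₂} [Ring D']
    [Algebra R D'] (e : D ≃ₐ[R] D') {A : AlgFunctor.{u, w} R}
    (f : AlgFunctorHom A (quasiCoherent (R := R) D)) {S : Type u} [CommRing S] [Algebra R S]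
    (hf : Function.Surjective (f.app S)) :
    Function.Surjective (((qcMap e.toAlgHom).comp f).app S) := fun y => by
  obtain ⟨a, ha⟩ := hf ((qcMap e.symm.toAlgHom).app S y)
  exact ⟨a, (congrArg ((qcMap e.toAlgHom).app S) ha).trans (qcMap_symm_app e.symm y)⟩

/-- A morphism from `A ⊗ B` to a quasi-coherent algebra factors through the tensor product of a
quotient of `A` and a quotient of `B`. -/
theorem exists_tensor_factor {A : AlgFunctor.{u, w₁} R} {B : AlgFunctor.{u, w₂} R}
    {I J : Type u} {P : Set (Set I)} {P' : Set (Set J)}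
    (c : ModFunctor.Coordinates A.toMod P) (d : ModFunctor.Coordinates B.toMod P')
    {D : Type v} [Ring D] [Algebra R D]
    (f : AlgFunctorHom (A.tensor B) (quasiCoherent (R := R) D)) :
    ∃ (Q : A.QuasiCoherentQuotient) (Q' : B.QuasiCoherentQuotient)
      (k : Q.carrier ⊗[R] Q'.carrier →ₐ[R] D),
      ∀ (S : Type u) [CommRing S] [Algebra R S] (a : A.obj S) (b : B.obj S),
        f.app S (a ⊗ₜ[S] b : A.obj S ⊗[S] B.obj S) =
          Algebra.TensorProduct.map (AlgHom.id S S) k (boxMul (Q.π.app S a) (Q'.π.app S b)) := by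
  obtain ⟨Q, k, hk⟩ := exists_quotient_factor c (f.comp (tensorInclLeft A B))
  obtain ⟨Q', k', hk'⟩ := exists_quotient_factor d (f.comp (tensorInclRight A B))
  -- Elements of Q and Q' lift to A(R) and B(R), whose images in A(R) ⊗ B(R) commute; so the two
  -- factorizations combine into a map from Q ⊗ Q'.
  have hcomm : ∀ x y, Commute (k x) (k' y) := fun x y => by
    obtain ⟨a, rfl⟩ := globalMap_surjective Q x
    obtain ⟨b, rfl⟩ := globalMap_surjective Q' y
    rw [← globalMap_qcMap_comp, ← globalMap_qcMap_comp, hk, hk', globalMap_comp, globalMap_comp]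
    change _ * _ = _ * _
    rw [← map_mul, ← map_mul]
    exact congrArg (globalMap f)
      ((inclLeft_mul_inclRight a b).trans (inclRight_mul_inclLeft a b).symm)
  refine ⟨Q, Q', Algebra.TensorProduct.lift k k' hcomm, fun S _ _ a b => ?_⟩
  refine Eq.trans ?_ (map_lift_boxMul k k' hcomm (Q.π.app S a) (Q'.π.app S b)).symm
  refine (congrArg (f.app S) (inclLeft_mul_inclRight a b).symm).trans ?_
  refine (map_mul (f.app S) _ _).trans (congrArg₂ (· * ·) ?_ ?_)
  · exact congrArg (fun j : AlgFunctorHom _ _ => j.app S a) hk.symm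
  · exact congrArg (fun j : AlgFunctorHom _ _ => j.app S b) hk'.symm

/-- Compatible morphisms to the quotients of a pro-quasicoherent functor define a morphism. -/
theorem ProQuasiCoherent.exists_hom {C : AlgFunctor.{u, w₁} R} (hC : C.ProQuasiCoherent)
    {X : AlgFunctor.{u, w₂} R}
    (F : ∀ Q : C.QuasiCoherentQuotient, AlgFunctorHom X (quasiCoherent (R := R) Q.carrier))
    (hF : ∀ (Q Q' : C.QuasiCoherentQuotient)
      (g : AlgFunctorHom (quasiCoherent (R := R) Q.carrier) (quasiCoherent (R := R) Q'.carrier)),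
      g.comp Q.π = Q'.π → g.comp (F Q) = F Q') :
    ∃ G : AlgFunctorHom X C, ∀ Q : C.QuasiCoherentQuotient, Q.π.comp G = F Q := by
  have : ∀ (S : Type u) [CommRing S] [Algebra R S] (x : X.obj S),
      ∃ y : C.obj S, ∀ Q : C.QuasiCoherentQuotient, Q.π.app S y = (F Q).app S x :=
    fun S _ _ x => (hC S (fun Q => (F Q).app S x) fun Q Q' g hg =>
      congrArg (fun j : AlgFunctorHom _ _ => j.app S x) (hF Q Q' g hg)).exists
  choose G hG using this
  refine ⟨{ app := fun S _ _ =>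
              { toFun := G S
                map_one' := hC.eq_of_forall fun Q => by rw [hG, map_one, map_one]
                map_mul' := fun x y => hC.eq_of_forall fun Q => by
                  rw [hG, map_mul, map_mul, hG, hG]
                map_zero' := hC.eq_of_forall fun Q => by rw [hG, map_zero, map_zero]
                map_add' := fun x y => hC.eq_of_forall fun Q => by
                  rw [hG, map_add, map_add, hG, hG]
                commutes' := fun s => hC.eq_of_forall fun Q => by
                  rw [hG, AlgHom.commutes, AlgHom.commutes] }
            naturality := fun f x => hC.eq_of_forall fun Q => ?_ }, fun Q =>
      AlgFunctorHom.ext_app fun S _ _ x => hG S x Q⟩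
  change Q.π.app _ (G _ _) = Q.π.app _ (C.map f (G _ x))
  rw [hG, Q.π.naturality, hG, (F Q).naturality]

/-! ### Uniqueness, pro-quasicoherence and the universal property. -/

section Tilde

variable {A : AlgFunctor.{u, w₁} R} {B : AlgFunctor.{u, w₂} R}
  [∀ Q : A.QuasiCoherentQuotient, Small.{u} Q.carrier]
  [∀ Q : B.QuasiCoherentQuotient, Small.{u} Q.carrier]
  {I J : Type u} {P : Set (Set I)} {P' : Set (Set J)}
  (c : ModFunctor.Coordinates A.toMod P) (d : ModFunctor.Coordinates B.toMod P')
  (hA : A.ProQuasiCoherent) (hB : B.ProQuasiCoherent)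

/-- A morphism of algebras from `A ⊗̃ B` to a quasi-coherent algebra is determined by its
restriction to `A ⊗ B`. -/
theorem tilde_algFunctorHom_ext {D : Type v} [Ring D] [Algebra R D]
    {φ φ' : AlgFunctorHom (tildeStructure c d hA hB).toAlgFunctor (quasiCoherent (R := R) D)}
    (h : φ.comp (tildeIncl c d hA hB) = φ'.comp (tildeIncl c d hA hB)) : φ = φ' := by
  have : (show ModHom (A.toMod.tildeTensor B.toMod) _ from φ.toModHom) = φ'.toModHom :=
    c.tilde_modHom_ext d (ModFunctor.finitary_quasiCoherent D) fun S _ _ a b =>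
      congrArg (fun j : AlgFunctorHom _ _ => j.app S (a ⊗ₜ[S] b : A.obj S ⊗[S] B.obj S)) h
  exact AlgFunctorHom.ext_app fun S _ _ z => congrArg (fun j : ModHom _ _ => j.app S z) this

/-- The existence half of the universal property for quasi-coherent targets: the factorization of
`f` through Q ⊗ Q' extends because `rhoHom` is defined on all of A ⊗̃ B. -/
theorem exists_tilde_factor {D : Type v} [Ring D] [Algebra R D]
    (f : AlgFunctorHom (A.tensor B) (quasiCoherent (R := R) D)) :
    ∃ (Q : A.QuasiCoherentQuotient) (Q' : B.QuasiCoherentQuotient)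
      (k : Q.carrier ⊗[R] Q'.carrier →ₐ[R] D),
      ((qcMap k).comp (rhoHom c d hA hB Q Q')).comp (tildeIncl c d hA hB) = f := by
  obtain ⟨Q, Q', k, hk⟩ := exists_tensor_factor c d f
  refine ⟨Q, Q', k, AlgFunctorHom.ext_app fun S _ _ (x : A.obj S ⊗[S] B.obj S) => ?_⟩
  set F := ((qcMap k).comp (rhoHom c d hA hB Q Q')).comp (tildeIncl c d hA hB)
  induction x with
  | zero => exact (map_zero (F.app S)).trans (map_zero (f.app S)).symm
  | add x y hx hy =>
    exact (map_add (F.app S) x y).trans ((congrArg₂ (· + ·) hx hy).trans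
      (map_add (f.app S) x y).symm)
  | tmul a b =>
    refine Eq.trans ?_ (hk S a b).symm
    exact congrArg ((qcMap k).app S) (rhoVal_toTilde Q Q' a b)

/-- Density is available only for finitary targets, so the two products are compared after `rho Q
Q'`; there they agree because they agree on the image of A ⊗ B. -/
theorem tildeStructure_unique
    (𝒮' : ModFunctor.AlgebraStructure (A.toMod.tildeTensor B.toMod))
    (ι' : AlgFunctorHom (A.tensor B) 𝒮'.toAlgFunctor)
    (h : ∀ (S : Type u) [CommRing S] [Algebra R S] (x : (A.tensor B).obj S),
      ι'.app S x = (ModFunctor.toTilde A.toMod B.toMod).app S x) :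
    𝒮' = tildeStructure c d hA hB := by
  set 𝒮 := tildeStructure c d hA hB
  have hmul' : ∀ (S : Type u) [CommRing S] [Algebra R S] (x y : A.obj S ⊗[S] B.obj S),
      𝒮'.mul S ((ModFunctor.toTilde A.toMod B.toMod).app S x)
        ((ModFunctor.toTilde A.toMod B.toMod).app S y) =
          (ModFunctor.toTilde A.toMod B.toMod).app S (x * y) := fun S _ _ x y => by
    refine Eq.trans ?_ (h S (x * y))
    refine Eq.trans ?_ (map_mul (ι'.app S) x y).symm
    exact congrArg₂ (fun z z' => 𝒮'.mul S z z') (h S x).symm (h S y).symm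
  have hmul : ∀ (S : Type u) [CommRing S] [Algebra R S] (x y : A.obj S ⊗[S] B.obj S),
      𝒮.mul S ((ModFunctor.toTilde A.toMod B.toMod).app S x)
        ((ModFunctor.toTilde A.toMod B.toMod).app S y) =
          (ModFunctor.toTilde A.toMod B.toMod).app S (x * y) := fun S _ _ x y =>
    (map_mul ((tildeIncl c d hA hB).app S) x y).symm
  refine ModFunctor.AlgebraStructure.ext ?_ ?_
  · refine funext fun S => funext fun _ => funext fun _ => LinearMap.ext₂ fun z z' => ?_
    refine rhoVal_injective c d hA hB fun Q Q' => ?_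
    refine c.tilde_bilinHom_ext d (ModFunctor.finitary_quasiCoherent _)
      (μ := BilinHom.ofStructure 𝒮' (rho Q Q')) (μ' := BilinHom.ofStructure 𝒮 (rho Q Q'))
      S (fun x y => ?_) z z'
    exact congrArg ((rho Q Q').app S) ((hmul' S x y).trans (hmul S x y).symm)
  · refine funext fun S => funext fun _ => funext fun _ => ?_
    exact (map_one (ι'.app S)).symm.trans (h S 1)

theorem rhoHom_surjective (Q : A.QuasiCoherentQuotient) (Q' : B.QuasiCoherentQuotient)
    (S : Type u) [CommRing S] [Algebra R S] :
    Function.Surjective ((rhoHom c d hA hB Q Q').app S) := by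
  intro (x : S ⊗[R] (Q.carrier ⊗[R] Q'.carrier))
  induction x using tmul_tmul_induction with
  | zero => exact ⟨0, map_zero _⟩
  | add x y hx hy =>
    obtain ⟨a, rfl⟩ := hx
    obtain ⟨b, rfl⟩ := hy
    exact ⟨a + b, map_add _ a b⟩
  | tmul s d d' =>
    obtain ⟨a, ha⟩ := Q.surjective S (s ⊗ₜ[R] d : S ⊗[R] Q.carrier)
    obtain ⟨b, hb⟩ := Q'.surjective S ((1 : S) ⊗ₜ[R] d' : S ⊗[R] Q'.carrier)
    refine ⟨(ModFunctor.toTilde A.toMod B.toMod).app S (a ⊗ₜ[S] b), ?_⟩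
    refine (rhoVal_toTilde Q Q' a b).trans ?_
    rw [ha, hb, boxMul_tmul, mul_one]

/-- The tensor product of the algebras of two quotients, in the universe of the values of
`A ⊗̃ B`. -/
def liftEquiv (Q : A.QuasiCoherentQuotient) (Q' : B.QuasiCoherentQuotient) :
    ULift.{max (u + 1) w₁ w₂} (Q.carrier ⊗[R] Q'.carrier) ≃ₐ[R] Q.carrier ⊗[R] Q'.carrier :=
  ULift.algEquiv

/-- The tensor product of two quotients, as a quotient of `A ⊗̃ B`. -/
def tildeQuotient (Q : A.QuasiCoherentQuotient) (Q' : B.QuasiCoherentQuotient) :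
    (tildeStructure c d hA hB).toAlgFunctor.QuasiCoherentQuotient where
  carrier := ULift.{max (u + 1) w₁ w₂} (Q.carrier ⊗[R] Q'.carrier)
  π := (qcMap (liftEquiv Q Q').symm.toAlgHom).comp (rhoHom c d hA hB Q Q')
  surjective S _ _ := surjective_qcMap_comp (liftEquiv Q Q').symm (rhoHom c d hA hB Q Q')
    (rhoHom_surjective c d hA hB Q Q' S)

theorem qcMap_map_comp_rhoHom (Q₁ Q₂ : A.QuasiCoherentQuotient) (Q₁' Q₂' : B.QuasiCoherentQuotient)
    (g : Q₁.carrier →ₐ[R] Q₂.carrier) (g' : Q₁'.carrier →ₐ[R] Q₂'.carrier)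
    (hg : (qcMap g).comp Q₁.π = Q₂.π) (hg' : (qcMap g').comp Q₁'.π = Q₂'.π) :
    (qcMap (Algebra.TensorProduct.map g g')).comp (rhoHom c d hA hB Q₁ Q₁') =
      rhoHom c d hA hB Q₂ Q₂' :=
  AlgFunctorHom.ext_app fun _ _ _ z => compatibleFamily_rhoVal c d z Q₁ Q₂ Q₁' Q₂' g g' hg hg'

/-- The algebra of `tildeQuotient` is the tensor product. -/
def tildeQuotientEquiv (Q : A.QuasiCoherentQuotient) (Q' : B.QuasiCoherentQuotient) :
    (tildeQuotient c d hA hB Q Q').carrier ≃ₐ[R] Q.carrier ⊗[R] Q'.carrier :=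
  liftEquiv Q Q'

theorem qcMap_comp_tildeQuotient (Q : A.QuasiCoherentQuotient) (Q' : B.QuasiCoherentQuotient) :
    (qcMap (tildeQuotientEquiv c d hA hB Q Q').toAlgHom).comp
      (tildeQuotient c d hA hB Q Q').π = rhoHom c d hA hB Q Q' :=
  qcMap_symm_comp (liftEquiv Q Q').symm _

/-- The quotients Q ⊗ Q' already have A ⊗̃ B as their limit, and they are cofinal among all
quotients. -/
theorem proQuasiCoherent_tilde : (tildeStructure c d hA hB).toAlgFunctor.ProQuasiCoherent := by
  intro S _ _ x hx
  let y (Q : A.QuasiCoherentQuotient) (Q' : B.QuasiCoherentQuotient) :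
      S ⊗[R] (Q.carrier ⊗[R] Q'.carrier) :=
    (qcMap (tildeQuotientEquiv c d hA hB Q Q').toAlgHom).app S (x (tildeQuotient c d hA hB Q Q'))
  have hy : CompatibleFamily y := by
    intro Q₁ Q₂ Q₁' Q₂' g g' hg hg'
    have h := hx (tildeQuotient c d hA hB Q₁ Q₁') (tildeQuotient c d hA hB Q₂ Q₂')
      ((qcMap (tildeQuotientEquiv c d hA hB Q₂ Q₂').symm.toAlgHom).comp
        ((qcMap (Algebra.TensorProduct.map g g')).comp
          (qcMap (tildeQuotientEquiv c d hA hB Q₁ Q₁').toAlgHom))) (by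
        rw [comp_assoc, comp_assoc, qcMap_comp_tildeQuotient,
          qcMap_map_comp_rhoHom c d hA hB Q₁ Q₂ Q₁' Q₂' g g' hg hg']
        rfl)
    exact (qcMap_symm_app (tildeQuotientEquiv c d hA hB Q₂ Q₂').symm _).symm.trans
      (congrArg ((qcMap (tildeQuotientEquiv c d hA hB Q₂ Q₂').toAlgHom).app S) h)
  obtain ⟨z, hz⟩ := exists_rho_eq hA hB y hy
  refine ⟨z, fun T => ?_, fun z' hz' => rhoVal_injective c d hA hB fun Q Q' => ?_⟩
  -- An arbitrary quotient `T` receives a map from some Q ⊗ Q': its restriction to A ⊗ B factors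
  -- that way, and density extends the identity to A ⊗̃ B. So the component of `x` at `T` is forced
  -- by the one at Q ⊗ Q'.
  · obtain ⟨Q, Q', k, hk⟩ := exists_tilde_factor c d hA hB (T.π.comp (tildeIncl c d hA hB))
    have hT : (qcMap k).comp (rhoHom c d hA hB Q Q') = T.π := tilde_algFunctorHom_ext c d hA hB hk
    have h := hx (tildeQuotient c d hA hB Q Q') T
      ((qcMap k).comp (qcMap (tildeQuotientEquiv c d hA hB Q Q').toAlgHom)) (by
      rw [comp_assoc, qcMap_comp_tildeQuotient, hT])
    refine (congrArg (fun j : AlgFunctorHom _ _ => j.app S z) hT).symm.trans ?_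
    exact (congrArg ((qcMap k).app S) (hz Q Q')).trans h
  · refine Eq.trans ?_ (hz Q Q').symm
    refine (congrArg (fun j : AlgFunctorHom _ _ => j.app S z')
      (qcMap_comp_tildeQuotient c d hA hB Q Q')).symm.trans ?_
    exact congrArg ((qcMap (tildeQuotientEquiv c d hA hB Q Q').toAlgHom).app S)
      (hz' (tildeQuotient c d hA hB Q Q'))

/-- As `C` is the limit of its quotients, both injectivity and surjectivity reduce to quasi-coherent
targets. -/
theorem bijective_comp_tildeIncl {C : AlgFunctor.{u, w₃} R} (hC : C.ProQuasiCoherent) :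
    Function.Bijective (fun φ : AlgFunctorHom (tildeStructure c d hA hB).toAlgFunctor C =>
      φ.comp (tildeIncl c d hA hB)) := by
  constructor
  · intro φ φ' h
    refine AlgFunctorHom.ext_app fun S _ _ z => hC.eq_of_forall fun Q => ?_
    have : Q.π.comp φ = Q.π.comp φ' :=
      tilde_algFunctorHom_ext c d hA hB (congrArg (fun j : AlgFunctorHom _ _ => Q.π.comp j) h)
    exact congrArg (fun j : AlgFunctorHom _ _ => j.app S z) this
  · intro f
    have := fun Q : C.QuasiCoherentQuotient => exists_tilde_factor c d hA hB (Q.π.comp f)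
    -- The chosen factorizations need not be related to each other. The resulting morphisms on A ⊗̃
    -- B are nevertheless compatible, because each is determined by its restriction to A ⊗ B.
    choose q q' k hk using this
    obtain ⟨G, hG⟩ := hC.exists_hom (fun Q => (qcMap (k Q)).comp (rhoHom c d hA hB (q Q) (q' Q)))
      fun Q Q' g hg => tilde_algFunctorHom_ext c d hA hB (by
        rw [comp_assoc, hk, hk, ← comp_assoc, hg])
    refine ⟨G, AlgFunctorHom.ext_app fun S _ _ x => hC.eq_of_forall fun Q => ?_⟩
    have : Q.π.comp (G.comp (tildeIncl c d hA hB)) = Q.π.comp f := by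
      rw [← comp_assoc, hG, hk]
    exact congrArg (fun j : AlgFunctorHom _ _ => j.app S x) this

end Tilde

end AlgFunctor

end

theorem mainTheorem5 {R : Type u} [CommRing R]
    (A : AlgFunctor.{u, w₁} R) (B : AlgFunctor.{u, w₂} R)
    (hA : A.toMod.EssentiallyFree) (hB : B.toMod.EssentiallyFree)
    (hA' : A.ProQuasiCoherent) (hB' : B.ProQuasiCoherent) :
    (A.toMod.tildeTensor B.toMod).EssentiallyFree ∧
    ∃ (𝒮 : ModFunctor.AlgebraStructure (A.toMod.tildeTensor B.toMod))
      (ι : AlgFunctorHom (A.tensor B) 𝒮.toAlgFunctor),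
      (∀ (S : Type u) [CommRing S] [Algebra R S] (x : (A.tensor B).obj S),
        ι.app S x = (ModFunctor.toTilde A.toMod B.toMod).app S x) ∧
      (∀ (𝒮' : ModFunctor.AlgebraStructure (A.toMod.tildeTensor B.toMod))
        (ι' : AlgFunctorHom (A.tensor B) 𝒮'.toAlgFunctor),
        (∀ (S : Type u) [CommRing S] [Algebra R S] (x : (A.tensor B).obj S),
          ι'.app S x = (ModFunctor.toTilde A.toMod B.toMod).app S x) → 𝒮' = 𝒮) ∧
      𝒮.toAlgFunctor.ProQuasiCoherent ∧
      ∀ C : AlgFunctor.{u, w₃} R, C.ProQuasiCoherent →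
        Function.Bijective
          (fun φ : AlgFunctorHom 𝒮.toAlgFunctor C => φ.comp ι) := by
  obtain ⟨I, P, ⟨c⟩⟩ := hA.exists_coordinates
  obtain ⟨J, P', ⟨d⟩⟩ := hB.exists_coordinates
  have := AlgFunctor.small_carrier c
  have := AlgFunctor.small_carrier d
  exact ⟨hA.tildeTensor hB, AlgFunctor.tildeStructure c d hA' hB',
    AlgFunctor.tildeIncl c d hA' hB', fun _ _ _ _ => rfl,
    AlgFunctor.tildeStructure_unique c d hA' hB', AlgFunctor.proQuasiCoherent_tilde c d hA' hB',
    fun _ hC => AlgFunctor.bijective_comp_tildeIncl c d hA' hB' hC⟩
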